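/- **Theorem.** Let $\nu$ be a place of $\mathbf{Q}$ (real or a prime $p$), $|\cdot|_\nu$ the usual absolute value of $\mathbf{Q}_\nu$ (with $|p|_p=1/p$), $dx$ Lebesgue measure on $\mathbf{R}$, respectively the Haar measure of $\mathbf{Q}_p$ giving $\mathbf{Z}_p$ volume $1$, and $\widetilde\varphi(x)=\int_{\mathbf{Q}_\nu}\varphi(t)\,\psi_\nu(-tx)\,dt$ the Fourier transform, where $\psi_\infty(x)=e^{2\pi i x}$ and $\psi_p(x)=e^{2\pi i\{x\}_p}$. Test functions are Schwartz functions on $\mathbf{R}$, respectively locally constant compactly supported functions on $\mathbf{Q}_p$; distributions are tempered distributions on $\mathbf{R}$, respectively linear forms on the test functions on $\mathbf{Q}_p$; for a distribution $T$ and a test function $\varphi$, $(T*\varphi)(y)=T(x\mapsto\varphi(y-x))$ is additive convolution on $\mathbf{Q}_\nu$. Let $L_\nu(s)=\pi^{-s/2}\Gamma(s/2)$ if $\nu$ is real, $L_p(s)=(1-p^{-s})^{-1}$, and $\Gamma_\nu(s)=L_\nu(s)/L_\nu(1-s)$. 1. There is a family of distributions $\Delta_s$, weakly meromorphic in $s\in\mathbf{C}$,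 with $\Delta_s(\varphi)=\int\varphi(x)|x|_\nu^{s-1}dx$ (absolutely convergent) for $\mathrm{Re}(s)>0$. The quotient $R_s=\Delta_s/\Gamma_\nu(s)$ extends (through removable singularities) to a weakly holomorphic family of distributions on $\mathrm{Re}(s)<1$. The function $-\log|x|_\nu$ has a Fourier transform $G_\nu$, the distribution $G_\nu(\varphi)=\int(-\log|x|_\nu)\,\widetilde\varphi(x)\,dx$ (absolutely convergent). For every test function $\varphi$, $\frac{\partial}{\partial s}\big|_{s=0}R_s(\varphi)=G_\nu(\varphi)$. 2. Let $g:(0,\infty)\to\mathbf{C}$ be smooth with compact support, $\widehat g(s)=\int_0^\infty g(u)u^{s}\frac{du}{u}$, and let $g_\nu$ be the test function $x\mapsto g(|x|_\nu)$ (equal to $0$ at $x=0$). For every $c>0$ the integral $$W_\nu(g)=\frac1{2\pi i}\int_{\mathrm{Re}(s)=c}-\frac{L_\nu'(s)}{L_\nu(s)}\bigl(\widehat g(s)+\widehat g(1-s)\bigr)\,ds$$ converges absolutely, and $$W_\nu(g)=\frac{\partial}{\partial s}\Big|_{s=0}(R_s*g_\nu)(1)=(G_\nu*g_\nu)(1).$$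 3. More generally, for $0<c<1$ and every $y\in\mathbf{Q}_\nu$, $y\neq0$, the integral $$W_\nu(g;y)=\frac1{2\pi i}\int_{\mathrm{Re}(s)=c}-\frac{\Gamma_\nu'(s)}{\Gamma_\nu(s)}\,\widehat g(s)\,|y|_\nu^{-s}\,ds$$ converges absolutely, and $$W_\nu(g;y)=-\log(|y|_\nu)\,g_\nu(y)+(G_\nu*g_\nu)(y).$$ -/

import Mathlib

open MeasureTheory Filter Topology Set
open scoped SchwartzMap Distributions ContDiff

noncomputable section

namespace WeilLocal

/-! ### The completions of the rational numbers -/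

/-- The places of `ℚ`: the archimedean one and the prime numbers. -/
inductive Place : Type
  | real : Place
  | finite (p : Nat.Primes) : Place

instance factPrime (p : Nat.Primes) : Fact (p : ℕ).Prime := ⟨p.2⟩

/-- The completion `ℚ_ν`. -/
def Completion : Place → Type
  | .real => ℝ
  | .finite p => ℚ_[p]

/-- The norm is the usual absolute value at the real place, and the `p`-adic one with
`‖p‖ = 1 / p` at `p`. -/
instance instNormedField : (v : Place) → NormedField (Completion v)
  | .real => inferInstanceAs (NormedField ℝ)
  | .finite p => inferInstanceAs (NormedField ℚ_[p])

instance instMeasurableSpacePadic (p : Nat.Primes) : MeasurableSpace ℚ_[p] := borel _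

instance instBorelSpacePadic (p : Nat.Primes) : BorelSpace ℚ_[p] := ⟨rfl⟩

instance instMeasurableSpace : (v : Place) → MeasurableSpace (Completion v)
  | .real => inferInstanceAs (MeasurableSpace ℝ)
  | .finite p => inferInstanceAs (MeasurableSpace ℚ_[p])

/-- The closed unit ball `ℤ_p` of `ℚ_p`, a compact set with non-empty interior. -/
def padicUnitBall (p : Nat.Primes) : TopologicalSpace.PositiveCompacts ℚ_[p] where
  carrier := Metric.closedBall 0 1
  isCompact' := isCompact_closedBall 0 1
  interior_nonempty' := ⟨0, mem_interior_iff_mem_nhds.2 (Metric.closedBall_mem_nhds 0 one_pos)⟩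

/-- The self-dual additive Haar measure: Lebesgue measure on `ℝ`, and the Haar measure on `ℚ_p`
that gives `ℤ_p` volume one. -/
def haar : (v : Place) → Measure (Completion v)
  | .real => (volume : Measure ℝ)
  | .finite p => (Measure.addHaarMeasure (padicUnitBall p) : Measure ℚ_[p])

/-! ### The basic additive characters -/

/-- Every `p`-adic number is congruent modulo `ℤ_p` to some `a / p ^ n`. -/
theorem exists_fract (p : Nat.Primes) (x : ℚ_[p]) :
    ∃ q : ℤ × ℕ, ‖x - (q.1 : ℚ_[p]) / (p : ℚ_[p]) ^ q.2‖ ≤ 1 := by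
  have hp : (1 : ℝ) < (p : ℕ) := by exact_mod_cast p.2.one_lt
  have hp0 : ((p : ℕ) : ℚ_[p]) ≠ 0 := by exact_mod_cast p.2.ne_zero
  obtain ⟨n, hn⟩ := pow_unbounded_of_one_lt ‖x‖ hp
  have hnorm : ‖((p : ℕ) : ℚ_[p]) ^ n‖ = ((p : ℕ) : ℝ)⁻¹ ^ n := by
    rw [norm_pow, Padic.norm_p]
  have hpos : (0 : ℝ) < ((p : ℕ) : ℝ) ^ n := by positivity
  have hy : ‖((p : ℕ) : ℚ_[p]) ^ n * x‖ ≤ 1 := by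
    rw [norm_mul, hnorm, inv_pow, inv_mul_le_iff₀ hpos, mul_one]
    exact hn.le
  set y : ℤ_[p] := ⟨((p : ℕ) : ℚ_[p]) ^ n * x, hy⟩ with hydef
  have hspec := PadicInt.appr_spec n y
  rw [← PadicInt.norm_le_pow_iff_mem_span_pow] at hspec
  refine ⟨((y.appr n : ℤ), n), ?_⟩
  have hpn : ((p : ℕ) : ℚ_[p]) ^ n ≠ 0 := pow_ne_zero _ hp0
  have heq : x - (((y.appr n : ℕ) : ℤ) : ℚ_[p]) / ((p : ℕ) : ℚ_[p]) ^ n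
      = (((p : ℕ) : ℚ_[p]) ^ n)⁻¹ * ((y - (y.appr n : ℤ_[p]) : ℤ_[p]) : ℚ_[p]) := by
    rw [PadicInt.coe_sub, hydef]
    push_cast
    field_simp
  change ‖x - (((y.appr n : ℕ) : ℤ) : ℚ_[p]) / ((p : ℕ) : ℚ_[p]) ^ n‖ ≤ 1
  rw [heq, norm_mul, norm_inv, hnorm, inv_pow, inv_inv]
  rw [PadicInt.norm_def] at hspec
  calc _ ≤ ((p : ℕ) : ℝ) ^ n * ((p : ℕ) : ℝ) ^ (-n : ℤ) := by gcongr
    _ = 1 := by rw [zpow_neg, zpow_natCast, mul_inv_cancel₀ hpos.ne']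

/-- A rational number `a / p ^ n` that is a `p`-adic integer is an integer. -/
theorem exists_int_of_norm_le (p : Nat.Primes) (a : ℤ) (n : ℕ)
    (h : ‖(a : ℚ_[p]) / (p : ℚ_[p]) ^ n‖ ≤ 1) : ∃ k : ℤ, (a : ℝ) / (p : ℝ) ^ n = k := by
  have hp0 : (0 : ℝ) < ((p : ℕ) : ℝ) := by exact_mod_cast p.2.pos
  have hpos : (0 : ℝ) < ((p : ℕ) : ℝ) ^ n := by positivity
  rw [norm_div, norm_pow, Padic.norm_p, inv_pow, div_inv_eq_mul, ← le_div_iff₀ hpos, one_div,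
    ← zpow_natCast, ← zpow_neg, Padic.norm_int_le_pow_iff_dvd] at h
  obtain ⟨k, hk⟩ := h
  refine ⟨k, ?_⟩
  rw [hk]
  push_cast
  field_simp

/-- `exp (2 π i {x}_p)`, where `{x}_p ∈ ℤ[1/p] / ℤ` is the class of `x` modulo `ℤ_p`. -/
def padicCharFun (p : Nat.Primes) (x : ℚ_[p]) : Circle :=
  Real.fourierChar (((exists_fract p x).choose.1 : ℝ) / (p : ℝ) ^ (exists_fract p x).choose.2)

/-- The value does not depend on the representative `a / p ^ n` of `x` modulo `ℤ_p`. -/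
theorem padicCharFun_eq (p : Nat.Primes) (x : ℚ_[p]) (a : ℤ) (n : ℕ)
    (h : ‖x - (a : ℚ_[p]) / (p : ℚ_[p]) ^ n‖ ≤ 1) :
    padicCharFun p x = Real.fourierChar ((a : ℝ) / (p : ℝ) ^ n) := by
  have hp0 : ((p : ℕ) : ℚ_[p]) ≠ 0 := by exact_mod_cast p.2.ne_zero
  have hp0' : ((p : ℕ) : ℝ) ≠ 0 := by exact_mod_cast p.2.ne_zero
  set q := (exists_fract p x).choose with hq
  have hqs : ‖x - (q.1 : ℚ_[p]) / (p : ℚ_[p]) ^ q.2‖ ≤ 1 := (exists_fract p x).choose_spec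
  have key : ‖((q.1 * (p : ℤ) ^ n - a * (p : ℤ) ^ q.2 : ℤ) : ℚ_[p]) /
      (p : ℚ_[p]) ^ (q.2 + n)‖ ≤ 1 := by
    have : ((q.1 * (p : ℤ) ^ n - a * (p : ℤ) ^ q.2 : ℤ) : ℚ_[p]) / (p : ℚ_[p]) ^ (q.2 + n)
        = (x - (a : ℚ_[p]) / (p : ℚ_[p]) ^ n) - (x - (q.1 : ℚ_[p]) / (p : ℚ_[p]) ^ q.2) := by
      push_cast
      field_simp
      ring
    rw [this]
    rw [sub_eq_add_neg (x - (a : ℚ_[p]) / (p : ℚ_[p]) ^ n)]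
    refine (Padic.nonarchimedean _ _).trans (max_le h ?_)
    rwa [norm_neg]
  obtain ⟨k, hk⟩ := exists_int_of_norm_le p _ _ key
  have hsum : (q.1 : ℝ) / (p : ℝ) ^ q.2 = (a : ℝ) / (p : ℝ) ^ n + k := by
    rw [← hk]
    push_cast
    field_simp
    ring
  have h1 : Real.fourierChar (k : ℝ) = 1 := by
    ext
    rw [Real.fourierChar_apply]
    rw [Circle.coe_one, Complex.exp_eq_one_iff]
    exact ⟨k, by push_cast; ring⟩
  change Real.fourierChar ((q.1 : ℝ) / (p : ℝ) ^ q.2) = _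
  rw [hsum, AddChar.map_add_eq_mul, h1, mul_one]

/-- The standard additive character `x ↦ exp (2 π i {x}_p)` of `ℚ_p`. -/
def padicChar (p : Nat.Primes) : AddChar ℚ_[p] Circle where
  toFun := padicCharFun p
  map_zero_eq_one' := by
    rw [padicCharFun_eq p 0 0 0 (by simp)]
    simp
  map_add_eq_mul' x y := by
    have hp0 : ((p : ℕ) : ℚ_[p]) ≠ 0 := by exact_mod_cast p.2.ne_zero
    have hp0' : ((p : ℕ) : ℝ) ≠ 0 := by exact_mod_cast p.2.ne_zero
    obtain ⟨⟨a, n⟩, ha⟩ := exists_fract p x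
    obtain ⟨⟨b, m⟩, hb⟩ := exists_fract p y
    have hab : ‖x + y - ((a * (p : ℤ) ^ m + b * (p : ℤ) ^ n : ℤ) : ℚ_[p]) /
        (p : ℚ_[p]) ^ (n + m)‖ ≤ 1 := by
      have : x + y - ((a * (p : ℤ) ^ m + b * (p : ℤ) ^ n : ℤ) : ℚ_[p]) / (p : ℚ_[p]) ^ (n + m)
          = (x - (a : ℚ_[p]) / (p : ℚ_[p]) ^ n) + (y - (b : ℚ_[p]) / (p : ℚ_[p]) ^ m) := by
        push_cast
        field_simp
        ring
      rw [this]
      exact (Padic.nonarchimedean _ _).trans (max_le ha hb)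
    rw [padicCharFun_eq p x a n ha, padicCharFun_eq p y b m hb, padicCharFun_eq p _ _ _ hab,
      ← AddChar.map_add_eq_mul]
    congr 1
    push_cast
    field_simp
    ring

/-- The basic additive character of `ℚ_ν`: `exp (2 π i x)` on `ℝ`, `exp (2 π i {x}_p)` on
`ℚ_p`. -/
def basicChar : (v : Place) → AddChar (Completion v) Circle
  | .real => Real.fourierChar
  | .finite p => padicChar p

/-- The additive Fourier transform on `ℚ_ν`, `f ↦ (x ↦ ∫ ψ (-(t x)) f t dt)`. -/
def localFourier (v : Place) (f : Completion v → ℂ) : Completion v → ℂ :=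
  Fourier.fourierIntegral (basicChar v) (haar v) f

/-! ### Test functions and distributions -/

/-- Locally constant functions with compact support on `ℚ_p`. -/
def bruhatSpace (p : Nat.Primes) : Submodule ℂ (ℚ_[p] → ℂ) where
  carrier := {f | IsLocallyConstant f ∧ HasCompactSupport f}
  add_mem' hf hg := ⟨hf.1.add hg.1, hf.2.add hg.2⟩
  zero_mem' := ⟨IsLocallyConstant.const 0, HasCompactSupport.zero⟩
  smul_mem' c _ hf := ⟨hf.1.comp (fun z => c • z), hf.2.comp_left (smul_zero c)⟩

/-- The Schwartz-Bruhat test functions on `ℚ_ν`. -/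
def SchwartzBruhat : Place → Type
  | .real => 𝓢(ℝ, ℂ)
  | .finite p => bruhatSpace p

/-- The function on `ℚ_ν` underlying a test function. -/
def SchwartzBruhat.toFun : {v : Place} → SchwartzBruhat v → Completion v → ℂ
  | .real, φ => fun x : ℝ => (show 𝓢(ℝ, ℂ) from φ) x
  | .finite p, φ => (show bruhatSpace p from φ).1

instance (v : Place) : CoeFun (SchwartzBruhat v) (fun _ => Completion v → ℂ) :=
  ⟨SchwartzBruhat.toFun⟩

/-- Distributions on `ℚ_ν`: tempered distributions on `ℝ`, and linear forms on the space of
locally constant functions with compact support on `ℚ_p`. -/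
def LocalDistribution : Place → Type
  | .real => 𝓢(ℝ, ℂ) →L[ℂ] ℂ
  | .finite p => bruhatSpace p →ₗ[ℂ] ℂ

/-- The value of a distribution at a test function. -/
def LocalDistribution.eval : {v : Place} → LocalDistribution v → SchwartzBruhat v → ℂ
  | .real, T, φ => (show 𝓢(ℝ, ℂ) →L[ℂ] ℂ from T) (show 𝓢(ℝ, ℂ) from φ)
  | .finite p, T, φ => (show bruhatSpace p →ₗ[ℂ] ℂ from T) (show bruhatSpace p from φ)

instance (v : Place) : CoeFun (LocalDistribution v) (fun _ => SchwartzBruhat v → ℂ) :=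
  ⟨LocalDistribution.eval⟩

theorem bruhat_reflect_mem (p : Nat.Primes) (f : ℚ_[p] → ℂ) (hf : f ∈ bruhatSpace p)
    (y : ℚ_[p]) : (fun x => f (y - x)) ∈ bruhatSpace p :=
  ⟨hf.1.comp_continuous (continuous_const.sub continuous_id),
    hf.2.comp_homeomorph (Homeomorph.subLeft y)⟩

/-- The test function `x ↦ φ (y - x)`. -/
def reflectAt : {v : Place} → SchwartzBruhat v → Completion v → SchwartzBruhat v
  | .real, φ, y => SchwartzMap.compSubConstCLM ℂ (show ℝ from y)
      (SchwartzMap.compCLMOfContinuousLinearEquiv ℂ (ContinuousLinearEquiv.neg ℝ)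
        (show 𝓢(ℝ, ℂ) from φ))
  | .finite p, φ, y => ⟨_, bruhat_reflect_mem p _ (show bruhatSpace p from φ).2 y⟩

theorem reflectAt_apply {v : Place} (φ : SchwartzBruhat v) (y x : Completion v) :
    reflectAt φ y x = φ (y - x) := by
  cases v with
  | real =>
    let φ' : 𝓢(ℝ, ℂ) := φ
    change φ' (-((show ℝ from x) - (show ℝ from y))) = φ' ((show ℝ from y) - (show ℝ from x))
    rw [neg_sub]
  | finite p => rfl

/-- The additive convolution `(T * φ) (y) = T (x ↦ φ (y - x))` on `ℚ_ν`. -/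
def addConv {v : Place} (T : LocalDistribution v) (φ : SchwartzBruhat v) (y : Completion v) : ℂ :=
  T (reflectAt φ y)

/-! ### Lifting functions on the half-line -/

/-- The positive half-line, as an open set. -/
def halfLine : TopologicalSpace.Opens ℝ := ⟨Ioi 0, isOpen_Ioi⟩

theorem eventually_zero_of_nonpos (g : 𝓓(halfLine, ℂ)) {r : ℝ} (hr : r ≤ 0) :
    ∀ᶠ u in 𝓝 r, g u = 0 := by
  have h : r ∉ tsupport g := fun h => absurd (g.tsupport_subset h) (not_lt.2 hr)
  exact notMem_tsupport_iff_eventuallyEq.1 h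

theorem contDiff_comp_abs (g : 𝓓(halfLine, ℂ)) : ContDiff ℝ ∞ (fun x : ℝ => g |x|) := by
  rw [contDiff_iff_contDiffAt]
  intro x
  by_cases hx : x = 0
  · subst hx
    have h0 : ∀ᶠ u in 𝓝 |(0 : ℝ)|, g u = 0 := by
      rw [abs_zero]
      exact eventually_zero_of_nonpos g le_rfl
    have h1 : ∀ᶠ x : ℝ in 𝓝 0, g |x| = 0 := (continuous_abs.tendsto (0 : ℝ)).eventually h0
    exact (contDiffAt_const (c := (0 : ℂ))).congr_of_eventuallyEq h1
  · exact g.contDiff.contDiffAt.comp x (contDiffAt_abs hx)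

theorem hasCompactSupport_comp_norm (g : 𝓓(halfLine, ℂ)) {K : Type*} [NormedField K]
    [ProperSpace K] : HasCompactSupport (fun x : K => g ‖x‖) := by
  obtain ⟨C, hC⟩ := g.hasCompactSupport.isCompact.isBounded.subset_closedBall 0
  refine HasCompactSupport.intro (isCompact_closedBall (0 : K) C) fun x hx => ?_
  by_contra h
  have := hC (subset_tsupport _ h)
  simp only [Metric.mem_closedBall, dist_zero_right, norm_norm] at this hx
  exact hx this

theorem isLocallyConstant_comp_norm (p : Nat.Primes) (g : 𝓓(halfLine, ℂ)) :
    IsLocallyConstant (fun x : ℚ_[p] => g ‖x‖) := by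
  rw [IsLocallyConstant.iff_eventually_eq]
  intro x
  by_cases hx : x = 0
  · subst hx
    have h0 : ∀ᶠ u in 𝓝 ‖(0 : ℚ_[p])‖, g u = 0 := by
      rw [norm_zero]
      exact eventually_zero_of_nonpos g le_rfl
    have h1 : ∀ᶠ y : ℚ_[p] in 𝓝 0, g ‖y‖ = 0 := (continuous_norm.tendsto _).eventually h0
    filter_upwards [h1] with y hy
    rw [hy, h1.self_of_nhds]
  · filter_upwards [Metric.ball_mem_nhds x (norm_pos_iff.2 hx)] with y hy
    have hxy : ‖y - x‖ < ‖x‖ := by rwa [Metric.mem_ball, dist_eq_norm] at hy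
    have h2 := Padic.add_eq_max_of_ne (p := p) (q := y - x) (r := x) hxy.ne
    rw [sub_add_cancel, max_eq_right hxy.le] at h2
    rw [h2]

/-- The test function `g_ν : x ↦ g (|x|_ν)` on `ℚ_ν`. -/
def liftTo : (v : Place) → 𝓓(halfLine, ℂ) → SchwartzBruhat v
  | .real, g => HasCompactSupport.toSchwartzMap (f := fun x : ℝ => g |x|)
      (hasCompactSupport_comp_norm g (K := ℝ)) (contDiff_comp_abs g)
  | .finite p, g => ⟨fun x => g ‖x‖, isLocallyConstant_comp_norm p g,
      hasCompactSupport_comp_norm g⟩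

theorem liftTo_apply (v : Place) (g : 𝓓(halfLine, ℂ)) (x : Completion v) :
    liftTo v g x = g ‖x‖ := by
  cases v <;> rfl

/-! ### Local factors and the Weil terms -/

/-- The local Euler factor of the Riemann zeta function: `π ^ (-s / 2) Γ (s / 2)` at the real
place, `1 / (1 - p ^ (-s))` at `p`. -/
def eulerFactor : Place → ℂ → ℂ
  | .real, s => (Real.pi : ℂ) ^ (-s / 2) * Complex.Gamma (s / 2)
  | .finite p, s => 1 / (1 - (p : ℂ) ^ (-s))

/-- The Tate-Gel'fand-Graev gamma function `Γ_ν (s) = L_ν (s) / L_ν (1 - s)`. -/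
def tateGamma (v : Place) (s : ℂ) : ℂ := eulerFactor v s / eulerFactor v (1 - s)

/-- The integrand of `W_ν (g)`. -/
def weilIntegrand (v : Place) (g : 𝓓(halfLine, ℂ)) (s : ℂ) : ℂ :=
  -logDeriv (eulerFactor v) s * (mellin g s + mellin g (1 - s))

/-- The integrand of `W_ν (g; y)`. -/
def weilIntegrandAt (v : Place) (g : 𝓓(halfLine, ℂ)) (y : Completion v) (s : ℂ) : ℂ :=
  -logDeriv (tateGamma v) s * mellin g s * (‖y‖ : ℂ) ^ (-s)

/-- Absolute convergence of `∫_{Re s = c} F (s) ds`. -/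
def LineIntegrable (c : ℝ) (F : ℂ → ℂ) : Prop :=
  Integrable fun t : ℝ => F (c + t * Complex.I)

/-- `(1 / (2 π i)) ∫_{Re s = c} F (s) ds`, with `s = c + i t` and `ds = i dt`. -/
def lineIntegral (c : ℝ) (F : ℂ → ℂ) : ℂ :=
  1 / (2 * Real.pi * Complex.I) * ∫ t : ℝ, F (c + t * Complex.I) * Complex.I

/-- Weil's local term `W_ν (g)`, computed on the line `Re s = c`. -/
def weilTerm (v : Place) (c : ℝ) (g : 𝓓(halfLine, ℂ)) : ℂ :=
  lineIntegral c (weilIntegrand v g)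

/-- The function `W_ν (g; y)`, computed on the line `Re s = c`. -/
def weilTermAt (v : Place) (c : ℝ) (g : 𝓓(halfLine, ℂ)) (y : Completion v) : ℂ :=
  lineIntegral c (weilIntegrandAt v g y)

/-! ### The homogeneous distributions, the Riesz kernels, and the transform of `-log |x|` -/

/-- `Δ` is the family `Δ_s` of homogeneous distributions: it is `|x| ^ (s - 1)` for `Re s > 0`,
continued meromorphically to the whole plane. (Values at the poles are irrelevant.) -/
structure IsHomogeneousFamily (v : Place) (Δ : ℂ → LocalDistribution v) : Prop where
  integrable : ∀ s : ℂ, 0 < s.re → ∀ φ : SchwartzBruhat v,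
    Integrable (fun x => φ x * (‖x‖ : ℂ) ^ (s - 1)) (haar v)
  eq_integral : ∀ s : ℂ, 0 < s.re → ∀ φ : SchwartzBruhat v,
    Δ s φ = ∫ x, φ x * (‖x‖ : ℂ) ^ (s - 1) ∂(haar v)
  meromorphic : ∀ φ : SchwartzBruhat v, ∀ s : ℂ, MeromorphicAt (fun z => Δ z φ) s

/-- `R` is the kernel `R_s = Δ_s / Γ_ν (s)`, holomorphic in `Re s < 1`: the quotient, with its
removable singularities filled in. -/
structure IsRieszKernel (v : Place) (Δ R : ℂ → LocalDistribution v) : Prop where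
  holomorphic : ∀ φ : SchwartzBruhat v, DifferentiableOn ℂ (fun s => R s φ) {s | s.re < 1}
  eq_quotient : ∀ φ : SchwartzBruhat v, ∀ s₀ : ℂ, s₀.re < 1 →
    ∀ᶠ s in 𝓝[≠] s₀, R s φ = Δ s φ / tateGamma v s

/-- `G` is the Fourier transform of the locally integrable function `-log |x|`, as a
distribution: its value at `φ` is the integral of `-log |x|` against the transform of `φ`. -/
structure IsFourierOfNegLog (v : Place) (G : LocalDistribution v) : Prop where
  integrable : ∀ φ : SchwartzBruhat v,
    Integrable (fun x => -(Real.log ‖x‖ : ℂ) * localFourier v φ x) (haar v)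
  eq_integral : ∀ φ : SchwartzBruhat v,
    G φ = ∫ x, -(Real.log ‖x‖ : ℂ) * localFourier v φ x ∂(haar v)

end WeilLocal

end

/-!
# Weil's local terms and the Fourier transform of `-log |x|`

Everything rests on Tate's local functional equation. For a test function `φ` write
`Z (φ, s) = ∫ φ (x) |x| ^ (s - 1) dx` (`zetaIntegral`); on the strip `0 < Re s < 1`

  `Z (φ, s) = Γ_ν (s) Z (φ̂, 1 - s)`   (`zetaIntegral_mul_invEuler`),

which holds more generally for integrable `φ` as soon as both sides converge. Hence `Δ_s (φ)` is
continued by `Γ_ν (s) Z (φ̂, 1 - s)`, the Riesz kernel is `R_s (φ) = Z (φ̂, 1 - s)`, holomorphic for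
`Re s < 1`, and its derivative at `s = 0` is the integral of `-log |x|` against `φ̂`, that is
`G_ν (φ)` (`IsRieszKernel.hasDerivAt`).

For the Weil terms take `φ = g_ν`, and put `A = G_ν * φ`. As `φ` is radial, `A` is the Fourier
transform of `B (x) = -log |x| φ̂ (x)` (`IsFourierOfNegLog.addConv_eq`). Moreover
`A (y) = O (1 / |y|)`, because away from the origin `G_ν` is a multiple of `1 / |x|`
(`IsFourierOfNegLog.mul_invEuler_one`), so the functional equation applies to `B` and gives
`Z (A, s) = Γ_ν (s) R_s' (φ)`. Comparing with the derivative in `s` of `Z (φ, s) = Γ_ν (s) R_s (φ)`,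

  `Z (A - log |x| φ, s) = -(Γ_ν' / Γ_ν) (s) Z (φ, s)`   (`IsFourierOfNegLog.zetaIntegral_addConv`).

This is the identity for `W_ν (g; y)` after a Mellin transform. On `ℝ` the zeta integral of an even
function is twice its Mellin transform, and Mellin inversion concludes (`weilTermAt_real`). On `ℚ_p`
all the factors except `ĝ` are Laurent series in `p ^ (-s)`; the identity above determines the
values of `A - log |x| φ` at the powers of `p` as a finite convolution of the coefficients of
`-Γ_p' / Γ_p` with the values `g (p ^ m)`, and Mellin inversion of `ĝ`, applied term by term, shows
that `W_p (g; y)` is the same convolution (`weilTermAt_finite`).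

The absolute convergence of the line integrals follows from the rapid decay of `ĝ` on vertical
strips and a linear bound for `L_ν' / L_ν` (`exists_norm_logDeriv_eulerFactor_le`). The case of
`W_ν (g)` is reduced to `W_ν (g; 1)` by moving the line to `Re s = 1 / 2`, where `s ↦ 1 - s` is
complex conjugation (`weilTerm_eq`, `weilTerm_half_eq`).
-/

namespace WeilLocal

variable {v : Place}

/-! ### Haar measure on `ℚ_p` -/

lemma one_lt_prime (p : Nat.Primes) : (1 : ℝ) < (p : ℕ) := by exact_mod_cast p.2.one_lt

lemma prime_pos (p : Nat.Primes) : (0 : ℝ) < (p : ℕ) := one_pos.trans (one_lt_prime p)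

instance (p : Nat.Primes) : (Measure.addHaarMeasure (padicUnitBall p)).IsAddHaarMeasure :=
  Measure.isAddHaarMeasure_addHaarMeasure _

lemma padic_haar_unitBall (p : Nat.Primes) :
    Measure.addHaarMeasure (padicUnitBall p) (Metric.closedBall 0 1) = 1 :=
  Measure.addHaarMeasure_self (K₀ := padicUnitBall p)

/-- A ball of `ℚ_p` is the disjoint union of `p` balls of the next smaller radius, one for each
digit. -/
lemma padic_closedBall_eq_iUnion (p : Nat.Primes) (m : ℤ) :
    Metric.closedBall (0 : ℚ_[p]) ((p : ℝ) ^ (m + 1)) =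
      ⋃ i : Fin p, Metric.closedBall (((i : ℕ) : ℚ_[p]) * (p : ℚ_[p]) ^ (-(m + 1)))
        ((p : ℝ) ^ m) := by
  have hp0 : ((p : ℕ) : ℚ_[p]) ≠ 0 := by exact_mod_cast p.2.ne_zero
  have hp := prime_pos p
  have hn : ∀ k : ℤ, ‖((p : ℕ) : ℚ_[p]) ^ k‖ = ((p : ℕ) : ℝ) ^ (-k) := fun k => by
    rw [norm_zpow, Padic.norm_p, inv_zpow, zpow_neg]
  ext x
  rw [mem_closedBall_zero_iff, mem_iUnion]
  simp only [Metric.mem_closedBall, dist_eq_norm]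
  constructor
  · intro hx
    have hy : ‖((p : ℕ) : ℚ_[p]) ^ (m + 1) * x‖ ≤ 1 := by
      rw [norm_mul, hn, zpow_neg, inv_mul_le_iff₀ (by positivity), mul_one]
      exact hx
    obtain ⟨n, hnp, hmem⟩ := PadicInt.exists_mem_range (p := p) ⟨_, hy⟩
    refine ⟨⟨n, hnp⟩, ?_⟩
    have h1 : ‖((p : ℕ) : ℚ_[p]) ^ (m + 1) * x - (n : ℚ_[p])‖ < 1 := by
      have := (PadicInt.mem_nonunits.1 ((IsLocalRing.mem_maximalIdeal _).1 hmem))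
      rw [PadicInt.norm_def] at this
      exact_mod_cast this
    have h2 : ‖((p : ℕ) : ℚ_[p]) ^ (m + 1) * x - (n : ℚ_[p])‖ ≤ ((p : ℕ) : ℝ) ^ (-1 : ℤ) := by
      have := (Padic.norm_le_pow_iff_norm_lt_pow_add_one
        (((p : ℕ) : ℚ_[p]) ^ (m + 1) * x - (n : ℚ_[p])) (-1)).2
      simp only [neg_add_cancel, zpow_zero] at this
      exact this h1
    have h3 : x - ((n : ℕ) : ℚ_[p]) * (p : ℚ_[p]) ^ (-(m + 1))
        = (p : ℚ_[p]) ^ (-(m + 1)) * (((p : ℕ) : ℚ_[p]) ^ (m + 1) * x - (n : ℚ_[p])) := by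
      rw [mul_sub, ← mul_assoc, ← zpow_add₀ hp0]
      simp [mul_comm]
    change ‖x - ((n : ℕ) : ℚ_[p]) * (p : ℚ_[p]) ^ (-(m + 1))‖ ≤ _
    rw [h3, norm_mul, hn, neg_neg]
    calc _ ≤ ((p : ℕ) : ℝ) ^ (m + 1) * ((p : ℕ) : ℝ) ^ (-1 : ℤ) := by gcongr
      _ = _ := by rw [← zpow_add₀ hp.ne']; simp
  · rintro ⟨i, hi⟩
    have h1 : ‖((i : ℕ) : ℚ_[p]) * (p : ℚ_[p]) ^ (-(m + 1))‖ ≤ ((p : ℕ) : ℝ) ^ (m + 1) := by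
      rw [norm_mul, hn, neg_neg]
      exact mul_le_of_le_one_left (by positivity) (IsUltrametricDist.norm_natCast_le_one _ _)
    have h2 := Padic.nonarchimedean (p := p) (x - ((i : ℕ) : ℚ_[p]) * (p : ℚ_[p]) ^ (-(m + 1)))
      (((i : ℕ) : ℚ_[p]) * (p : ℚ_[p]) ^ (-(m + 1)))
    rw [sub_add_cancel] at h2
    refine h2.trans (max_le (hi.trans ?_) h1)
    exact zpow_le_zpow_right₀ (one_lt_prime p).le (by omega)

lemma padic_closedBall_pairwise_disjoint (p : Nat.Primes) (m : ℤ) :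
    Pairwise (Function.onFun Disjoint fun i : Fin p =>
      Metric.closedBall (((i : ℕ) : ℚ_[p]) * (p : ℚ_[p]) ^ (-(m + 1))) ((p : ℝ) ^ m)) := by
  have hp := prime_pos p
  intro i j hij
  refine Set.disjoint_left.2 fun x hx hy => ?_
  rw [Metric.mem_closedBall, dist_eq_norm] at hx hy
  have h1 : ‖((i : ℕ) : ℚ_[p]) * (p : ℚ_[p]) ^ (-(m + 1)) -
      ((j : ℕ) : ℚ_[p]) * (p : ℚ_[p]) ^ (-(m + 1))‖ ≤ ((p : ℕ) : ℝ) ^ m := by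
    have := Padic.nonarchimedean (p := p) (x - ((j : ℕ) : ℚ_[p]) * (p : ℚ_[p]) ^ (-(m + 1)))
      (-(x - ((i : ℕ) : ℚ_[p]) * (p : ℚ_[p]) ^ (-(m + 1))))
    rw [norm_neg] at this
    refine le_trans (le_of_eq ?_) (this.trans (max_le hy hx))
    congr 1; ring
  have h2 : (((i : ℕ) : ℚ_[p])) - ((j : ℕ) : ℚ_[p]) = (((i : ℕ) - (j : ℕ) : ℤ) : ℚ_[p]) := by
    push_cast; rfl
  have h3 : ‖(((i : ℕ) - (j : ℕ) : ℤ) : ℚ_[p])‖ = 1 := by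
    refine le_antisymm (Padic.norm_int_le_one _) (not_lt.1 fun h => ?_)
    have hd := (Padic.norm_intCast_lt_one_iff (p := p)).1 h
    have hi := i.2
    have hj := j.2
    apply hij
    have := Int.eq_zero_of_abs_lt_dvd hd (by rw [abs_lt]; omega)
    exact Fin.ext (by omega)
  rw [← sub_mul, norm_mul, h2, h3, one_mul, norm_zpow, Padic.norm_p, inv_zpow, zpow_neg,
    inv_inv] at h1
  exact absurd (zpow_lt_zpow_right₀ (one_lt_prime p) (lt_add_one m)) (not_lt.2 h1)

lemma padic_haar_closedBall_succ (p : Nat.Primes) (m : ℤ) :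
    Measure.addHaarMeasure (padicUnitBall p) (Metric.closedBall 0 ((p : ℝ) ^ (m + 1))) =
      (p : ℕ) * Measure.addHaarMeasure (padicUnitBall p) (Metric.closedBall 0 ((p : ℝ) ^ m)) := by
  rw [padic_closedBall_eq_iUnion, measure_iUnion (padic_closedBall_pairwise_disjoint p m)
    (fun _ => measurableSet_closedBall), tsum_fintype]
  have : ∀ a : ℚ_[p], Measure.addHaarMeasure (padicUnitBall p)
      (Metric.closedBall a ((p : ℝ) ^ m)) = Measure.addHaarMeasure (padicUnitBall p)
      (Metric.closedBall 0 ((p : ℝ) ^ m)) := fun a => by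
    rw [← measure_preimage_add _ a (Metric.closedBall a ((p : ℝ) ^ m))]
    congr 1
    ext x
    simp [dist_eq_norm]
  simp [this]

/-- Balls of `ℚ_p` have volume equal to their radius. -/
lemma padic_haar_closedBall (p : Nat.Primes) (m : ℤ) :
    Measure.addHaarMeasure (padicUnitBall p) (Metric.closedBall 0 ((p : ℝ) ^ m)) =
      ENNReal.ofReal ((p : ℝ) ^ m) := by
  have hp := prime_pos p
  have hpe : ((p : ℕ) : ENNReal) = ENNReal.ofReal (p : ℕ) := by simp
  induction m using Int.induction_on with
  | zero => simp [padic_haar_unitBall]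
  | succ n ih =>
    rw [padic_haar_closedBall_succ, ih, hpe, ← ENNReal.ofReal_mul hp.le, zpow_add_one₀ hp.ne',
      mul_comm]
  | pred n ih =>
    have h := padic_haar_closedBall_succ p (-(n : ℤ) - 1)
    rw [sub_add_cancel, ih, ← sub_add_cancel (-(n : ℤ)) 1, zpow_add_one₀ hp.ne', mul_comm,
      ENNReal.ofReal_mul hp.le, ← hpe, sub_add_cancel] at h
    exact ((ENNReal.mul_right_inj (by simp [p.2.ne_zero]) (by simp)).1 h).symm

/-- Multiplication by `a` scales the Haar measure of `ℚ_p` by `‖a‖`. -/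
lemma padic_map_mul_left (p : Nat.Primes) {a : ℚ_[p]} (ha : a ≠ 0) :
    Measure.map (a * ·) (Measure.addHaarMeasure (padicUnitBall p)) =
      ENNReal.ofReal ‖a‖⁻¹ • Measure.addHaarMeasure (padicUnitBall p) := by
  set μ := Measure.addHaarMeasure (padicUnitBall p)
  have : (Measure.map (a * ·) μ).IsAddHaarMeasure :=
    (DistribMulAction.toAddEquiv₀ ℚ_[p] a ha).isAddHaarMeasure_map μ (continuous_const_mul a)
      (continuous_const_mul a⁻¹)
  rw [Measure.addHaarMeasure_unique (Measure.map (a * ·) μ) (padicUnitBall p)]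
  congr 1
  have hpre : (a * ·) ⁻¹' (padicUnitBall p : Set ℚ_[p]) =
      Metric.closedBall 0 ((p : ℝ) ^ a.valuation) := by
    ext x
    rw [mem_preimage, mem_closedBall_zero_iff]
    change a * x ∈ Metric.closedBall (0 : ℚ_[p]) 1 ↔ _
    rw [mem_closedBall_zero_iff, norm_mul, ← le_inv_mul_iff₀ (norm_pos_iff.2 ha), mul_one,
      Padic.norm_eq_zpow_neg_valuation ha, zpow_neg, inv_inv]
  rw [Measure.map_apply (measurable_const_mul a)
    (padicUnitBall p).isCompact.isClosed.measurableSet, hpre, padic_haar_closedBall,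
    Padic.norm_eq_zpow_neg_valuation ha, zpow_neg, inv_inv]

/-! ### The completions as locally compact fields -/

instance instBorelSpaceCompletion : (v : Place) → BorelSpace (Completion v)
  | .real => inferInstanceAs (BorelSpace ℝ)
  | .finite p => inferInstanceAs (BorelSpace ℚ_[p])

instance instProperSpaceCompletion : (v : Place) → ProperSpace (Completion v)
  | .real => inferInstanceAs (ProperSpace ℝ)
  | .finite p => inferInstanceAs (ProperSpace ℚ_[p])

instance instSecondCountableCompletion : (v : Place) → SecondCountableTopology (Completion v)
  | .real => inferInstanceAs (SecondCountableTopology ℝ)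
  | .finite p => inferInstanceAs (SecondCountableTopology ℚ_[p])

instance instNeBotCompletion : (v : Place) → (𝓝[≠] (0 : Completion v)).NeBot
  | .real => inferInstanceAs (𝓝[≠] (0 : ℝ)).NeBot
  | .finite p => inferInstanceAs (𝓝[≠] (0 : ℚ_[p])).NeBot

instance instIsAddHaarMeasureHaar : (v : Place) → (haar v).IsAddHaarMeasure
  | .real => inferInstanceAs (volume : Measure ℝ).IsAddHaarMeasure
  | .finite p => inferInstanceAs (Measure.addHaarMeasure (padicUnitBall p)).IsAddHaarMeasure

lemma ae_ne_zero : ∀ᵐ x ∂haar v, x ≠ 0 := by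
  simp [ae_iff]

lemma map_mul_left_haar {a : Completion v} (ha : a ≠ 0) :
    (haar v).map (a * ·) = ENNReal.ofReal ‖a‖⁻¹ • haar v := by
  cases v with
  | real =>
    have h : ∀ b : ℝ, b ≠ 0 → (volume : Measure ℝ).map (b * ·) = ENNReal.ofReal ‖b‖⁻¹ • volume :=
      fun b hb => by rw [Real.map_volume_mul_left hb, abs_inv, Real.norm_eq_abs]
    exact h a ha
  | finite p => exact padic_map_mul_left p ha

lemma measurableEmbedding_mul_left {a : Completion v} (ha : a ≠ 0) :
    MeasurableEmbedding (a * · : Completion v → Completion v) :=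
  (Homeomorph.mulLeft₀ a ha).measurableEmbedding

lemma integral_comp_mul_left_haar' {E : Type*} [NormedAddCommGroup E] [NormedSpace ℝ E]
    {a : Completion v} (ha : a ≠ 0) (f : Completion v → E) :
    ∫ x, f (a * x) ∂haar v = ‖a‖⁻¹ • ∫ x, f x ∂haar v := by
  rw [← (measurableEmbedding_mul_left ha).integral_map, map_mul_left_haar ha,
    integral_smul_measure, ENNReal.toReal_ofReal (by positivity)]

/-- The change of variables `x ↦ a x`, for complex-valued functions. -/
lemma integral_comp_mul_left_haar {a : Completion v} (ha : a ≠ 0) (f : Completion v → ℂ) :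
    ∫ x, f (a * x) ∂haar v = (‖a‖⁻¹ : ℝ) * ∫ x, f x ∂haar v := by
  rw [integral_comp_mul_left_haar' ha, Complex.real_smul]

lemma integrable_comp_mul_left_haar {a : Completion v} (ha : a ≠ 0) {f : Completion v → ℂ}
    (hf : Integrable f (haar v)) : Integrable (fun x => f (a * x)) (haar v) := by
  have : Integrable f ((haar v).map (a * ·)) := by
    rw [map_mul_left_haar ha]
    exact hf.smul_measure ENNReal.ofReal_ne_top
  exact (measurableEmbedding_mul_left ha).integrable_map_iff.1 this

/-- The volume of a ball is at most proportional to its radius. -/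
lemma exists_haar_closedBall_le (v : Place) :
    ∃ C : ℝ, 0 ≤ C ∧ ∀ r : ℝ, 0 < r →
      haar v (Metric.closedBall 0 r) ≤ ENNReal.ofReal (C * r) := by
  cases v with
  | real =>
    refine ⟨2, by norm_num, fun r _ => ?_⟩
    exact (Real.volume_closedBall (a := 0) (r := r)).le
  | finite p =>
    refine ⟨(p : ℕ), (prime_pos p).le, fun r hr => ?_⟩
    obtain ⟨m, hm⟩ := exists_mem_Ico_zpow hr (one_lt_prime p)
    calc haar (.finite p) (Metric.closedBall 0 r)
        ≤ haar (.finite p) (Metric.closedBall 0 (((p : ℕ) : ℝ) ^ (m + 1))) :=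
          measure_mono (Metric.closedBall_subset_closedBall hm.2.le)
      _ = ENNReal.ofReal (((p : ℕ) : ℝ) ^ (m + 1)) := padic_haar_closedBall p (m + 1)
      _ ≤ _ := by
        apply ENNReal.ofReal_le_ofReal
        rw [zpow_add_one₀ (prime_pos p).ne', mul_comm]
        exact mul_le_mul_of_nonneg_left hm.1 (prime_pos p).le

/-! ### Functions of rapid decay and temperate weights -/

/-- A continuous function that decays faster than any power of the norm. -/
def RapidDecay (f : Completion v → ℂ) : Prop :=
  Continuous f ∧ ∀ N : ℕ, ∃ C : ℝ, ∀ x, (1 + ‖x‖) ^ N * ‖f x‖ ≤ C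

/-- A function that becomes integrable after division by some power of `1 + ‖x‖`: the densities
that can be integrated against functions of rapid decay. -/
def TemperateWeight (w : Completion v → ℂ) : Prop :=
  ∃ N : ℕ, Integrable (fun x => (((1 + ‖x‖) ^ N)⁻¹ : ℝ) * w x) (haar v)

lemma RapidDecay.norm_mul_le {f : Completion v → ℂ} {w : Completion v → ℂ} {N : ℕ} {C : ℝ}
    (hC : ∀ x, (1 + ‖x‖) ^ N * ‖f x‖ ≤ C) (x : Completion v) :
    ‖f x * w x‖ ≤ C * ‖(((1 + ‖x‖) ^ N)⁻¹ : ℝ) * w x‖ := by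
  have h : 0 < (1 + ‖x‖) ^ N := by positivity
  rw [norm_mul, norm_mul, ← mul_assoc, Complex.norm_real, Real.norm_of_nonneg (by positivity)]
  gcongr
  rw [le_mul_inv_iff₀ h, mul_comm]
  exact hC x

lemma TemperateWeight.aestronglyMeasurable {w : Completion v → ℂ} (hw : TemperateWeight w) :
    AEStronglyMeasurable w (haar v) := by
  obtain ⟨N, hN⟩ := hw
  have h : AEStronglyMeasurable (fun x : Completion v => (((1 + ‖x‖) ^ N : ℝ) : ℂ)) (haar v) := by
    refine Continuous.aestronglyMeasurable ?_
    fun_prop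
  refine (h.mul hN.1).congr (Eventually.of_forall fun x => ?_)
  have h : ((1 + ‖x‖) ^ N : ℝ) ≠ 0 := by positivity
  simp only [Pi.mul_apply]
  rw [← mul_assoc, ← Complex.ofReal_mul, mul_inv_cancel₀ h, Complex.ofReal_one, one_mul]

lemma RapidDecay.integrable_mul {f w : Completion v → ℂ} (hf : RapidDecay f)
    (hw : TemperateWeight w) : Integrable (fun x => f x * w x) (haar v) := by
  have hm := hw.aestronglyMeasurable
  obtain ⟨N, hN⟩ := hw
  obtain ⟨C, hC⟩ := hf.2 N
  exact (hN.norm.const_mul C).mono' (hf.1.aestronglyMeasurable.mul hm)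
    (Eventually.of_forall fun x => RapidDecay.norm_mul_le hC x)

lemma TemperateWeight.mono {w₁ w₂ : Completion v → ℂ} (h₁ : TemperateWeight w₁)
    (hm : AEStronglyMeasurable w₂ (haar v)) (h : ∀ x, x ≠ 0 → ‖w₂ x‖ ≤ ‖w₁ x‖) :
    TemperateWeight w₂ := by
  obtain ⟨N, hN⟩ := h₁
  refine ⟨N, hN.mono (AEStronglyMeasurable.mul ?_ hm) ?_⟩
  · refine Measurable.aestronglyMeasurable ?_
    fun_prop
  · filter_upwards [ae_ne_zero] with x hx
    rw [norm_mul, norm_mul]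
    gcongr
    exact h x hx

lemma TemperateWeight.add {w₁ w₂ : Completion v → ℂ} (h₁ : TemperateWeight w₁)
    (h₂ : TemperateWeight w₂) : TemperateWeight (fun x => w₁ x + w₂ x) := by
  have hm₁ := h₁.aestronglyMeasurable
  have hm₂ := h₂.aestronglyMeasurable
  obtain ⟨N, hN⟩ := h₁
  obtain ⟨M, hM⟩ := h₂
  refine ⟨max N M, ?_⟩
  have key : ∀ (K L : ℕ), K ≤ L → ∀ w : Completion v → ℂ, AEStronglyMeasurable w (haar v) →
      Integrable (fun x => (((1 + ‖x‖) ^ K)⁻¹ : ℝ) * w x) (haar v) →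
      Integrable (fun x => (((1 + ‖x‖) ^ L)⁻¹ : ℝ) * w x) (haar v) := by
    intro K L hKL w hw h
    refine h.mono (AEStronglyMeasurable.mul ?_ hw) (Eventually.of_forall fun x => ?_)
    · refine Measurable.aestronglyMeasurable ?_
      fun_prop
    · rw [norm_mul, norm_mul, Complex.norm_real, Complex.norm_real,
        Real.norm_of_nonneg (by positivity), Real.norm_of_nonneg (by positivity)]
      gcongr
      simp
  refine ((key N _ (le_max_left N M) w₁ hm₁ hN).add
    (key M _ (le_max_right N M) w₂ hm₂ hM)).congr (Eventually.of_forall fun x => ?_)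
  simp only [Pi.add_apply]
  ring

lemma TemperateWeight.const_mul {w : Completion v → ℂ} (h : TemperateWeight w) (c : ℂ) :
    TemperateWeight (fun x => c * w x) := by
  obtain ⟨N, hN⟩ := h
  refine ⟨N, (hN.const_mul c).congr (Eventually.of_forall fun x => ?_)⟩
  simp only
  ring

/-- Dyadic bound for the integral of a function of the norm. -/
lemma integrable_comp_norm_of_summable {F : ℝ → ℝ} (hF : Measurable F) {a : ℤ → ℝ}
    (ha : ∀ n : ℤ, ∀ u ∈ Ioc ((2 : ℝ) ^ n) (2 ^ (n + 1)), |F u| ≤ a n)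
    (hs : Summable fun n : ℤ => a n * 2 ^ n) :
    Integrable (fun x : Completion v => F ‖x‖) (haar v) := by
  obtain ⟨C, hC0, hC⟩ := exists_haar_closedBall_le v
  have ha0 : ∀ n, 0 ≤ a n := fun n =>
    (abs_nonneg _).trans (ha n (2 ^ (n + 1)) ⟨zpow_lt_zpow_right₀ one_lt_two (lt_add_one n), le_rfl⟩)
  refine ⟨(hF.comp measurable_norm).aestronglyMeasurable, ?_⟩
  set S : ℤ → Set (Completion v) := fun n => {x | ‖x‖ ∈ Ioc ((2 : ℝ) ^ n) (2 ^ (n + 1))} with hS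
  have hSm : ∀ n, MeasurableSet (S n) := fun n => measurable_norm measurableSet_Ioc
  have hcover : ∀ᵐ x ∂haar v, x ∈ ⋃ n, S n := by
    filter_upwards [ae_ne_zero] with x hx
    obtain ⟨n, hn⟩ := exists_mem_Ioc_zpow (norm_pos_iff.2 hx) (one_lt_two (α := ℝ))
    exact mem_iUnion.2 ⟨n, hn⟩
  rw [HasFiniteIntegral, ← Measure.restrict_eq_self_of_ae_mem hcover]
  refine (lintegral_iUnion_le S _).trans_lt ?_
  have hb : ∀ n, ∫⁻ x in S n, ‖F ‖x‖‖ₑ ∂haar v ≤ ENNReal.ofReal (C * 2 * (a n * 2 ^ n)) := by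
    intro n
    calc ∫⁻ x in S n, ‖F ‖x‖‖ₑ ∂haar v ≤ ∫⁻ x in S n, ENNReal.ofReal (a n) ∂haar v := by
          refine setLIntegral_mono measurable_const fun x hx => ?_
          rw [Real.enorm_eq_ofReal_abs]
          exact ENNReal.ofReal_le_ofReal (ha n _ hx)
      _ = ENNReal.ofReal (a n) * haar v (S n) := by simp
      _ ≤ ENNReal.ofReal (a n) * ENNReal.ofReal (C * 2 ^ (n + 1)) := by
          gcongr
          refine (measure_mono fun x hx => ?_).trans (hC _ (by positivity))
          rw [mem_closedBall_zero_iff]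
          exact hx.2
      _ = _ := by
          rw [← ENNReal.ofReal_mul (ha0 n), zpow_add_one₀ two_ne_zero]
          congr 1
          ring
  refine (ENNReal.tsum_le_tsum hb).trans_lt ?_
  rw [← ENNReal.ofReal_tsum_of_nonneg (fun n => by have := ha0 n; positivity) (hs.mul_left _)]
  exact ENNReal.ofReal_lt_top

/-- The dyadic sums that dominate `∫ |x| ^ (σ - 1) (1 + |x|) ^ (-N) dx` converge for `0 < σ < N`. -/
lemma summable_dyadic {σ : ℝ} (hσ : 0 < σ) {N : ℕ} (hN : σ < N) :
    Summable fun n : ℤ => ((2 : ℝ) ^ |σ - 1| * ((2 : ℝ) ^ n) ^ (σ - 1) *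
      ((1 + (2 : ℝ) ^ n) ^ N)⁻¹) * 2 ^ n := by
  have h1 : ∀ n : ℤ, ((2 : ℝ) ^ |σ - 1| * ((2 : ℝ) ^ n) ^ (σ - 1) *
      ((1 + (2 : ℝ) ^ n) ^ N)⁻¹) * 2 ^ n =
      (2 : ℝ) ^ |σ - 1| * (((2 : ℝ) ^ n) ^ σ * ((1 + (2 : ℝ) ^ n) ^ N)⁻¹) := by
    intro n
    rw [Real.rpow_sub_one (by positivity)]
    field_simp
  simp_rw [h1]
  refine Summable.mul_left _ ?_
  rw [summable_int_iff_summable_nat_and_neg]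
  constructor
  · refine Summable.of_nonneg_of_le (fun n => by positivity) (fun n => ?_)
      (summable_geometric_of_lt_one (r := (2 : ℝ) ^ (σ - N)) (by positivity)
        (Real.rpow_lt_one_of_one_lt_of_neg one_lt_two (by linarith)))
    rw [zpow_natCast, ← div_eq_mul_inv, div_le_iff₀ (by positivity)]
    calc ((2 : ℝ) ^ n) ^ σ = ((2 : ℝ) ^ (σ - N)) ^ n * ((2 : ℝ) ^ n) ^ N := by
          rw [← Real.rpow_natCast, ← Real.rpow_natCast, ← Real.rpow_natCast,
            ← Real.rpow_mul zero_le_two, ← Real.rpow_mul zero_le_two, ← Real.rpow_mul zero_le_two,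
            ← Real.rpow_add two_pos]
          congr 1
          ring
      _ ≤ ((2 : ℝ) ^ (σ - N)) ^ n * (1 + (2 : ℝ) ^ n) ^ N := by gcongr; linarith
  · refine Summable.of_nonneg_of_le (fun n => by positivity) (fun n => ?_)
      (summable_geometric_of_lt_one (r := (2 : ℝ) ^ (-σ)) (by positivity)
        (Real.rpow_lt_one_of_one_lt_of_neg one_lt_two (by linarith)))
    have h2 : ((2 : ℝ) ^ (-(n : ℤ))) ^ σ = ((2 : ℝ) ^ (-σ)) ^ n := by
      rw [← Real.rpow_intCast, ← Real.rpow_natCast, ← Real.rpow_mul zero_le_two,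
        ← Real.rpow_mul zero_le_two]
      congr 1
      push_cast
      ring
    rw [h2]
    refine mul_le_of_le_one_right (by positivity) (inv_le_one_of_one_le₀ (one_le_pow₀ ?_))
    simp only [le_add_iff_nonneg_right]
    positivity

lemma measurable_norm_cpow (s : ℂ) :
    Measurable fun x : Completion v => (‖x‖ : ℂ) ^ s := by
  fun_prop

lemma norm_norm_cpow {x : Completion v} (hx : x ≠ 0) (s : ℂ) :
    ‖(‖x‖ : ℂ) ^ s‖ = ‖x‖ ^ s.re :=
  Complex.norm_cpow_eq_rpow_re_of_pos (norm_pos_iff.2 hx) s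

/-- Tate's integrals converge at the origin for `0 < Re s`, and at infinity against a decay of order
`N > Re s`. -/
lemma integrable_inv_pow_mul_norm_cpow {s : ℂ} (hs : 0 < s.re) {N : ℕ} (hN : s.re < N) :
    Integrable (fun x : Completion v => (((1 + ‖x‖) ^ N)⁻¹ : ℝ) * (‖x‖ : ℂ) ^ (s - 1))
      (haar v) := by
  have key := integrable_comp_norm_of_summable (v := v)
    (F := fun u => u ^ (s.re - 1) * ((1 + u) ^ N)⁻¹) (by fun_prop) ?_ (summable_dyadic hs hN)
  · refine key.mono ?_ ?_
    · refine AEStronglyMeasurable.mul ?_ (measurable_norm_cpow _).aestronglyMeasurable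
      refine Measurable.aestronglyMeasurable ?_
      fun_prop
    · filter_upwards [ae_ne_zero] with x hx
      rw [norm_mul, norm_mul, norm_norm_cpow hx, Complex.norm_real, mul_comm,
        Real.norm_of_nonneg (r := ‖x‖ ^ (s.re - 1)) (by positivity)]
      rfl
  · intro n u hu
    have h2 : (0 : ℝ) < 2 ^ n := by positivity
    have hu0 : 0 < u := h2.trans hu.1
    rw [abs_of_nonneg (by positivity)]
    gcongr
    · have h3 : u ^ (s.re - 1) = (u / 2 ^ n) ^ (s.re - 1) * ((2 : ℝ) ^ n) ^ (s.re - 1) := by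
        rw [← Real.mul_rpow (by positivity) h2.le, div_mul_cancel₀ _ h2.ne']
      rw [h3]
      have h4 : 1 ≤ u / 2 ^ n := (one_le_div h2).2 hu.1.le
      have h5 : u / 2 ^ n ≤ 2 := by
        rw [div_le_iff₀ h2, mul_comm, ← zpow_add_one₀ two_ne_zero]
        exact hu.2
      gcongr
      calc (u / 2 ^ n) ^ (s.re - 1) ≤ (u / 2 ^ n) ^ |s.re - 1| :=
            Real.rpow_le_rpow_of_exponent_le h4 (le_abs_self _)
        _ ≤ _ := Real.rpow_le_rpow (by positivity) h5 (abs_nonneg _)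
    · exact hu.1.le

/-- `|x| ^ (s - 1)` is a temperate weight for `Re s > 0`. -/
lemma temperateWeight_norm_cpow {s : ℂ} (hs : 0 < s.re) :
    TemperateWeight (fun x : Completion v => (‖x‖ : ℂ) ^ (s - 1)) := by
  obtain ⟨N, hN⟩ := exists_nat_gt s.re
  exact ⟨N, integrable_inv_pow_mul_norm_cpow hs hN⟩

lemma temperateWeight_one : TemperateWeight (fun _ : Completion v => 1) := by
  have := temperateWeight_norm_cpow (v := v) (s := 1) (by simp)
  simpa using this

/-- The logarithm is dominated by a small positive and a small negative power. -/
lemma abs_log_le_rpow_add {u ε : ℝ} (hu : 0 < u) (hε : 0 < ε) :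
    |Real.log u| ≤ (u ^ ε + u ^ (-ε)) / ε := by
  rw [abs_le, add_div]
  have h1 := Real.log_le_rpow_div hu.le hε
  have h2 := Real.log_le_rpow_div (inv_pos.2 hu).le hε
  rw [Real.log_inv, Real.inv_rpow hu.le, ← Real.rpow_neg hu.le] at h2
  have h3 : 0 ≤ u ^ ε / ε := by positivity
  have h4 : 0 ≤ u ^ (-ε) / ε := by positivity
  constructor <;> linarith

/-- The logarithm is absorbed by a small change of the exponent `s` in either direction. -/
lemma temperateWeight_log_mul_norm_cpow {s : ℂ} (hs : 0 < s.re) :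
    TemperateWeight (fun x : Completion v => -(Real.log ‖x‖ : ℂ) * (‖x‖ : ℂ) ^ (s - 1)) := by
  set ε := s.re / 2 with hε
  have hε0 : 0 < ε := by positivity
  have h := ((temperateWeight_norm_cpow (v := v) (s := (s.re + ε : ℝ))
    (by rw [Complex.ofReal_re]; positivity)).add
    (temperateWeight_norm_cpow (v := v) (s := (s.re - ε : ℝ))
    (by rw [Complex.ofReal_re]; linarith))).const_mul (ε⁻¹ : ℝ)
  refine h.mono (Measurable.aestronglyMeasurable (by fun_prop)) fun x hx => ?_
  have hx' := norm_pos_iff.2 hx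
  have h1 : ∀ σ : ℝ, (‖x‖ : ℂ) ^ ((σ : ℂ) - 1) = ((‖x‖ ^ (σ - 1) : ℝ) : ℂ) := fun σ => by
    rw [Complex.ofReal_cpow hx'.le, Complex.ofReal_sub, Complex.ofReal_one]
  rw [h1, h1, ← Complex.ofReal_add, ← Complex.ofReal_mul, Complex.norm_real,
    Real.norm_of_nonneg (by positivity), norm_mul, norm_neg, Complex.norm_real, norm_norm_cpow hx,
    Complex.sub_re, Complex.one_re, Real.norm_eq_abs]
  calc |Real.log ‖x‖| * ‖x‖ ^ (s.re - 1)
      ≤ ((‖x‖ ^ ε + ‖x‖ ^ (-ε)) / ε) * ‖x‖ ^ (s.re - 1) := by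
        gcongr
        exact abs_log_le_rpow_add hx' hε0
    _ = _ := by
        rw [show s.re + ε - 1 = ε + (s.re - 1) by ring,
          show s.re - ε - 1 = -ε + (s.re - 1) by ring, Real.rpow_add hx', Real.rpow_add hx']
        ring

lemma temperateWeight_log : TemperateWeight (fun x : Completion v => -(Real.log ‖x‖ : ℂ)) := by
  simpa using temperateWeight_log_mul_norm_cpow (v := v) (s := 1) (by simp)

/-! ### The additive characters and the Fourier transform -/

lemma padicChar_eq_one (p : Nat.Primes) {x : ℚ_[p]} (hx : ‖x‖ ≤ 1) : padicChar p x = 1 := by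
  change padicCharFun p x = 1
  rw [padicCharFun_eq p x 0 0 (by simpa using hx)]
  simp

/-- The character is trivial on `ℤ_p` but not on `p⁻¹ ℤ_p`, which makes the measure self-dual. -/
lemma padicChar_inv_ne_one (p : Nat.Primes) : padicChar p (p : ℚ_[p])⁻¹ ≠ 1 := by
  change padicCharFun p _ ≠ 1
  rw [padicCharFun_eq p _ 1 1 (by simp)]
  intro h
  have hp := one_lt_prime p
  have h1 := congrArg (fun z : Circle => (z : ℂ)) h
  simp only [Real.fourierChar_apply, Circle.coe_one, Complex.exp_eq_one_iff] at h1
  obtain ⟨n, hn⟩ := h1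
  have h2 : (2 * Real.pi * (((1 : ℤ) : ℝ) / ((p : ℕ) : ℝ) ^ 1) : ℝ) = n * (2 * Real.pi) := by
    have h3 : ((2 * Real.pi * (((1 : ℤ) : ℝ) / ((p : ℕ) : ℝ) ^ 1) : ℝ) : ℂ) =
        ((n * (2 * Real.pi) : ℝ) : ℂ) := by
      refine mul_right_cancel₀ Complex.I_ne_zero (hn.trans ?_)
      push_cast
      ring
    exact_mod_cast h3
  have h3 : ((p : ℕ) : ℝ)⁻¹ = n := by
    have h4 : (2 * Real.pi) ≠ 0 := by positivity
    refine mul_left_cancel₀ h4 ?_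
    rw [mul_comm _ (n : ℝ), ← h2]
    simp
  have h5 : ((p : ℕ) : ℝ)⁻¹ < 1 := inv_lt_one_of_one_lt₀ hp
  have h6 : 0 < ((p : ℕ) : ℝ)⁻¹ := inv_pos.2 (prime_pos p)
  rw [h3] at h5 h6
  have h7 : n < 1 := by exact_mod_cast h5
  have h8 : 0 < n := by exact_mod_cast h6
  omega

lemma continuous_padicChar (p : Nat.Primes) : Continuous (padicChar p) := by
  refine IsLocallyConstant.continuous ?_
  rw [IsLocallyConstant.iff_eventually_eq]
  intro x
  filter_upwards [Metric.closedBall_mem_nhds x one_pos] with y hy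
  rw [Metric.mem_closedBall, dist_eq_norm] at hy
  rw [← sub_add_cancel y x, AddChar.map_add_eq_mul, padicChar_eq_one p hy, one_mul]

lemma continuous_basicChar (v : Place) : Continuous (basicChar v) := by
  cases v with
  | real => exact Real.continuous_fourierChar
  | finite p => exact continuous_padicChar p

lemma localFourier_apply (f : Completion v → ℂ) (t : Completion v) :
    localFourier v f t = ∫ x, (basicChar v (-(x * t)) : ℂ) * f x ∂haar v := rfl

lemma continuous_localFourier {f : Completion v → ℂ} (hf : Integrable f (haar v)) :
    Continuous (localFourier v f) :=
  VectorFourier.fourierIntegral_continuous (L := LinearMap.mul (Completion v) (Completion v))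
    (continuous_basicChar v) continuous_mul hf

/-- The Fourier transform is self-adjoint; the variables are rescaled by a factor `y`. -/
lemma integral_mul_localFourier_comp_mul {f g : Completion v → ℂ} (hf : Integrable f (haar v))
    (hg : Integrable g (haar v)) (y : Completion v) :
    ∫ x, f x * localFourier v g (x * y) ∂haar v = ∫ x, g x * localFourier v f (x * y) ∂haar v := by
  have h := VectorFourier.integral_fourierIntegral_smul_eq_flip (μ := haar v) (ν := haar v)
    (L := y • LinearMap.mul (Completion v) (Completion v)) (continuous_basicChar v)
    (by simp only [LinearMap.smul_apply, LinearMap.mul_apply']; fun_prop) hf hg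
  have e : ∀ (k : Completion v → ℂ) (x : Completion v),
      localFourier v k (x * y) = VectorFourier.fourierIntegral (basicChar v) (haar v)
        (y • LinearMap.mul (Completion v) (Completion v)) k x := by
    intro k x
    refine integral_congr_ae (Eventually.of_forall fun t => ?_)
    simp only [LinearMap.smul_apply, LinearMap.mul_apply', smul_eq_mul]
    congr 3
    ring
  have e' : ∀ (k : Completion v → ℂ) (x : Completion v),
      localFourier v k (x * y) = VectorFourier.fourierIntegral (basicChar v) (haar v)
        (y • LinearMap.mul (Completion v) (Completion v)).flip k x := by
    intro k x
    rw [e]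
    refine integral_congr_ae (Eventually.of_forall fun t => ?_)
    simp only [LinearMap.flip_apply, LinearMap.smul_apply, LinearMap.mul_apply', smul_eq_mul]
    congr 3
    ring
  simp_rw [e' g, e f, mul_comm (g _)]
  exact h.symm

/-- The transform of a function of period `h` is supported on the `t` with `ψ (h t) = 1`. -/
lemma localFourier_eq_zero_of_periodic {f : Completion v → ℂ} {h t : Completion v}
    (hf : ∀ x, f (x + h) = f x) (ht : basicChar v (h * t) ≠ 1) : localFourier v f t = 0 := by
  have h1 := congrFun (Fourier.fourierIntegral_comp_add_right (basicChar v) (haar v) f h) t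
  have h2 : (f ∘ fun x => x + h) = f := funext hf
  rw [h2] at h1
  change localFourier v f t = (basicChar v (h * t) : ℂ) * localFourier v f t at h1
  by_contra h0
  apply ht
  ext
  exact mul_right_cancel₀ h0 (by rw [← h1, Circle.coe_one, one_mul])

/-- The transform of a dilated function is the contracted transform. -/
lemma localFourier_comp_mul_left {a : Completion v} (ha : a ≠ 0) (f : Completion v → ℂ)
    (t : Completion v) :
    localFourier v (fun x => f (a * x)) t = (‖a‖⁻¹ : ℝ) * localFourier v f (a⁻¹ * t) := by
  rw [localFourier_apply, localFourier_apply, ← integral_comp_mul_left_haar ha]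
  congr 1 with x
  congr 4
  field_simp

/-! ### Test functions decay rapidly, and so do their transforms -/

lemma rapidDecay_of_hasCompactSupport {f : Completion v → ℂ} (hf : Continuous f)
    (hs : HasCompactSupport f) : RapidDecay f := by
  refine ⟨hf, fun N => ?_⟩
  obtain ⟨C, hC⟩ := (hs.mul_left (f := fun x => (((1 + ‖x‖) ^ N : ℝ) : ℂ))).exists_bound_of_continuous
    (by fun_prop)
  refine ⟨C, fun x => ?_⟩
  have := hC x
  rwa [Pi.mul_apply, norm_mul, Complex.norm_real, Real.norm_of_nonneg (by positivity)] at this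

lemma rapidDecay_schwartzMap (f : 𝓢(ℝ, ℂ)) : RapidDecay (v := .real) (fun x : ℝ => f x) := by
  refine ⟨f.continuous, fun N => ⟨2 ^ N * (Finset.Iic (N, 0)).sup
    (fun m => SchwartzMap.seminorm ℂ m.1 m.2) f, fun (x : ℝ) => ?_⟩⟩
  have := SchwartzMap.one_add_le_sup_seminorm_apply (𝕜 := ℂ) (m := (N, 0)) (k := N) (n := 0)
    le_rfl le_rfl f x
  rw [norm_iteratedFDeriv_zero] at this
  exact this

lemma localFourier_real_eq (f : 𝓢(ℝ, ℂ)) :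
    localFourier .real (fun x : ℝ => f x) = fun x : ℝ => (FourierTransform.fourier f) x := by
  funext x
  rw [SchwartzMap.fourier_coe]
  exact (Real.fourier_real_eq (fun x : ℝ => f x) x).symm

/-- A locally constant function with compact support is invariant under small translations. -/
lemma exists_periodic_of_bruhat (p : Nat.Primes) {f : ℚ_[p] → ℂ} (hf : f ∈ bruhatSpace p) :
    ∃ δ > 0, ∀ h : ℚ_[p], ‖h‖ < δ → ∀ x, f (x + h) = f x := by
  obtain ⟨hl, hc⟩ := hf
  obtain ⟨δ, hδ, hball⟩ := lebesgue_number_lemma_of_metric (s := tsupport f)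
    (c := fun z : ℂ => f ⁻¹' {z}) hc.isCompact (fun z => hl.isOpen_fiber z)
    (fun x _ => mem_iUnion.2 ⟨f x, rfl⟩)
  have key : ∀ x ∈ tsupport f, ∀ h : ℚ_[p], ‖h‖ < δ → f (x + h) = f x := by
    intro x hx h hh
    obtain ⟨z, hz⟩ := hball x hx
    have h1 : f x = z := hz (Metric.mem_ball_self hδ)
    have h2 : f (x + h) = z := hz (by simpa [dist_eq_norm] using hh)
    rw [h1, h2]
  refine ⟨δ, hδ, fun h hh x => ?_⟩
  by_cases hx : x ∈ tsupport f
  · exact key x hx h hh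
  by_cases hx' : x + h ∈ tsupport f
  · have := key _ hx' (-h) (by rwa [norm_neg])
    rw [add_neg_cancel_right] at this
    exact this.symm
  · rw [image_eq_zero_of_notMem_tsupport hx, image_eq_zero_of_notMem_tsupport hx']

lemma SchwartzBruhat.rapidDecay (φ : SchwartzBruhat v) : RapidDecay φ := by
  cases v with
  | real => exact rapidDecay_schwartzMap φ
  | finite p =>
    let φ' : bruhatSpace p := φ
    exact rapidDecay_of_hasCompactSupport (v := .finite p) φ'.2.1.continuous φ'.2.2

lemma RapidDecay.integrable {f : Completion v → ℂ} (hf : RapidDecay f) :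
    Integrable f (haar v) := by
  simpa using hf.integrable_mul temperateWeight_one

/-- Invariance of `f` under translations by a small ball makes its transform vanish outside a large
one. -/
lemma hasCompactSupport_localFourier (p : Nat.Primes) {f : ℚ_[p] → ℂ} (hf : f ∈ bruhatSpace p) :
    HasCompactSupport (localFourier (.finite p) f) := by
  obtain ⟨δ, hδ, h⟩ := exists_periodic_of_bruhat p hf
  have hp := prime_pos p
  refine HasCompactSupport.intro
    (isCompact_closedBall (0 : ℚ_[p]) ((p : ℕ) / δ)) fun (t : ℚ_[p]) ht => ?_
  replace ht : (p : ℕ) / δ < ‖t‖ := not_le.1 fun h => ht (mem_closedBall_zero_iff.2 h)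
  rw [div_lt_iff₀ hδ] at ht
  have ht0 : t ≠ 0 := by
    rintro rfl
    rw [norm_zero, zero_mul] at ht
    exact absurd ht (not_lt.2 hp.le)
  refine localFourier_eq_zero_of_periodic (v := .finite p) (h := (p : ℚ_[p])⁻¹ * t⁻¹)
    (fun x => h _ ?_ x) ?_
  · rw [norm_mul, norm_inv, norm_inv, Padic.norm_p, inv_inv, ← div_eq_mul_inv,
      div_lt_iff₀ (norm_pos_iff.2 ht0), mul_comm]
    exact ht
  · change padicChar p ((p : ℚ_[p])⁻¹ * t⁻¹ * t) ≠ 1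
    rw [inv_mul_cancel_right₀ ht0]
    exact padicChar_inv_ne_one p

lemma SchwartzBruhat.rapidDecay_localFourier (φ : SchwartzBruhat v) :
    RapidDecay (localFourier v φ) := by
  cases v with
  | real =>
    change RapidDecay (localFourier .real (fun x : ℝ => (show 𝓢(ℝ, ℂ) from φ) x))
    rw [localFourier_real_eq]
    exact rapidDecay_schwartzMap _
  | finite p =>
    refine rapidDecay_of_hasCompactSupport (continuous_localFourier φ.rapidDecay.integrable) ?_
    exact hasCompactSupport_localFourier p (show bruhatSpace p from φ).2

/-! ### The reciprocal of the Euler factor -/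

/-- The entire function `1 / L_ν (s)`. -/
noncomputable def invEuler : Place → ℂ → ℂ
  | .real, s => (Real.pi : ℂ) ^ (s / 2) * (Complex.Gamma (s / 2))⁻¹
  | .finite p, s => 1 - (p : ℂ) ^ (-s)

lemma eulerFactor_eq_inv (v : Place) (s : ℂ) : eulerFactor v s = (invEuler v s)⁻¹ := by
  cases v with
  | real => simp [eulerFactor, invEuler, neg_div, Complex.cpow_neg, mul_comm]
  | finite p => simp [eulerFactor, invEuler]

lemma tateGamma_eq_div (v : Place) (s : ℂ) :
    tateGamma v s = invEuler v (1 - s) / invEuler v s := by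
  rw [tateGamma, eulerFactor_eq_inv, eulerFactor_eq_inv, div_inv_eq_mul, mul_comm, div_eq_mul_inv]

lemma differentiable_invEuler (v : Place) : Differentiable ℂ (invEuler v) := by
  cases v with
  | real =>
    have h1 : Differentiable ℂ fun s : ℂ => (Real.pi : ℂ) ^ (s / 2) := fun s =>
      (differentiableAt_id.div_const 2).const_cpow (Or.inl (by simp [Real.pi_ne_zero]))
    exact h1.mul (Complex.differentiable_one_div_Gamma.comp (differentiable_id.div_const 2))
  | finite p =>
    intro s
    exact (differentiableAt_const _).sub
      (differentiableAt_id.neg.const_cpow (Or.inl (by exact_mod_cast p.2.ne_zero)))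

lemma norm_prime_cpow_neg (p : Nat.Primes) (s : ℂ) :
    ‖((p : ℕ) : ℂ) ^ (-s)‖ = ((p : ℕ) : ℝ) ^ (-s.re) := by
  rw [Complex.norm_natCast_cpow_of_pos p.2.pos, Complex.neg_re]

lemma norm_prime_cpow_neg_lt_one (p : Nat.Primes) {s : ℂ} (hs : 0 < s.re) :
    ‖((p : ℕ) : ℂ) ^ (-s)‖ < 1 := by
  rw [norm_prime_cpow_neg]
  exact Real.rpow_lt_one_of_one_lt_of_neg (one_lt_prime p) (by linarith)

lemma invEuler_ne_zero (v : Place) {s : ℂ} (hs : 0 < s.re) : invEuler v s ≠ 0 := by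
  cases v with
  | real =>
    refine mul_ne_zero ?_ (inv_ne_zero (Complex.Gamma_ne_zero_of_re_pos ?_))
    · simp [Complex.cpow_eq_zero_iff, Real.pi_ne_zero]
    · simp [hs]
  | finite p =>
    intro h
    have h1 := norm_prime_cpow_neg_lt_one p hs
    rw [← sub_eq_zero.1 (show (1 : ℂ) - (p : ℂ) ^ (-s) = 0 from h), norm_one] at h1
    exact lt_irrefl _ h1

lemma invEuler_zero (v : Place) : invEuler v 0 = 0 := by
  cases v <;> simp [invEuler]

/-! ### The standard functions -/

/-- An even function on the line is integrated over the half-line. -/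
lemma integral_comp_abs_complex (f : ℝ → ℂ) (hf : IntegrableOn f (Ioi 0)) :
    ∫ x : ℝ, f |x| = 2 * ∫ x in Ioi (0 : ℝ), f x := by
  have eq : ∫ x : ℝ in Ioi 0, f |x| = ∫ x : ℝ in Ioi 0, f x :=
    setIntegral_congr_fun measurableSet_Ioi fun x hx => by simp only [abs_of_pos (mem_Ioi.1 hx)]
  have eq' : ∫ x : ℝ in Iic 0, f |x| = ∫ x : ℝ in Ioi 0, f x := by
    rw [← neg_zero, ← integral_comp_neg_Iic, neg_zero]
    exact setIntegral_congr_fun measurableSet_Iic fun x hx => by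
      simp only [abs_of_nonpos (mem_Iic.1 hx)]
  have h1 : IntegrableOn (fun x : ℝ => f |x|) (Ioi 0) :=
    hf.congr_fun (fun x hx => by simp only [abs_of_pos (mem_Ioi.1 hx)]) measurableSet_Ioi
  have h2 : IntegrableOn (fun x : ℝ => f |x|) (Iic 0) := by
    rw [← Measure.map_neg_eq_self (volume : Measure ℝ)]
    let m : MeasurableEmbedding fun x : ℝ => -x := (Homeomorph.neg ℝ).measurableEmbedding
    rw [m.integrableOn_map_iff]
    simp_rw [Function.comp_def, abs_neg, neg_preimage, neg_Iic, neg_zero]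
    exact Iff.mpr integrableOn_Ici_iff_integrableOn_Ioi h1
  rw [← setIntegral_univ, ← Iic_union_Ioi (a := (0 : ℝ)),
    setIntegral_union (Iic_disjoint_Ioi le_rfl) measurableSet_Ioi h2 h1, eq, eq', two_mul]

/-- The function whose Mellin transform is a multiple of the Euler factor, and which is its own
Fourier transform: the Gaussian on `ℝ`, the indicator of `ℤ_p` on `ℚ_p`. -/
noncomputable def standardFn : (v : Place) → Completion v → ℂ
  | .real => fun x : ℝ => Complex.exp (-Real.pi * x ^ 2)
  | .finite _ => fun x => if ‖x‖ ≤ 1 then 1 else 0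

instance (p : Nat.Primes) : IsUltrametricDist (Completion (.finite p)) :=
  inferInstanceAs (IsUltrametricDist ℚ_[p])

/-- The prime `p`, as an element of the completion at `p`. -/
noncomputable def uniformizer (p : Nat.Primes) : Completion (.finite p) := ((p : ℕ) : ℚ_[p])

lemma norm_uniformizer (p : Nat.Primes) : ‖uniformizer p‖ = ((p : ℕ) : ℝ)⁻¹ :=
  Padic.norm_p (p := p)

lemma uniformizer_ne_zero (p : Nat.Primes) : uniformizer p ≠ 0 :=
  norm_pos_iff.1 (by rw [norm_uniformizer]; exact inv_pos.2 (prime_pos p))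

/-- Norms on `ℚ_p` are powers of `p`: a norm below `p ^ (n + 1)` is at most `p ^ n`. -/
lemma norm_le_zpow_of_lt (p : Nat.Primes) {x : Completion (.finite p)} {n : ℤ}
    (h : ‖x‖ < ((p : ℕ) : ℝ) ^ (n + 1)) : ‖x‖ ≤ ((p : ℕ) : ℝ) ^ n :=
  (Padic.norm_le_pow_iff_norm_lt_pow_add_one (p := p) x n).2 h

lemma norm_add_le_iff_of_le {p : Nat.Primes} {x h : Completion (.finite p)} {r : ℝ}
    (hh : ‖h‖ ≤ r) : ‖x + h‖ ≤ r ↔ ‖x‖ ≤ r := by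
  constructor
  · intro h'
    have := IsUltrametricDist.norm_add_le_max (x + h) (-h)
    rw [add_neg_cancel_right, norm_neg] at this
    exact this.trans (max_le h' hh)
  · exact fun h' => (IsUltrametricDist.norm_add_le_max x h).trans (max_le h' hh)

lemma standardFn_finite_add (p : Nat.Primes) {h : Completion (.finite p)} (hh : ‖h‖ ≤ 1)
    (x : Completion (.finite p)) :
    standardFn (.finite p) (x + h) = standardFn (.finite p) x :=
  if_congr (norm_add_le_iff_of_le hh) rfl rfl

lemma isLocallyConstant_standardFn_finite (p : Nat.Primes) :
    IsLocallyConstant (standardFn (.finite p)) := by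
  rw [IsLocallyConstant.iff_eventually_eq]
  intro x
  filter_upwards [Metric.closedBall_mem_nhds x one_pos] with y hy
  rw [Metric.mem_closedBall, dist_eq_norm] at hy
  rw [← add_sub_cancel x y, standardFn_finite_add p hy]

lemma standardFn_finite_mem (p : Nat.Primes) : standardFn (.finite p) ∈ bruhatSpace p :=
  ⟨isLocallyConstant_standardFn_finite p,
    HasCompactSupport.intro (isCompact_closedBall (0 : Completion (.finite p)) 1)
      fun _ hx => if_neg fun h => hx (mem_closedBall_zero_iff.2 h)⟩

lemma integral_standardFn_finite (p : Nat.Primes) :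
    ∫ x, standardFn (.finite p) x ∂haar (.finite p) = 1 := by
  have h1 : standardFn (.finite p) =
      (Metric.closedBall (0 : Completion (.finite p)) 1).indicator (fun _ => (1 : ℂ)) := by
    funext x
    by_cases hx : ‖x‖ ≤ 1
    · rw [indicator_of_mem (mem_closedBall_zero_iff.2 hx)]
      exact if_pos hx
    · rw [indicator_of_notMem fun h => hx (mem_closedBall_zero_iff.1 h)]
      exact if_neg hx
  have h2 : haar (.finite p) (Metric.closedBall (0 : Completion (.finite p)) 1) = 1 :=
    padic_haar_unitBall p
  rw [h1, integral_indicator measurableSet_closedBall, setIntegral_const, measureReal_def, h2]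
  simp

lemma rapidDecay_standardFn (v : Place) : RapidDecay (standardFn v) := by
  cases v with
  | real =>
    refine ⟨show Continuous fun x : ℝ => Complex.exp (-Real.pi * x ^ 2) by fun_prop, fun N =>
      ⟨N.factorial * Real.exp 2, fun (x : ℝ) => ?_⟩⟩
    have h0 : 0 ≤ 1 + ‖x‖ := by positivity
    have h1 : (1 + ‖x‖) ^ N ≤ N.factorial * Real.exp (1 + ‖x‖) := by
      have := Real.pow_div_factorial_le_exp _ h0 N
      rwa [div_le_iff₀' (by positivity)] at this
    have h2 : ‖Complex.exp (-Real.pi * x ^ 2)‖ = Real.exp (-(Real.pi * ‖x‖ ^ 2)) := by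
      rw [Complex.norm_exp, Real.norm_eq_abs, sq_abs]
      congr 1
      rw [← Complex.ofReal_pow, ← Complex.ofReal_neg, ← Complex.ofReal_mul, Complex.ofReal_re]
      ring
    change (1 + ‖x‖) ^ N * ‖Complex.exp (-Real.pi * x ^ 2)‖ ≤ _
    rw [h2]
    calc (1 + ‖x‖) ^ N * Real.exp (-(Real.pi * ‖x‖ ^ 2))
        ≤ (N.factorial * Real.exp (1 + ‖x‖)) * Real.exp (-(Real.pi * ‖x‖ ^ 2)) := by gcongr
      _ = N.factorial * Real.exp (1 + ‖x‖ - Real.pi * ‖x‖ ^ 2) := by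
          rw [mul_assoc, ← Real.exp_add, sub_eq_add_neg]
      _ ≤ _ := by
          gcongr
          nlinarith [sq_nonneg (‖x‖ - 1), sq_nonneg ‖x‖, Real.pi_gt_three]
  | finite p =>
    exact (show SchwartzBruhat (.finite p) from ⟨_, standardFn_finite_mem p⟩).rapidDecay

lemma localFourier_standardFn (v : Place) : localFourier v (standardFn v) = standardFn v := by
  cases v with
  | real =>
    funext (x : ℝ)
    have h := congrFun (fourier_gaussian_pi (b := 1) (by simp)) x
    simp only [mul_one, Complex.one_cpow, div_one, one_mul] at h
    rw [Real.fourier_real_eq] at h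
    exact h
  | finite p =>
    funext t
    by_cases ht : ‖t‖ ≤ 1
    · have h1 : standardFn (.finite p) t = 1 := if_pos ht
      rw [h1, ← integral_standardFn_finite p, localFourier_apply]
      refine integral_congr_ae (Eventually.of_forall fun x => ?_)
      by_cases hx : ‖x‖ ≤ 1
      · have h2 : basicChar (.finite p) (-(x * t)) = 1 := by
          refine padicChar_eq_one p ?_
          change ‖-(x * t)‖ ≤ 1
          rw [norm_neg, norm_mul]
          exact mul_le_one₀ hx (norm_nonneg _) ht
        simp only [h2, Circle.coe_one, one_mul]
      · have h2 : standardFn (.finite p) x = 0 := if_neg hx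
        simp only [h2, mul_zero]
    · have ht0 : t ≠ 0 := by
        rintro rfl
        simp at ht
      have h1 : standardFn (.finite p) t = 0 := if_neg ht
      rw [h1]
      have hh : ‖(uniformizer p)⁻¹ * t⁻¹‖ ≤ 1 := by
        rw [norm_mul, norm_inv, norm_inv, norm_uniformizer, inv_inv, ← div_eq_mul_inv,
          div_le_one (norm_pos_iff.2 ht0)]
        have h2 := (norm_le_zpow_of_lt p (x := t) (n := 0)).mt (by simpa using ht)
        simpa using h2
      refine localFourier_eq_zero_of_periodic (h := (uniformizer p)⁻¹ * t⁻¹)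
        (standardFn_finite_add p hh) ?_
      rw [inv_mul_cancel_right₀ ht0]
      exact padicChar_inv_ne_one p

/-- The volume of `ℤ_p^×` at `p`, and `1` at the real place. -/
noncomputable def standardConst : Place → ℂ
  | .real => 1
  | .finite p => 1 - (p : ℂ)⁻¹

lemma standardConst_ne_zero (v : Place) : standardConst v ≠ 0 := by
  cases v with
  | real => exact one_ne_zero
  | finite p =>
    have := invEuler_ne_zero (.finite p) (s := 1) (by simp)
    simpa [invEuler, standardConst, Complex.cpow_neg_one] using this

/-- The zeta integral of the standard function is the Euler factor, up to a constant: Euler's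
integral for `Γ (s / 2)` on `ℝ`, and on `ℚ_p` the comparison of the integral with its image under
the dilation by `p`. -/
lemma integral_standardFn_mul_norm_cpow (v : Place) {s : ℂ} (hs : 0 < s.re) :
    ∫ x, standardFn v x * (‖x‖ : ℂ) ^ (s - 1) ∂haar v = standardConst v / invEuler v s := by
  have hint := (rapidDecay_standardFn v).integrable_mul (temperateWeight_norm_cpow hs)
  cases v with
  | real =>
    have hint' : Integrable fun x : ℝ => Complex.exp (-Real.pi * x ^ 2) * (‖x‖ : ℂ) ^ (s - 1) := hint
    have h1 : ∀ x : ℝ, Complex.exp (-Real.pi * x ^ 2) * (‖x‖ : ℂ) ^ (s - 1) =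
        (fun u : ℝ => (u : ℂ) ^ (s - 1) * Complex.exp (-Real.pi * u ^ 2)) |x| := fun x => by
      simp only
      rw [← Complex.ofReal_pow |x|, sq_abs, Complex.ofReal_pow, mul_comm, Real.norm_eq_abs]
    have h2 : IntegrableOn (fun u : ℝ => (u : ℂ) ^ (s - 1) * Complex.exp (-Real.pi * u ^ 2))
        (Ioi 0) := by
      refine (hint'.integrableOn (s := Ioi 0)).congr_fun (fun x hx => ?_) measurableSet_Ioi
      simp only [h1, abs_of_pos (mem_Ioi.1 hx)]
    have h3 := mellin_comp_rpow (fun u : ℝ => Complex.exp (-(Real.pi * u))) s 2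
    have h4 := Complex.integral_cpow_mul_exp_neg_mul_Ioi (a := s / 2) (r := Real.pi)
      (by simp [hs]) Real.pi_pos
    have h5 : mellin (fun u : ℝ => Complex.exp (-(Real.pi * u))) (s / 2) =
        (1 / Real.pi) ^ (s / 2) * Complex.Gamma (s / 2) := by
      rw [← h4]
      rfl
    have h6 : ∫ u : ℝ in Ioi 0, (u : ℂ) ^ (s - 1) * Complex.exp (-Real.pi * u ^ 2) =
        mellin (fun u : ℝ => Complex.exp (-(Real.pi * (u ^ (2 : ℝ) : ℝ)))) s := by
      refine setIntegral_congr_fun measurableSet_Ioi fun u hu => ?_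
      simp only [smul_eq_mul]
      norm_num
    change ∫ x : ℝ, Complex.exp (-Real.pi * x ^ 2) * (‖x‖ : ℂ) ^ (s - 1) = _
    simp_rw [h1]
    rw [integral_comp_abs_complex _ h2, h6, h3]
    rw [Complex.ofReal_ofNat, h5]
    simp only [standardConst, invEuler]
    rw [one_div, Complex.inv_cpow _ _ (by
      rw [Complex.arg_ofReal_of_nonneg Real.pi_pos.le]; exact Real.pi_pos.ne)]
    simp
    ring
  | finite p =>
    have hpc : ((p : ℕ) : ℂ) ≠ 0 := by exact_mod_cast p.2.ne_zero
    set a : Completion (.finite p) := (uniformizer p)⁻¹ with ha_def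
    have ha : a ≠ 0 := inv_ne_zero (uniformizer_ne_zero p)
    have hna : ‖a‖ = (p : ℕ) := by rw [norm_inv, norm_uniformizer, inv_inv]
    set J := ∫ x, standardFn (.finite p) x * (‖x‖ : ℂ) ^ (s - 1) ∂haar (.finite p) with hJ
    have h1 := integral_comp_mul_left_haar ha
      (fun x => standardFn (.finite p) x * (‖x‖ : ℂ) ^ (s - 1))
    have h2 := integral_comp_mul_left_haar ha (standardFn (.finite p))
    rw [integral_standardFn_finite, mul_one] at h2
    rw [← hJ] at h1
    have hst := (rapidDecay_standardFn (.finite p)).integrable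
    -- Only the units of `ℤ_p` contribute to the difference of the integral and of its rescaling.
    have h3 : J - ((p : ℕ) : ℂ) ^ (1 - s) * ((‖a‖⁻¹ : ℝ) * J) = 1 - (‖a‖⁻¹ : ℝ) := by
      rw [← h1, ← h2, ← integral_const_mul, hJ]
      refine Eq.trans ?_ (congrArg (· - _) (integral_standardFn_finite p))
      rw [← integral_sub hst (integrable_comp_mul_left_haar ha hst), ← integral_sub hint
        ((integrable_comp_mul_left_haar ha hint).const_mul _)]
      refine integral_congr_ae ?_
      filter_upwards [ae_ne_zero] with x hx
      have hx' : (‖x‖ : ℂ) ≠ 0 := by simpa using hx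
      have h4 : (‖a * x‖ : ℂ) ^ (s - 1) = ((p : ℕ) : ℂ) ^ (s - 1) * (‖x‖ : ℂ) ^ (s - 1) := by
        rw [norm_mul, hna, Complex.ofReal_mul, Complex.mul_cpow_ofReal_nonneg
          (prime_pos p).le (norm_nonneg x), Complex.ofReal_natCast]
      have h5 : ((p : ℕ) : ℂ) ^ (1 - s) * ((p : ℕ) : ℂ) ^ (s - 1) = 1 := by
        rw [← Complex.cpow_add _ _ hpc]
        simp
      have h6 : ((p : ℕ) : ℂ) ^ (1 - s) *
          (standardFn (.finite p) (a * x) * (‖a * x‖ : ℂ) ^ (s - 1)) =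
          standardFn (.finite p) (a * x) * (‖x‖ : ℂ) ^ (s - 1) := by
        rw [h4, ← mul_assoc, mul_comm _ (standardFn _ _), mul_assoc, ← mul_assoc _ _
          ((‖x‖ : ℂ) ^ (s - 1)), h5, one_mul]
      rw [h6, ← sub_mul]
      rcases lt_trichotomy ‖x‖ 1 with h | h | h
      · have h7 : standardFn (.finite p) x = 1 := if_pos h.le
        have h8 : standardFn (.finite p) (a * x) = 1 := by
          refine if_pos ?_
          have h9 := norm_le_zpow_of_lt p (x := x) (n := -1) (by simpa using h)
          rw [norm_mul, hna]
          calc ((p : ℕ) : ℝ) * ‖x‖ ≤ ((p : ℕ) : ℝ) * ((p : ℕ) : ℝ) ^ (-1 : ℤ) :=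
                mul_le_mul_of_nonneg_left h9 (prime_pos p).le
            _ = 1 := by rw [zpow_neg_one, mul_inv_cancel₀ (prime_pos p).ne']
        rw [h7, h8, sub_self, zero_mul]
      · rw [h, Complex.ofReal_one, Complex.one_cpow, mul_one]
      · have h7 : standardFn (.finite p) x = 0 := if_neg (not_le.2 h)
        have h8 : standardFn (.finite p) (a * x) = 0 := by
          refine if_neg (not_le.2 ?_)
          rw [norm_mul, hna]
          exact h.trans_le (le_mul_of_one_le_left (norm_nonneg x) (one_lt_prime p).le)
        rw [h7, h8, sub_self, zero_mul]
    rw [eq_div_iff (invEuler_ne_zero _ hs)]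
    have h10 : ((p : ℕ) : ℂ) ^ (1 - s) * (‖a‖⁻¹ : ℝ) = ((p : ℕ) : ℂ) ^ (-s) := by
      rw [hna, sub_eq_add_neg, Complex.cpow_add _ _ hpc, Complex.cpow_one]
      push_cast
      field_simp
    rw [← mul_assoc, h10] at h3
    rw [hna] at h3
    simp only [invEuler, standardConst]
    push_cast at h3
    rw [mul_sub, mul_one, mul_comm J, h3]

/-! ### Zeta integrals and the local functional equation -/

/-- Tate's local zeta integral `∫ f (x) |x| ^ (s - 1) dx`. -/
noncomputable def zetaIntegral (f : Completion v → ℂ) (s : ℂ) : ℂ :=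
  ∫ x, f x * (‖x‖ : ℂ) ^ (s - 1) ∂haar v

/-- Fubini's theorem and the substitution `y ↦ x y` turn a product of zeta integrals at `s` and `1 -
s` into a single one. -/
lemma zetaIntegral_mul_zetaIntegral_eq {f h : Completion v → ℂ} {s : ℂ}
    (hf : Integrable f (haar v))
    (hfs : Integrable (fun x => f x * (‖x‖ : ℂ) ^ (s - 1)) (haar v)) (hh : Continuous h)
    (hhs : Integrable (fun x => h x * (‖x‖ : ℂ) ^ (1 - s - 1)) (haar v)) :
    zetaIntegral f s * zetaIntegral h (1 - s) =
      ∫ y, (∫ x, f x * h (x * y) ∂haar v) * (‖y‖ : ℂ) ^ (1 - s - 1) ∂haar v := by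
  set k : Completion v → ℂ := fun y => h y * (‖y‖ : ℂ) ^ (1 - s - 1) with hk
  set F : Completion v → Completion v → ℂ :=
    fun x y => f x * (h (x * y) * (‖y‖ : ℂ) ^ (1 - s - 1)) with hF
  have hFk : ∀ x y, x ≠ 0 → F x y = f x * (‖x‖ : ℂ) ^ s * k (x * y) := by
    intro x y hx
    have hx' : (‖x‖ : ℂ) ≠ 0 := by simpa using hx
    simp only [hF, hk]
    rw [norm_mul, Complex.ofReal_mul, Complex.mul_cpow_ofReal_nonneg (norm_nonneg x)
      (norm_nonneg y)]
    have : (‖x‖ : ℂ) ^ s * (‖x‖ : ℂ) ^ (1 - s - 1) = 1 := by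
      rw [← Complex.cpow_add _ _ hx']
      simp
    linear_combination (-(f x * h (x * y) * (‖y‖ : ℂ) ^ (1 - s - 1))) * this
  have hmeas : AEStronglyMeasurable (Function.uncurry F) ((haar v).prod (haar v)) := by
    refine hf.1.comp_fst.mul ((Continuous.aestronglyMeasurable ?_).mul
      (measurable_norm_cpow _).aestronglyMeasurable.comp_snd)
    fun_prop
  have hnorm : ∀ x, x ≠ 0 →
      ∫ y, ‖F x y‖ ∂haar v = ‖f x * (‖x‖ : ℂ) ^ (s - 1)‖ * ∫ y, ‖k y‖ ∂haar v := by
    intro x hx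
    simp_rw [hFk x _ hx, norm_mul (f x * _)]
    have hx' : (‖x‖ : ℂ) ≠ 0 := by simpa using hx
    rw [integral_const_mul, integral_comp_mul_left_haar' hx (fun y => ‖k y‖), smul_eq_mul,
      ← mul_assoc]
    congr 1
    rw [norm_mul, norm_mul, norm_norm_cpow hx, norm_norm_cpow hx, mul_assoc, Complex.sub_re,
      Complex.one_re, Real.rpow_sub_one (by simpa using hx), div_eq_mul_inv]
  have hint : Integrable (Function.uncurry F) ((haar v).prod (haar v)) := by
    rw [integrable_prod_iff hmeas]
    constructor
    · filter_upwards [ae_ne_zero] with x hx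
      simp only [Function.uncurry_apply_pair, hFk x _ hx]
      exact (integrable_comp_mul_left_haar hx hhs).const_mul _
    · refine (hfs.norm.mul_const (∫ y, ‖k y‖ ∂haar v)).congr ?_
      filter_upwards [ae_ne_zero] with x hx
      exact (hnorm x hx).symm
  have h1 : ∫ x, ∫ y, F x y ∂haar v ∂haar v = zetaIntegral f s * zetaIntegral h (1 - s) := by
    rw [zetaIntegral, ← integral_mul_const]
    refine integral_congr_ae ?_
    filter_upwards [ae_ne_zero] with x hx
    simp_rw [hFk x _ hx]
    have hx' : (‖x‖ : ℂ) ≠ 0 := by simpa using hx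
    rw [integral_const_mul, integral_comp_mul_left_haar hx k, zetaIntegral, ← mul_assoc,
      mul_assoc (f x), Complex.ofReal_inv, ← div_eq_mul_inv, Complex.cpow_sub _ _ hx', Complex.cpow_one]
  rw [← h1, integral_integral_swap hint]
  refine integral_congr_ae (Eventually.of_forall fun y => ?_)
  simp only [hF, ← mul_assoc]
  rw [integral_mul_const]

/-- The local functional equation: both sides, multiplied by the zeta integral of the standard
function, are the same double integral because the Fourier transform is self-adjoint. -/
theorem zetaIntegral_mul_invEuler {f : Completion v → ℂ} {s : ℂ} (hs0 : 0 < s.re) (hs1 : s.re < 1)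
    (hf : Integrable f (haar v))
    (hfs : Integrable (fun x => f x * (‖x‖ : ℂ) ^ (s - 1)) (haar v))
    (hft : Integrable (fun x => localFourier v f x * (‖x‖ : ℂ) ^ (1 - s - 1)) (haar v)) :
    zetaIntegral f s * invEuler v s =
      invEuler v (1 - s) * zetaIntegral (localFourier v f) (1 - s) := by
  have hs1' : 0 < (1 - s).re := by simpa using hs1
  have he := rapidDecay_standardFn v
  have h1 := zetaIntegral_mul_zetaIntegral_eq hf hfs he.1
    (he.integrable_mul (temperateWeight_norm_cpow hs1'))
  have h2 := zetaIntegral_mul_zetaIntegral_eq he.integrable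
    (he.integrable_mul (temperateWeight_norm_cpow hs0)) (continuous_localFourier hf) hft
  have h3 : ∀ y, ∫ x, f x * standardFn v (x * y) ∂haar v =
      ∫ x, standardFn v x * localFourier v f (x * y) ∂haar v := fun y => by
    rw [← integral_mul_localFourier_comp_mul hf he.integrable, localFourier_standardFn]
  simp_rw [h3] at h1
  rw [← h2] at h1
  have h4 : zetaIntegral (standardFn v) (1 - s) = standardConst v / invEuler v (1 - s) :=
    integral_standardFn_mul_norm_cpow v hs1'
  have h5 : zetaIntegral (standardFn v) s = standardConst v / invEuler v s :=
    integral_standardFn_mul_norm_cpow v hs0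
  rw [h4, h5] at h1
  have h6 := invEuler_ne_zero v hs0
  have h7 := invEuler_ne_zero v hs1'
  have h8 := standardConst_ne_zero v
  field_simp at h1
  linear_combination h1

/-- Zeta integrals are holomorphic in their strip of convergence. -/
lemma hasDerivAt_zetaIntegral {f : Completion v → ℂ} {a b : ℝ} {s : ℂ} (ha : a < s.re)
    (hb : s.re < b) (hm : AEStronglyMeasurable f (haar v))
    (hf : ∀ σ : ℝ, a < σ → σ < b → Integrable (fun x => f x * (‖x‖ : ℂ) ^ ((σ : ℂ) - 1)) (haar v)) :
    HasDerivAt (zetaIntegral f)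
      (∫ x, f x * ((Real.log ‖x‖ : ℂ) * (‖x‖ : ℂ) ^ (s - 1)) ∂haar v) s := by
  obtain ⟨ε, hε, hεa, hεb⟩ : ∃ ε > 0, a < s.re - 2 * ε ∧ s.re + 2 * ε < b := by
    refine ⟨min (s.re - a) (b - s.re) / 3,
      by have := lt_min (sub_pos.2 ha) (sub_pos.2 hb); positivity, ?_, ?_⟩
    · have := min_le_left (s.re - a) (b - s.re)
      linarith
    · have := min_le_right (s.re - a) (b - s.re)
      linarith
  have hnorm : ∀ (σ : ℝ) (x : Completion v), x ≠ 0 →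
      ‖f x * (‖x‖ : ℂ) ^ ((σ : ℂ) - 1)‖ = ‖f x‖ * ‖x‖ ^ (σ - 1) := by
    intro σ x hx
    rw [norm_mul, norm_norm_cpow hx, Complex.sub_re, Complex.one_re, Complex.ofReal_re]
  set B : Completion v → ℝ := fun x => ε⁻¹ * (‖f x * (‖x‖ : ℂ) ^ (((s.re + 2 * ε : ℝ) : ℂ) - 1)‖ +
    2 * ‖f x * (‖x‖ : ℂ) ^ ((s.re : ℂ) - 1)‖ +
    ‖f x * (‖x‖ : ℂ) ^ (((s.re - 2 * ε : ℝ) : ℂ) - 1)‖) with hB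
  have hBint : Integrable B (haar v) :=
    ((((hf _ (by linarith) hεb).norm).add ((hf _ ha hb).norm.const_mul 2)).add
      (hf _ hεa (by linarith)).norm).const_mul _
  refine (hasDerivAt_integral_of_dominated_loc_of_deriv_le (bound := B)
    (F' := fun z x => f x * ((Real.log ‖x‖ : ℂ) * (‖x‖ : ℂ) ^ (z - 1)))
    (Metric.ball_mem_nhds s hε) ?_ ?_ ?_ ?_ hBint ?_).2
  · exact Eventually.of_forall fun z => hm.mul (measurable_norm_cpow _).aestronglyMeasurable
  · refine (hf _ ha hb).mono (hm.mul (measurable_norm_cpow _).aestronglyMeasurable) ?_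
    filter_upwards [ae_ne_zero] with x hx
    rw [hnorm _ _ hx, norm_mul, norm_norm_cpow hx, Complex.sub_re, Complex.one_re]
  · refine hm.mul (Measurable.aestronglyMeasurable ?_)
    fun_prop
  · filter_upwards [ae_ne_zero] with x hx z hz
    have hu := norm_pos_iff.2 hx
    have hz' : |z.re - s.re| < ε := by
      rw [Metric.mem_ball, dist_eq_norm] at hz
      exact (Complex.abs_re_le_norm (z - s)).trans_lt hz
    rw [abs_lt] at hz'
    have h1 := abs_log_le_rpow_add hu hε
    have h2 : ‖x‖ ^ (z.re - 1) ≤ (‖x‖ ^ ε + ‖x‖ ^ (-ε)) * ‖x‖ ^ (s.re - 1) := by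
      rw [add_mul, ← Real.rpow_add hu, ← Real.rpow_add hu]
      rcases le_total 1 ‖x‖ with h | h
      · have := Real.rpow_le_rpow_of_exponent_le h
          (show z.re - 1 ≤ ε + (s.re - 1) by linarith)
        have h0 : 0 ≤ ‖x‖ ^ (-ε + (s.re - 1)) := by positivity
        linarith
      · have := Real.rpow_le_rpow_of_exponent_ge hu h
          (show -ε + (s.re - 1) ≤ z.re - 1 by linarith)
        have h0 : 0 ≤ ‖x‖ ^ (ε + (s.re - 1)) := by positivity
        linarith
    rw [norm_mul, norm_mul, norm_norm_cpow hx, Complex.norm_real, Real.norm_eq_abs,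
      Complex.sub_re, Complex.one_re]
    calc ‖f x‖ * (|Real.log ‖x‖| * ‖x‖ ^ (z.re - 1))
        ≤ ‖f x‖ * (((‖x‖ ^ ε + ‖x‖ ^ (-ε)) / ε) *
          ((‖x‖ ^ ε + ‖x‖ ^ (-ε)) * ‖x‖ ^ (s.re - 1))) := by gcongr
      _ = B x := by
        simp only [hB]
        rw [hnorm _ _ hx, hnorm _ _ hx, hnorm _ _ hx,
          show s.re + 2 * ε - 1 = ε + ε + (s.re - 1) by ring,
          show s.re - 2 * ε - 1 = -ε + -ε + (s.re - 1) by ring, Real.rpow_add hu, Real.rpow_add hu,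
          Real.rpow_add hu (-ε + -ε), Real.rpow_add hu]
        have : ‖x‖ ^ ε * ‖x‖ ^ (-ε) = 1 := by
          rw [← Real.rpow_add hu]
          simp
        rw [div_eq_inv_mul]
        linear_combination (2 * ε⁻¹ * ‖f x‖ * ‖x‖ ^ (s.re - 1)) * this
  · filter_upwards [ae_ne_zero] with x hx z _
    have hx' : (‖x‖ : ℂ) ≠ 0 := by simpa using hx
    have := (((hasDerivAt_id z).sub_const 1).const_cpow (c := (‖x‖ : ℂ)) (Or.inl hx')).const_mul
      (f x)
    refine this.congr_deriv ?_
    rw [← Complex.ofReal_log (norm_nonneg x)]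
    simp [mul_comm]

lemma RapidDecay.hasDerivAt_zetaIntegral {f : Completion v → ℂ} (hf : RapidDecay f) {s : ℂ}
    (hs : 0 < s.re) :
    HasDerivAt (zetaIntegral f)
      (∫ x, f x * ((Real.log ‖x‖ : ℂ) * (‖x‖ : ℂ) ^ (s - 1)) ∂haar v) s :=
  WeilLocal.hasDerivAt_zetaIntegral hs (lt_add_one _) hf.1.aestronglyMeasurable fun σ hσ _ =>
    hf.integrable_mul (temperateWeight_norm_cpow (by simpa using hσ))

/-- The functional equation for test functions. -/
lemma zetaIntegral_schwartzBruhat (φ : SchwartzBruhat v) {s : ℂ} (hs0 : 0 < s.re) (hs1 : s.re < 1) :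
    zetaIntegral φ s = tateGamma v s * zetaIntegral (localFourier v φ) (1 - s) := by
  have hs1' : 0 < (1 - s).re := by simpa using hs1
  have := zetaIntegral_mul_invEuler hs0 hs1 φ.rapidDecay.integrable
    (φ.rapidDecay.integrable_mul (temperateWeight_norm_cpow hs0))
    (φ.rapidDecay_localFourier.integrable_mul (temperateWeight_norm_cpow hs1'))
  rw [tateGamma_eq_div, div_mul_eq_mul_div, ← this, mul_div_cancel_right₀ _ (invEuler_ne_zero v hs0)]

/-! ### Distributions given by temperate weights -/

/-- Integration against a temperate weight is a continuous linear form on Schwartz functions. -/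
lemma exists_schwartz_form {w : Completion .real → ℂ} (hw : TemperateWeight w) :
    ∃ T : 𝓢(ℝ, ℂ) →L[ℂ] ℂ, ∀ φ : 𝓢(ℝ, ℂ), T φ = ∫ x : ℝ, φ x * w x := by
  have hint : ∀ φ : 𝓢(ℝ, ℂ), Integrable fun x : ℝ => φ x * w x := fun φ =>
    (rapidDecay_schwartzMap φ).integrable_mul hw
  obtain ⟨N, hN⟩ := hw
  have hN' : Integrable fun x : ℝ => (((1 + ‖x‖) ^ N)⁻¹ : ℝ) * w x := hN
  refine ⟨SchwartzMap.mkCLMtoNormedSpace (fun φ => ∫ x : ℝ, φ x * w x) ?_ ?_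
    ⟨Finset.Iic (N, 0), 2 ^ N * ∫ x : ℝ, ‖(((1 + ‖x‖) ^ N)⁻¹ : ℝ) * w x‖, by positivity, ?_⟩,
    fun φ => rfl⟩
  · intro f g
    simp only [_root_.add_apply, add_mul]
    exact integral_add (hint f) (hint g)
  · intro a f
    simp only [_root_.smul_apply, smul_eq_mul, mul_assoc, RingHom.id_apply]
    exact integral_const_mul _ _
  · intro φ
    have h1 : ∀ x : Completion .real, (1 + ‖x‖) ^ N * ‖(fun x : ℝ => φ x) x‖ ≤
        2 ^ N * (Finset.Iic (N, 0)).sup (schwartzSeminormFamily ℂ ℝ ℂ) φ := by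
      intro (x : ℝ)
      have := SchwartzMap.one_add_le_sup_seminorm_apply (𝕜 := ℂ) (m := (N, 0)) (k := N) (n := 0)
        le_rfl le_rfl φ x
      rw [norm_iteratedFDeriv_zero] at this
      exact this
    refine (norm_integral_le_integral_norm _).trans ?_
    rw [mul_right_comm, ← integral_const_mul]
    exact integral_mono (hint φ).norm (hN'.norm.const_mul _) fun x =>
      RapidDecay.norm_mul_le h1 x

lemma exists_distribution_integral {w : Completion v → ℂ} (hw : TemperateWeight w) :
    ∃ T : LocalDistribution v, ∀ φ : SchwartzBruhat v, T φ = ∫ x, φ x * w x ∂haar v := by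
  cases v with
  | real => exact exists_schwartz_form hw
  | finite p =>
    have hint : ∀ φ : SchwartzBruhat (.finite p),
        Integrable (fun x => φ x * w x) (haar (.finite p)) := fun φ =>
      φ.rapidDecay.integrable_mul hw
    refine ⟨({ toFun := fun φ : bruhatSpace p => ∫ x, φ.1 x * w x ∂haar (.finite p)
               map_add' := ?_, map_smul' := ?_ } : bruhatSpace p →ₗ[ℂ] ℂ), fun φ => rfl⟩
    · intro f g
      exact (integral_congr_ae (Eventually.of_forall fun x => add_mul (f.1 x) (g.1 x) (w x))).trans
        (integral_add (hint f) (hint g))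
    · intro a f
      exact (integral_congr_ae (Eventually.of_forall fun x => mul_assoc a (f.1 x) (w x))).trans
        (integral_const_mul _ _)

/-- Integration of the Fourier transform against a temperate weight defines a distribution. -/
lemma exists_distribution_integral_localFourier {w : Completion v → ℂ} (hw : TemperateWeight w)
    (c : ℂ) : ∃ T : LocalDistribution v, ∀ φ : SchwartzBruhat v,
      T φ = c * ∫ x, localFourier v φ x * w x ∂haar v := by
  cases v with
  | real =>
    obtain ⟨T, hT⟩ := exists_schwartz_form hw
    refine ⟨c • T.comp (FourierTransform.fourierCLM ℂ 𝓢(ℝ, ℂ)), fun φ => ?_⟩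
    let φ' : 𝓢(ℝ, ℂ) := φ
    have h1 := hT (FourierTransform.fourier φ')
    change c * T (FourierTransform.fourier φ') = _
    rw [h1]
    congr 1
    change _ = ∫ x : ℝ, localFourier .real (fun x : ℝ => φ' x) x * w x
    rw [localFourier_real_eq]
  | finite p =>
    have hint : ∀ φ : SchwartzBruhat (.finite p),
        Integrable (fun x => localFourier (.finite p) φ x * w x) (haar (.finite p)) := fun φ =>
      φ.rapidDecay_localFourier.integrable_mul hw
    refine ⟨({ toFun := fun φ : bruhatSpace p =>
                 c * ∫ x, localFourier (.finite p) φ.1 x * w x ∂haar (.finite p)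
               map_add' := ?_, map_smul' := ?_ } : bruhatSpace p →ₗ[ℂ] ℂ), fun φ => rfl⟩
    · intro f g
      have h1 : localFourier (.finite p) (f + g : bruhatSpace p).1 =
          localFourier (.finite p) f.1 + localFourier (.finite p) g.1 :=
        (VectorFourier.fourierIntegral_add (continuous_basicChar (.finite p))
          (L := LinearMap.mul (Completion (.finite p)) (Completion (.finite p))) continuous_mul
          (SchwartzBruhat.rapidDecay (v := .finite p) f).integrable
          (SchwartzBruhat.rapidDecay (v := .finite p) g).integrable)
      rw [h1, ← mul_add]
      congr 1
      simp only [Pi.add_apply, add_mul]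
      exact integral_add (hint f) (hint g)
    · intro a f
      have h1 : localFourier (.finite p) (a • f : bruhatSpace p).1 =
          a • localFourier (.finite p) f.1 :=
        Fourier.fourierIntegral_const_smul (basicChar (.finite p)) (haar (.finite p)) f.1 a
      rw [h1]
      simp only [Pi.smul_apply, smul_eq_mul, mul_assoc, RingHom.id_apply]
      rw [integral_const_mul, mul_left_comm]

/-! ### Meromorphic continuation -/

lemma analyticAt_invEuler (v : Place) (s : ℂ) : AnalyticAt ℂ (invEuler v) s :=
  (differentiable_invEuler v).analyticAt s

lemma eventually_invEuler_ne_zero (v : Place) (s : ℂ) : ∀ᶠ z in 𝓝[≠] s, invEuler v z ≠ 0 := by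
  rcases (analyticAt_invEuler v s).eventually_eq_zero_or_eventually_ne_zero with h | h
  · exfalso
    have h1 : AnalyticOnNhd ℂ (invEuler v) univ := fun z _ => analyticAt_invEuler v z
    have h2 := h1.eq_of_eventuallyEq (g := 0) (fun z _ => analyticAt_const) h
    exact invEuler_ne_zero v (s := 1) (by simp) (congrFun h2 1)
  · exact h

lemma meromorphicAt_tateGamma (v : Place) (s : ℂ) : MeromorphicAt (tateGamma v) s := by
  have h1 : AnalyticAt ℂ (fun z : ℂ => invEuler v (1 - z)) s :=
    ((differentiable_invEuler v).comp (differentiable_id.const_sub 1)).analyticAt s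
  exact (h1.meromorphicAt.div (analyticAt_invEuler v s).meromorphicAt).congr
    (Eventually.of_forall fun z => (tateGamma_eq_div v z).symm)

lemma eventually_tateGamma_ne_zero (v : Place) {s : ℂ} (hs : s.re < 1) :
    ∀ᶠ z in 𝓝[≠] s, tateGamma v z ≠ 0 := by
  have h1 : ∀ᶠ z in 𝓝[≠] s, z.re < 1 :=
    eventually_nhdsWithin_of_eventually_nhds
      ((isOpen_lt Complex.continuous_re continuous_const).mem_nhds hs)
  filter_upwards [eventually_invEuler_ne_zero v s, h1] with z hz hz1
  rw [tateGamma_eq_div]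
  exact div_ne_zero (invEuler_ne_zero v (by simpa using hz1)) hz

/-- The family `s ↦ ∫ φ̂ (x) |x| ^ (-s) dx`, which is the Riesz kernel, is holomorphic for `Re s <
1`. -/
lemma hasDerivAt_riesz (φ : SchwartzBruhat v) {s : ℂ} (hs : s.re < 1) :
    HasDerivAt (fun z => zetaIntegral (localFourier v φ) (1 - z))
      (∫ x, localFourier v φ x * (-(Real.log ‖x‖ : ℂ) * (‖x‖ : ℂ) ^ (-s)) ∂haar v) s := by
  have h := (φ.rapidDecay_localFourier.hasDerivAt_zetaIntegral (s := 1 - s)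
    (by simpa using hs)).comp s ((hasDerivAt_id s).const_sub 1)
  refine h.congr_deriv ?_
  rw [mul_neg_one, ← integral_neg]
  congr 1 with x
  rw [show (1 : ℂ) - s - 1 = -s by ring]
  ring

lemma analyticAt_riesz (φ : SchwartzBruhat v) {s : ℂ} (hs : s.re < 1) :
    AnalyticAt ℂ (fun z => zetaIntegral (localFourier v φ) (1 - z)) s := by
  refine DifferentiableOn.analyticAt (s := {z : ℂ | z.re < 1})
    (fun z hz => (hasDerivAt_riesz φ hz).differentiableAt.differentiableWithinAt) ?_
  exact (isOpen_lt Complex.continuous_re continuous_const).mem_nhds hs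

lemma analyticAt_zetaIntegral (φ : SchwartzBruhat v) {s : ℂ} (hs : 0 < s.re) :
    AnalyticAt ℂ (zetaIntegral φ) s := by
  refine DifferentiableOn.analyticAt (s := {z : ℂ | 0 < z.re}) (fun z hz =>
    (φ.rapidDecay.hasDerivAt_zetaIntegral hz).differentiableAt.differentiableWithinAt) ?_
  exact (isOpen_lt continuous_const Complex.continuous_re).mem_nhds hs

/-- Meromorphic functions on `Re s < 1` that agree on the critical strip agree off a discrete
set. -/
lemma eventually_eq_of_eq_on_strip {f g : ℂ → ℂ} (hf : ∀ s : ℂ, s.re < 1 → MeromorphicAt f s)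
    (hg : ∀ s : ℂ, s.re < 1 → MeromorphicAt g s)
    (h : ∀ s : ℂ, 0 < s.re → s.re < 1 → f s = g s) {s : ℂ} (hs : s.re < 1) :
    ∀ᶠ z in 𝓝[≠] s, f z = g z := by
  set U : Set ℂ := {z | z.re < 1}
  have hU : IsPreconnected U := (convex_halfSpace_re_lt 1).isPreconnected
  have hd : MeromorphicOn (f - g) U := fun z hz => (hf z hz).sub (hg z hz)
  have h2 : meromorphicOrderAt (f - g) (1 / 2) = ⊤ := by
    rw [meromorphicOrderAt_eq_top_iff]
    have hm : {z : ℂ | 0 < z.re ∧ z.re < 1} ∈ 𝓝 (1 / 2 : ℂ) :=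
      ((isOpen_lt continuous_const Complex.continuous_re).inter
        (isOpen_lt Complex.continuous_re continuous_const)).mem_nhds (by simp; norm_num)
    filter_upwards [eventually_nhdsWithin_of_eventually_nhds hm] with z hz
    rw [Pi.sub_apply, h z hz.1 hz.2, sub_self]
  have h3 : meromorphicOrderAt (f - g) s = ⊤ := by
    by_contra h4
    exact hd.meromorphicOrderAt_ne_top_of_isPreconnected hU hs (by simp [U]; norm_num) h4 h2
  rw [meromorphicOrderAt_eq_top_iff] at h3
  filter_upwards [h3] with z hz
  exact sub_eq_zero.1 hz

/-- The continuation of `Δ_s` to `Re s ≤ 0` is given by the functional equation. -/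
theorem exists_isHomogeneousFamily (v : Place) :
    ∃ Δ : ℂ → LocalDistribution v, IsHomogeneousFamily v Δ := by
  have key : ∀ s : ℂ, ∃ T : LocalDistribution v, ∀ φ : SchwartzBruhat v,
      T φ = if 0 < s.re then zetaIntegral φ s
        else tateGamma v s * zetaIntegral (localFourier v φ) (1 - s) := by
    intro s
    by_cases hs : 0 < s.re
    · obtain ⟨T, hT⟩ := exists_distribution_integral (v := v) (temperateWeight_norm_cpow hs)
      exact ⟨T, fun φ => by rw [if_pos hs, hT]; rfl⟩
    · have hs' : 0 < (1 - s).re := by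
        rw [Complex.sub_re, Complex.one_re]
        linarith
      obtain ⟨T, hT⟩ := exists_distribution_integral_localFourier (v := v)
        (temperateWeight_norm_cpow hs') (tateGamma v s)
      exact ⟨T, fun φ => by rw [if_neg hs, hT]; rfl⟩
  choose Δ hΔ using key
  refine ⟨Δ, fun s hs φ => φ.rapidDecay.integrable_mul (temperateWeight_norm_cpow hs),
    fun s hs φ => by rw [hΔ, if_pos hs]; rfl, fun φ s => ?_⟩
  rcases lt_or_ge 0 s.re with hs | hs
  · refine (analyticAt_zetaIntegral φ hs).meromorphicAt.congr ?_
    filter_upwards [eventually_nhdsWithin_of_eventually_nhds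
      ((isOpen_lt continuous_const Complex.continuous_re).mem_nhds hs)] with z hz
    rw [hΔ, if_pos hz]
  · have hs1 : s.re < 1 := hs.trans_lt one_pos
    refine ((meromorphicAt_tateGamma v s).mul (analyticAt_riesz φ hs1).meromorphicAt).congr ?_
    filter_upwards [eventually_nhdsWithin_of_eventually_nhds
      ((isOpen_lt Complex.continuous_re continuous_const).mem_nhds hs1)] with z hz
    rw [hΔ]
    split_ifs with h0
    · exact (zetaIntegral_schwartzBruhat φ h0 hz).symm
    · rfl

/-- By uniqueness of meromorphic continuation, `Δ_s / Γ_ν (s)` is `∫ φ̂ (x) |x| ^ (-s) dx`. -/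
lemma IsHomogeneousFamily.eventually_eq {Δ : ℂ → LocalDistribution v}
    (hΔ : IsHomogeneousFamily v Δ) (φ : SchwartzBruhat v) {s : ℂ} (hs : s.re < 1) :
    ∀ᶠ z in 𝓝[≠] s, zetaIntegral (localFourier v φ) (1 - z) = Δ z φ / tateGamma v z := by
  have h := eventually_eq_of_eq_on_strip (f := fun z => Δ z φ)
    (g := fun z => tateGamma v z * zetaIntegral (localFourier v φ) (1 - z))
    (fun z _ => hΔ.meromorphic φ z)
    (fun z hz => (meromorphicAt_tateGamma v z).mul (analyticAt_riesz φ hz).meromorphicAt)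
    (fun z h0 h1 => by
      rw [← zetaIntegral_schwartzBruhat φ h0 h1]
      exact hΔ.eq_integral z h0 φ) hs
  filter_upwards [h, eventually_tateGamma_ne_zero v hs] with z hz hz0
  rw [hz, mul_div_cancel_left₀ _ hz0]

theorem IsHomogeneousFamily.exists_isRieszKernel {Δ : ℂ → LocalDistribution v}
    (hΔ : IsHomogeneousFamily v Δ) : ∃ R : ℂ → LocalDistribution v, IsRieszKernel v Δ R := by
  have key : ∀ s : ℂ, ∃ T : LocalDistribution v, s.re < 1 → ∀ φ : SchwartzBruhat v,
      T φ = zetaIntegral (localFourier v φ) (1 - s) := by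
    intro s
    by_cases hs : s.re < 1
    · obtain ⟨T, hT⟩ := exists_distribution_integral_localFourier (v := v)
        (temperateWeight_norm_cpow (s := 1 - s) (by simpa using hs)) 1
      exact ⟨T, fun _ φ => by rw [hT, one_mul]; rfl⟩
    · obtain ⟨T, -⟩ := exists_distribution_integral (v := v) temperateWeight_one
      exact ⟨T, fun h => absurd h hs⟩
  choose R hR using key
  refine ⟨R, fun φ => ?_, fun φ s hs => ?_⟩
  · exact DifferentiableOn.congr (fun s hs =>
      (hasDerivAt_riesz φ hs).differentiableAt.differentiableWithinAt) fun s hs => hR s hs φ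
  · filter_upwards [hΔ.eventually_eq φ hs, eventually_nhdsWithin_of_eventually_nhds
      ((isOpen_lt Complex.continuous_re continuous_const).mem_nhds hs)] with z hz hz1
    rw [hR z hz1, hz]

/-- The Riesz kernel is the Fourier transform of `|x| ^ (-s)`. -/
lemma IsRieszKernel.eq_zetaIntegral {Δ R : ℂ → LocalDistribution v}
    (hR : IsRieszKernel v Δ R) (hΔ : IsHomogeneousFamily v Δ) (φ : SchwartzBruhat v) {s : ℂ}
    (hs : s.re < 1) : R s φ = zetaIntegral (localFourier v φ) (1 - s) := by
  have hU : {z : ℂ | z.re < 1} ∈ 𝓝 s :=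
    (isOpen_lt Complex.continuous_re continuous_const).mem_nhds hs
  have h1 : ContinuousAt (fun z => R z φ) s := (hR.holomorphic φ).continuousOn.continuousAt hU
  have h2 := (hasDerivAt_riesz φ hs).continuousAt
  have h3 : (fun z => R z φ) =ᶠ[𝓝[≠] s] fun z => zetaIntegral (localFourier v φ) (1 - z) := by
    filter_upwards [hΔ.eventually_eq φ hs, hR.eq_quotient φ s hs] with z hz hz'
    rw [hz, hz']
  exact tendsto_nhds_unique (h1.tendsto.mono_left nhdsWithin_le_nhds)
    ((h2.tendsto.mono_left nhdsWithin_le_nhds).congr' h3.symm)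

theorem exists_isFourierOfNegLog (v : Place) : ∃ G : LocalDistribution v, IsFourierOfNegLog v G := by
  obtain ⟨T, hT⟩ := exists_distribution_integral_localFourier (v := v) temperateWeight_log 1
  refine ⟨T, fun φ => ?_, fun φ => ?_⟩
  · simp_rw [mul_comm _ (localFourier v _ _)]
    exact φ.rapidDecay_localFourier.integrable_mul temperateWeight_log
  · simp_rw [hT, one_mul, mul_comm (localFourier v _ _)]

lemma IsFourierOfNegLog.hasDerivAt {G : LocalDistribution v} (hG : IsFourierOfNegLog v G)
    (φ : SchwartzBruhat v) :
    HasDerivAt (fun z => zetaIntegral (localFourier v φ) (1 - z)) (G φ) 0 := by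
  refine (hasDerivAt_riesz φ (s := 0) (by simp)).congr_deriv ?_
  rw [hG.eq_integral]
  congr 1 with x
  rw [neg_zero, Complex.cpow_zero]
  ring

/-- The Fourier transform of `-log |x|` is the derivative at `0` of the Riesz kernels. -/
theorem IsRieszKernel.hasDerivAt {Δ R : ℂ → LocalDistribution v} {G : LocalDistribution v}
    (hR : IsRieszKernel v Δ R) (hΔ : IsHomogeneousFamily v Δ) (hG : IsFourierOfNegLog v G)
    (φ : SchwartzBruhat v) : HasDerivAt (fun s : ℂ => R s φ) (G φ) 0 := by
  refine (hG.hasDerivAt φ).congr_of_eventuallyEq ?_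
  filter_upwards [(isOpen_lt Complex.continuous_re continuous_const).mem_nhds
    (show (0 : ℂ).re < 1 by simp)] with s hs
  exact hR.eq_zetaIntegral hΔ φ hs

/-! ### Growth of the logarithmic derivatives of the Euler factors -/

/-- The integrand of Gauss's integral for the digamma function: the factor `1 - x` compensates the
singularity at `x = 1`. -/
lemma norm_ofReal_cpow_sub_one_le {s : ℂ} {A x : ℝ} (hA : 0 < A) (hs : A ≤ s.re) (hx0 : 0 < x)
    (hx1 : x < 1) : ‖(x : ℂ) ^ (s - 1) - 1‖ ≤
      (2 * (x ^ (A - 1) + 1) + 4 * ‖s - 1‖) * (1 - x) := by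
  have hx1' : 0 < 1 - x := sub_pos.2 hx1
  rcases le_total x (1 / 2) with h | h
  · have h1 : ‖(x : ℂ) ^ (s - 1)‖ ≤ x ^ (A - 1) := by
      rw [Complex.norm_cpow_eq_rpow_re_of_pos hx0, Complex.sub_re, Complex.one_re]
      exact Real.rpow_le_rpow_of_exponent_ge hx0 hx1.le (by linarith)
    have h2 : 0 ≤ x ^ (A - 1) := by positivity
    calc ‖(x : ℂ) ^ (s - 1) - 1‖ ≤ ‖(x : ℂ) ^ (s - 1)‖ + ‖(1 : ℂ)‖ := norm_sub_le _ _
      _ ≤ (2 * (x ^ (A - 1) + 1)) * (1 - x) := by rw [norm_one]; nlinarith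
      _ ≤ _ := by gcongr; linarith [norm_nonneg (s - 1)]
  · have hder : ∀ u ∈ Icc (1 / 2 : ℝ) 1, HasDerivWithinAt (fun u : ℝ => (u : ℂ) ^ (s - 1))
        ((s - 1) * (u : ℂ) ^ (s - 1 - 1)) (Icc (1 / 2) 1) u := by
      intro u hu
      have hu0 : 0 < u := lt_of_lt_of_le (by norm_num) hu.1
      have := (hasDerivAt_id (u : ℂ)).cpow_const (c := s - 1) (Or.inl (by simpa using hu0))
      simpa using this.comp_ofReal.hasDerivWithinAt
    have hbd : ∀ u ∈ Icc (1 / 2 : ℝ) 1, ‖(s - 1) * (u : ℂ) ^ (s - 1 - 1)‖ ≤ 4 * ‖s - 1‖ := by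
      intro u hu
      have hu0 : 0 < u := lt_of_lt_of_le (by norm_num) hu.1
      rw [norm_mul, Complex.norm_cpow_eq_rpow_re_of_pos hu0, mul_comm]
      gcongr
      calc u ^ (s - 1 - 1).re ≤ u ^ (-2 : ℝ) := by
            refine Real.rpow_le_rpow_of_exponent_ge hu0 hu.2 ?_
            simp only [Complex.sub_re, Complex.one_re]
            linarith
        _ ≤ (1 / 2 : ℝ) ^ (-2 : ℝ) :=
            Real.rpow_le_rpow_of_nonpos (by norm_num) hu.1 (by norm_num)
        _ = 4 := by rw [Real.rpow_neg (by norm_num)]; norm_num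
    have h1 := (convex_Icc (1 / 2 : ℝ) 1).norm_image_sub_le_of_norm_hasDerivWithin_le hder hbd
      (right_mem_Icc.2 (by norm_num)) ⟨h, hx1.le⟩
    rw [Complex.ofReal_one, Complex.one_cpow, Real.norm_eq_abs, abs_sub_comm,
      abs_of_pos hx1'] at h1
    refine h1.trans ?_
    gcongr
    have : 0 ≤ x ^ (A - 1) := by positivity
    linarith

/-- A difference of Beta integrals, bounded uniformly in the second argument. -/
lemma norm_betaIntegral_sub_le {s : ℂ} {A h : ℝ} (hA : 0 < A) (hs : A ≤ s.re) (hh : 0 < h) :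
    ‖Complex.betaIntegral s h - Complex.betaIntegral 1 h‖ ≤ 2 / A + 2 + 4 * ‖s - 1‖ := by
  have hc1 := Complex.betaIntegral_convergent (u := s) (v := h) (hA.trans_le hs) (by simpa using hh)
  have hc2 := Complex.betaIntegral_convergent (u := 1) (v := h) (by simp) (by simpa using hh)
  have hA1 : (-1 : ℝ) < A - 1 := by linarith
  have hb : IntervalIntegrable (fun x : ℝ => 2 * (x ^ (A - 1) + 1) + 4 * ‖s - 1‖) volume 0 1 :=
    (((intervalIntegral.intervalIntegrable_rpow' hA1).add intervalIntegrable_const).const_mul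
      2).add intervalIntegrable_const
  rw [Complex.betaIntegral, Complex.betaIntegral, ← intervalIntegral.integral_sub hc1 hc2]
  have h1 : ∫ x in (0 : ℝ)..1, (2 * (x ^ (A - 1) + 1) + 4 * ‖s - 1‖) =
      2 / A + 2 + 4 * ‖s - 1‖ := by
    have hi := intervalIntegral.intervalIntegrable_rpow' (a := 0) (b := 1) hA1
    rw [intervalIntegral.integral_add ((hi.add intervalIntegrable_const).const_mul 2)
      intervalIntegrable_const, intervalIntegral.integral_const_mul,
      intervalIntegral.integral_add hi intervalIntegrable_const, integral_rpow (Or.inl hA1)]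
    simp [hA.ne']
    ring
  rw [← h1]
  refine intervalIntegral.norm_integral_le_of_norm_le zero_le_one ?_ hb
  have hne : ∀ᵐ x : ℝ, x ≠ 1 := by simp [ae_iff]
  filter_upwards [hne] with x hx1 hx
  have hx' : x < 1 := lt_of_le_of_ne hx.2 hx1
  have hx1' : 0 < 1 - x := sub_pos.2 hx'
  have h2 : ‖(1 - (x : ℂ)) ^ ((h : ℂ) - 1)‖ = (1 - x) ^ (h - 1) := by
    rw [← Complex.ofReal_one, ← Complex.ofReal_sub, Complex.norm_cpow_eq_rpow_re_of_pos hx1']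
    simp
  rw [← sub_mul, norm_mul, sub_self, Complex.cpow_zero, h2]
  have h3 : (1 - x) * (1 - x) ^ (h - 1) ≤ 1 := by
    rw [← Real.rpow_one_add' hx1'.le (by linarith)]
    exact Real.rpow_le_one hx1'.le (by linarith [hx.1]) (by linarith)
  calc _ ≤ ((2 * (x ^ (A - 1) + 1) + 4 * ‖s - 1‖) * (1 - x)) * (1 - x) ^ (h - 1) := by
        gcongr
        exact norm_ofReal_cpow_sub_one_le hA hs hx.1 hx'
    _ = (2 * (x ^ (A - 1) + 1) + 4 * ‖s - 1‖) * ((1 - x) * (1 - x) ^ (h - 1)) := by ring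
    _ ≤ _ := by
      refine mul_le_of_le_one_right ?_ h3
      have : 0 ≤ x ^ (A - 1) := Real.rpow_nonneg hx.1.le _
      positivity

/-- The digamma function grows at most linearly on a half-plane `Re s ≥ A > 0`: it is a limit of
differences of Beta integrals, which is Gauss's integral for `ψ (s) - ψ (1)`. -/
lemma norm_digamma_sub_le {s : ℂ} {A : ℝ} (hA : 0 < A) (hs : A ≤ s.re) :
    ‖logDeriv Complex.Gamma s - logDeriv Complex.Gamma 1‖ ≤ 2 / A + 2 + 4 * ‖s - 1‖ := by
  have hs0 : 0 < s.re := hA.trans_le hs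
  have hne : ∀ {z : ℂ}, 0 < z.re → Complex.Gamma z ≠ 0 :=
    fun h => Complex.Gamma_ne_zero_of_re_pos h
  have hd : ∀ {z : ℂ}, 0 < z.re → DifferentiableAt ℂ Complex.Gamma z := fun {z} h =>
    Complex.differentiableAt_Gamma z fun m hm => by
      rw [hm] at h
      simp at h
      have : (0 : ℝ) ≤ m := by positivity
      linarith
  -- The quotient whose derivative at `0` is the difference of the logarithmic derivatives.
  set q : ℂ → ℂ := fun z => Complex.Gamma s / Complex.Gamma (s + z) -
    Complex.Gamma 1 / Complex.Gamma (1 + z) with hq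
  have hder : ∀ w : ℂ, 0 < w.re → HasDerivAt (fun z => Complex.Gamma w / Complex.Gamma (w + z))
      (-logDeriv Complex.Gamma w) 0 := by
    intro w hw
    have h1 : HasDerivAt (fun z => Complex.Gamma (w + z)) (deriv Complex.Gamma w) 0 := by
      have h2 : HasDerivAt Complex.Gamma (deriv Complex.Gamma w) (w + 0) := by
        rw [add_zero]; exact (hd hw).hasDerivAt
      exact h2.comp_const_add w 0
    have h3 := (hasDerivAt_const (0 : ℂ) (Complex.Gamma w)).div h1 (by rw [add_zero]; exact hne hw)
    refine h3.congr_deriv ?_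
    rw [add_zero, logDeriv_apply]
    have := hne hw
    field_simp
    ring
  have hqd : HasDerivAt q (-logDeriv Complex.Gamma s - -logDeriv Complex.Gamma 1) 0 :=
    (hder s hs0).sub (hder 1 (by simp))
  have hqr : HasDerivAt (fun h : ℝ => q h)
      (-logDeriv Complex.Gamma s - -logDeriv Complex.Gamma 1) 0 := by
    have := hqd
    rw [← Complex.ofReal_zero] at this
    exact this.comp_ofReal
  have hlim := hqr.tendsto_slope_zero_right
  have hG : Tendsto (fun h : ℝ => Complex.Gamma (h + 1)) (𝓝[>] 0) (𝓝 1) := by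
    have h1 : ContinuousAt (fun h : ℝ => Complex.Gamma (h + 1)) 0 := by
      have h2 : ContinuousAt Complex.Gamma (((0 : ℝ) : ℂ) + 1) :=
        (hd (by simp)).continuousAt
      exact ContinuousAt.comp (f := fun h : ℝ => (h : ℂ) + 1) h2 (by fun_prop)
    have h2 := h1.tendsto
    simp only [Complex.ofReal_zero, zero_add, Complex.Gamma_one] at h2
    exact h2.mono_left nhdsWithin_le_nhds
  have hlim2 := (hG.mul hlim).norm
  rw [one_mul, neg_sub_neg, norm_sub_rev] at hlim2
  refine le_of_tendsto hlim2 ?_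
  filter_upwards [self_mem_nhdsWithin] with h hh
  have hh0 : (0 : ℝ) < h := hh
  have hhc : (h : ℂ) ≠ 0 := by exact_mod_cast hh0.ne'
  have hb1 := Complex.Gamma_mul_Gamma_eq_betaIntegral (s := s) (t := h) hs0 (by simpa using hh0)
  have hb2 := Complex.Gamma_mul_Gamma_eq_betaIntegral (s := 1) (t := h) (by simp)
    (by simpa using hh0)
  have hn1 : Complex.Gamma (s + h) ≠ 0 := hne (by simp; linarith)
  have hn2 : Complex.Gamma (1 + h) ≠ 0 := hne (by simp; linarith)
  have key : Complex.Gamma (h + 1) * (h⁻¹ • (q ((0 + h : ℝ) : ℂ) - q ((0 : ℝ) : ℂ))) =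
      Complex.betaIntegral s h - Complex.betaIntegral 1 h := by
    have hq0 : q ((0 : ℝ) : ℂ) = 0 := by
      simp [hq, div_self (hne hs0)]
    rw [hq0, zero_add, sub_zero, Complex.Gamma_add_one _ hhc, Complex.real_smul,
      Complex.ofReal_inv]
    have e1 : Complex.betaIntegral s h = Complex.Gamma s * Complex.Gamma h / Complex.Gamma (s + h) := by
      rw [hb1, mul_div_cancel_left₀ _ hn1]
    have e2 : Complex.betaIntegral 1 h = Complex.Gamma 1 * Complex.Gamma h / Complex.Gamma (1 + h) := by
      rw [hb2, mul_div_cancel_left₀ _ hn2]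
    rw [e1, e2]
    simp only [hq]
    field_simp
  rw [key]
  exact norm_betaIntegral_sub_le hA hs hh0

lemma differentiableAt_eulerFactor (v : Place) {s : ℂ} (hs : 0 < s.re) :
    DifferentiableAt ℂ (eulerFactor v) s := by
  rw [show eulerFactor v = fun z => (invEuler v z)⁻¹ from funext (eulerFactor_eq_inv v)]
  exact (differentiable_invEuler v s).inv (invEuler_ne_zero v hs)

lemma eulerFactor_ne_zero (v : Place) {s : ℂ} (hs : 0 < s.re) : eulerFactor v s ≠ 0 := by
  rw [eulerFactor_eq_inv]
  exact inv_ne_zero (invEuler_ne_zero v hs)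

lemma differentiableAt_logDeriv_eulerFactor (v : Place) {s : ℂ} (hs : 0 < s.re) :
    DifferentiableAt ℂ (logDeriv (eulerFactor v)) s := by
  have hd : DifferentiableOn ℂ (eulerFactor v) {z | 0 < z.re} := fun z hz =>
    (differentiableAt_eulerFactor v hz).differentiableWithinAt
  have hU : {z : ℂ | 0 < z.re} ∈ 𝓝 s :=
    (isOpen_lt continuous_const Complex.continuous_re).mem_nhds hs
  exact (hd.analyticAt hU).deriv.differentiableAt.div (differentiableAt_eulerFactor v hs)
    (eulerFactor_ne_zero v hs)

/-- The two factors of `Γ_ν` contribute with the same sign, because of the reflection `s ↦ 1 - s`.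
-/
lemma logDeriv_tateGamma (v : Place) {s : ℂ} (hs0 : 0 < s.re) (hs1 : s.re < 1) :
    logDeriv (tateGamma v) s = logDeriv (eulerFactor v) s + logDeriv (eulerFactor v) (1 - s) := by
  have hs1' : 0 < (1 - s).re := by simpa using hs1
  have h1 : DifferentiableAt ℂ (fun z => eulerFactor v (1 - z)) s :=
    (differentiableAt_eulerFactor v hs1').comp s (differentiableAt_id.const_sub 1)
  have h2 := logDeriv_div (g := fun z => eulerFactor v (1 - z)) s (eulerFactor_ne_zero v hs0)
    (eulerFactor_ne_zero v hs1')
    (differentiableAt_eulerFactor v hs0) h1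
  have h3 : deriv (fun z => eulerFactor v (1 - z)) s = -deriv (eulerFactor v) (1 - s) :=
    deriv_comp_const_sub (eulerFactor v) 1 s
  change logDeriv (fun z => eulerFactor v z / eulerFactor v (1 - z)) s = _
  rw [h2, sub_eq_add_neg]
  congr 1
  rw [logDeriv_apply, logDeriv_apply, h3, neg_div, neg_neg]

lemma logDeriv_eulerFactor_finite (p : Nat.Primes) {s : ℂ} (hs : 0 < s.re) :
    logDeriv (eulerFactor (.finite p)) s =
      -(((p : ℕ) : ℂ) ^ (-s) * Complex.log (p : ℕ) / (1 - ((p : ℕ) : ℂ) ^ (-s))) := by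
  have hpc : ((p : ℕ) : ℂ) ≠ 0 := by exact_mod_cast p.2.ne_zero
  have h0 : 1 - ((p : ℕ) : ℂ) ^ (-s) ≠ 0 := invEuler_ne_zero (.finite p) hs
  have h1 : HasDerivAt (fun z : ℂ => ((p : ℕ) : ℂ) ^ (-z))
      (((p : ℕ) : ℂ) ^ (-s) * Complex.log (p : ℕ) * (-1)) s :=
    (hasDerivAt_id s).neg.const_cpow (Or.inl hpc)
  have h2 := (h1.const_sub 1).inv h0
  have h3 : eulerFactor (.finite p) = (fun z : ℂ => 1 - ((p : ℕ) : ℂ) ^ (-z))⁻¹ := by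
    funext z
    simp [eulerFactor]
  rw [logDeriv_apply, h3, h2.deriv]
  simp only [Pi.inv_apply]
  field_simp

lemma logDeriv_eulerFactor_real {s : ℂ} (hs : 0 < s.re) :
    logDeriv (eulerFactor .real) s =
      (-Complex.log Real.pi + logDeriv Complex.Gamma (s / 2)) / 2 := by
  have hpc : (Real.pi : ℂ) ≠ 0 := by exact_mod_cast Real.pi_ne_zero
  have hs2 : 0 < (s / 2).re := by simpa using hs
  have hG0 := Complex.Gamma_ne_zero_of_re_pos hs2
  have h1 : HasDerivAt (fun z : ℂ => (Real.pi : ℂ) ^ (-z / 2))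
      ((Real.pi : ℂ) ^ (-s / 2) * Complex.log Real.pi * (-1 / 2)) s :=
    ((hasDerivAt_id s).neg.div_const 2).const_cpow (Or.inl hpc)
  have hG : DifferentiableAt ℂ Complex.Gamma (s / 2) :=
    Complex.differentiableAt_Gamma _ fun m hm => by
      rw [hm] at hs2
      simp at hs2
      have : (0 : ℝ) ≤ m := by positivity
      linarith
  have h2 : HasDerivAt (fun z : ℂ => Complex.Gamma (z / 2)) (deriv Complex.Gamma (s / 2) * (1 / 2)) s :=
    hG.hasDerivAt.comp s ((hasDerivAt_id s).div_const 2)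
  have hp0 : (Real.pi : ℂ) ^ (-s / 2) ≠ 0 := by simp [Complex.cpow_eq_zero_iff, hpc]
  rw [logDeriv_apply, logDeriv_apply]
  change deriv (fun z : ℂ => (Real.pi : ℂ) ^ (-z / 2) * Complex.Gamma (z / 2)) s /
    ((Real.pi : ℂ) ^ (-s / 2) * Complex.Gamma (s / 2)) = _
  rw [(h1.fun_mul h2).deriv]
  field_simp

lemma norm_le_of_re_mem {s : ℂ} {A B : ℝ} (hA : A ≤ s.re) (hB : s.re ≤ B) :
    ‖s‖ ≤ |A| + |B| + |s.im| := by
  refine (Complex.norm_le_abs_re_add_abs_im s).trans ?_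
  gcongr
  rw [abs_le]
  constructor
  · linarith [neg_abs_le A, abs_nonneg B]
  · linarith [le_abs_self B, abs_nonneg A]

/-- On vertical strips to the right of `0`, the logarithmic derivative of the Euler factor grows at
most linearly. -/
lemma exists_norm_logDeriv_eulerFactor_le (v : Place) {A : ℝ} (hA : 0 < A) (B : ℝ) :
    ∃ C : ℝ, 0 ≤ C ∧ ∀ s : ℂ, A ≤ s.re → s.re ≤ B →
      ‖logDeriv (eulerFactor v) s‖ ≤ C * (1 + |s.im|) := by
  cases v with
  | real =>
    set D := |Real.log Real.pi| + ‖logDeriv Complex.Gamma 1‖ + 2 / (A / 2) + 2 +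
      4 * (|A| + |B| + 1) + 4 with hD
    refine ⟨D, by positivity, fun s hs hs' => ?_⟩
    rw [logDeriv_eulerFactor_real (hA.trans_le hs)]
    have h1 := norm_digamma_sub_le (s := s / 2) (A := A / 2) (by linarith)
      (by simp; linarith)
    have h2 := norm_le_of_re_mem hs hs'
    have h3 : ‖s / 2 - 1‖ ≤ ‖s‖ + 1 := by
      refine (norm_sub_le _ _).trans ?_
      rw [norm_div, norm_one, Complex.norm_ofNat]
      linarith [norm_nonneg s]
    have h4 : ‖logDeriv Complex.Gamma (s / 2)‖ ≤
        ‖logDeriv Complex.Gamma (s / 2) - logDeriv Complex.Gamma 1‖ + ‖logDeriv Complex.Gamma 1‖ := by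
      simpa using norm_add_le (logDeriv Complex.Gamma (s / 2) - logDeriv Complex.Gamma 1)
        (logDeriv Complex.Gamma 1)
    have h5 : ‖Complex.log Real.pi‖ = |Real.log Real.pi| := by
      rw [← Complex.ofReal_log Real.pi_pos.le, Complex.norm_real, Real.norm_eq_abs]
    have h6 : ‖(-Complex.log Real.pi + logDeriv Complex.Gamma (s / 2)) / 2‖ ≤
        |Real.log Real.pi| + ‖logDeriv Complex.Gamma (s / 2)‖ := by
      rw [norm_div, Complex.norm_ofNat]
      have := norm_add_le (-Complex.log Real.pi) (logDeriv Complex.Gamma (s / 2))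
      rw [norm_neg, h5] at this
      linarith [norm_nonneg (-Complex.log Real.pi + logDeriv Complex.Gamma (s / 2))]
    have h7 : D + 4 * |s.im| ≤ D * (1 + |s.im|) := by
      have h8 : 4 ≤ D := by
        have : 0 ≤ |Real.log Real.pi| + ‖logDeriv Complex.Gamma 1‖ + 2 / (A / 2) + 2 +
          4 * (|A| + |B| + 1) := by positivity
        linarith
      nlinarith [abs_nonneg s.im]
    linarith
  | finite p =>
    have hlog : 0 ≤ Real.log (p : ℕ) := Real.log_nonneg (one_lt_prime p).le
    have hA1 : ((p : ℕ) : ℝ) ^ (-A) < 1 :=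
      Real.rpow_lt_one_of_one_lt_of_neg (one_lt_prime p) (by linarith)
    have hA2 : 0 < 1 - ((p : ℕ) : ℝ) ^ (-A) := by linarith
    refine ⟨Real.log (p : ℕ) / (1 - ((p : ℕ) : ℝ) ^ (-A)), by positivity, fun s hs _ => ?_⟩
    have h1 : ‖((p : ℕ) : ℂ) ^ (-s)‖ ≤ ((p : ℕ) : ℝ) ^ (-A) := by
      rw [norm_prime_cpow_neg]
      exact Real.rpow_le_rpow_of_exponent_le (one_lt_prime p).le (by linarith)
    have h2 : 1 - ((p : ℕ) : ℝ) ^ (-A) ≤ ‖1 - ((p : ℕ) : ℂ) ^ (-s)‖ := by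
      have := norm_sub_norm_le (1 : ℂ) (((p : ℕ) : ℂ) ^ (-s))
      rw [norm_one] at this
      linarith
    have h3 : ‖Complex.log (p : ℕ)‖ = Real.log (p : ℕ) := by
      rw [← Complex.ofReal_natCast, ← Complex.ofReal_log (prime_pos p).le, Complex.norm_real,
        Real.norm_of_nonneg hlog]
    rw [logDeriv_eulerFactor_finite p (hA.trans_le hs), norm_neg, norm_div, norm_mul, h3]
    calc _ ≤ 1 * Real.log (p : ℕ) / (1 - ((p : ℕ) : ℝ) ^ (-A)) := by
          gcongr
          exact h1.trans hA1.le
      _ = Real.log (p : ℕ) / (1 - ((p : ℕ) : ℝ) ^ (-A)) * 1 := by ring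
      _ ≤ _ := by gcongr; linarith [abs_nonneg s.im]

/-! ### Mellin transforms of test functions on the half-line -/

/-- Smooth functions on the line supported in the interval `(a, b)` of the half-line. -/
structure IsTestOn (a b : ℝ) (f : ℝ → ℂ) : Prop where
  pos : 0 < a
  lt : a < b
  contDiff : ContDiff ℝ ∞ f
  tsupport_subset : tsupport f ⊆ Ioo a b

lemma IsTestOn.eq_zero {a b : ℝ} {f : ℝ → ℂ} (hf : IsTestOn a b f) {u : ℝ} (hu : u ∉ Ioo a b) :
    f u = 0 :=
  image_eq_zero_of_notMem_tsupport fun h => hu (hf.tsupport_subset h)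

lemma exists_isTestOn (g : 𝓓(halfLine, ℂ)) : ∃ a b : ℝ, IsTestOn a b g := by
  have hK : IsCompact (tsupport g) := g.hasCompactSupport.isCompact
  have hpos : ∀ x ∈ tsupport g, 0 < x := fun x hx => g.tsupport_subset hx
  obtain ⟨b, hb⟩ := hK.bddAbove
  obtain ⟨a, ha0, ha⟩ : ∃ a : ℝ, 0 < a ∧ ∀ x ∈ tsupport g, a ≤ x := by
    rcases (tsupport g).eq_empty_or_nonempty with h | h
    · exact ⟨1, one_pos, by simp [h]⟩
    · obtain ⟨x, hx, hmin⟩ := hK.exists_isMinOn h continuousOn_id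
      exact ⟨x, hpos x hx, fun y hy => hmin hy⟩
  refine ⟨a / 2, max a b + 1, by positivity, by linarith [le_max_left a b], g.contDiff,
    fun x hx => ⟨by linarith [ha x hx], ?_⟩⟩
  have := hb hx
  linarith [le_max_right a b]

/-- The Euler operator `f ↦ u f' (u)` preserves test functions. -/
lemma IsTestOn.mul_deriv {a b : ℝ} {f : ℝ → ℂ} (hf : IsTestOn a b f) :
    IsTestOn a b (fun u => (u : ℂ) * deriv f u) where
  pos := hf.pos
  lt := hf.lt
  contDiff := Complex.ofRealCLM.contDiff.mul ((contDiff_infty_iff_deriv.1 hf.contDiff).2)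
  tsupport_subset := (tsupport_mul_subset_right (f := fun u : ℝ => (u : ℂ))).trans
    ((closure_minimal support_deriv_subset (isClosed_tsupport f)).trans hf.tsupport_subset)

lemma IsTestOn.mellin_eq {a b : ℝ} {f : ℝ → ℂ} (hf : IsTestOn a b f) (s : ℂ) :
    mellin f s = ∫ u in a..b, (u : ℂ) ^ (s - 1) * f u := by
  rw [mellin, intervalIntegral.integral_of_le hf.lt.le]
  refine setIntegral_eq_of_subset_of_forall_sdiff_eq_zero measurableSet_Ioi
    (fun u hu => hf.pos.trans hu.1) fun u hu => ?_
  rw [hf.eq_zero fun h => hu.2 ⟨h.1, h.2.le⟩, smul_zero]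

/-- Integration by parts. -/
lemma IsTestOn.mellin_mul_deriv {a b : ℝ} {f : ℝ → ℂ} (hf : IsTestOn a b f) (s : ℂ) :
    mellin (fun u => (u : ℂ) * deriv f u) s = -(s * mellin f s) := by
  rw [hf.mul_deriv.mellin_eq, hf.mellin_eq, ← intervalIntegral.integral_const_mul]
  have h0 : ∀ u ∈ uIcc a b, 0 < u := fun u hu => by
    rw [uIcc_of_le hf.lt.le] at hu
    exact hf.pos.trans_le hu.1
  have h1 : ∀ u ∈ uIcc a b, HasDerivAt (fun u : ℝ => (u : ℂ) ^ s) (s * (u : ℂ) ^ (s - 1)) u := by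
    intro u hu
    have := (hasDerivAt_id (u : ℂ)).cpow_const (c := s) (Or.inl (by simpa using h0 u hu))
    simpa using this.comp_ofReal
  have h2 : ∀ u ∈ uIcc a b, HasDerivAt f (deriv f u) u := fun u _ =>
    (hf.contDiff.differentiable (by simp) u).hasDerivAt
  have hc : ∀ z : ℂ, ContinuousOn (fun u : ℝ => (u : ℂ) ^ z) (uIcc a b) := fun z =>
    continuousOn_of_forall_continuousAt fun u hu =>
      Complex.continuousAt_ofReal_cpow_const _ _ (Or.inr (h0 u hu).ne')
  have h3 := intervalIntegral.integral_mul_deriv_eq_deriv_mul h1 h2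
    (((hc (s - 1)).const_smul s).intervalIntegrable)
    ((hf.contDiff.continuous_deriv (by simp)).intervalIntegrable a b)
  rw [hf.eq_zero (u := a) (by simp), hf.eq_zero (u := b) (by simp)] at h3
  simp only [mul_zero, sub_self, zero_sub] at h3
  simp_rw [← mul_assoc s]
  rw [← h3]
  refine intervalIntegral.integral_congr fun u hu => ?_
  have hu0 : (u : ℂ) ≠ 0 := by exact_mod_cast (h0 u hu).ne'
  rw [Complex.cpow_sub _ _ hu0, Complex.cpow_one]
  field_simp

lemma IsTestOn.exists_norm_mellin_le {a b : ℝ} {f : ℝ → ℂ} (hf : IsTestOn a b f) (A B : ℝ) :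
    ∃ C : ℝ, 0 ≤ C ∧ ∀ s : ℂ, A ≤ s.re → s.re ≤ B → ‖mellin f s‖ ≤ C := by
  obtain ⟨M, hM⟩ := (HasCompactSupport.of_support_subset_isCompact (isCompact_Icc (a := a) (b := b))
    (fun u hu => by
      by_contra h
      exact hu (hf.eq_zero fun h' => h ⟨h'.1.le, h'.2.le⟩))).exists_bound_of_continuous
    hf.contDiff.continuous
  have hM0 : 0 ≤ M := (norm_nonneg _).trans (hM 0)
  have hb : 0 < b := hf.pos.trans hf.lt
  set D := a ^ (A - 1) + a ^ (B - 1) + (b ^ (A - 1) + b ^ (B - 1)) with hD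
  have ha := hf.pos
  have hD0 : 0 ≤ D := by positivity
  have hl := hf.lt
  refine ⟨D * M * |b - a|, by positivity, fun s hA hB => ?_⟩
  rw [hf.mellin_eq]
  refine intervalIntegral.norm_integral_le_of_norm_le_const fun u hu => ?_
  rw [uIoc_of_le hf.lt.le] at hu
  have hu0 : 0 < u := hf.pos.trans hu.1
  rw [norm_mul, Complex.norm_cpow_eq_rpow_re_of_pos hu0, Complex.sub_re, Complex.one_re]
  gcongr
  · have e1 : 0 ≤ a ^ (A - 1) := by positivity
    have e2 : 0 ≤ a ^ (B - 1) := by positivity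
    have e3 : 0 ≤ b ^ (A - 1) := by positivity
    have e4 : 0 ≤ b ^ (B - 1) := by positivity
    have mono : ∀ z : ℝ, u ^ z ≤ a ^ z + b ^ z := by
      intro z
      rcases le_total 0 z with hz | hz
      · exact (Real.rpow_le_rpow hu0.le hu.2 hz).trans (le_add_of_nonneg_left (by positivity))
      · exact (Real.rpow_le_rpow_of_nonpos ha hu.1.le hz).trans
          (le_add_of_nonneg_right (by positivity))
    rcases le_total 1 u with h | h
    · have := Real.rpow_le_rpow_of_exponent_le h (show s.re - 1 ≤ B - 1 by linarith)
      linarith [mono (B - 1)]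
    · have := Real.rpow_le_rpow_of_exponent_ge hu0 h (show A - 1 ≤ s.re - 1 by linarith)
      linarith [mono (A - 1)]
  · exact hM u

/-- Mellin transforms of test functions decay rapidly on vertical strips. -/
lemma IsTestOn.exists_pow_mul_norm_mellin_le {a b : ℝ} {f : ℝ → ℂ} (hf : IsTestOn a b f) (A B : ℝ)
    (k : ℕ) : ∃ C : ℝ, 0 ≤ C ∧ ∀ s : ℂ, A ≤ s.re → s.re ≤ B →
      (1 + |s.im|) ^ k * ‖mellin f s‖ ≤ C := by
  induction k generalizing f with
  | zero => simpa using hf.exists_norm_mellin_le A B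
  | succ k ih =>
    obtain ⟨C₁, h₁0, h₁⟩ := ih hf
    obtain ⟨C₂, h₂0, h₂⟩ := ih hf.mul_deriv
    refine ⟨C₁ + C₂, by positivity, fun s hA hB => ?_⟩
    have e1 := h₁ s hA hB
    have e2 := h₂ s hA hB
    rw [hf.mellin_mul_deriv, norm_neg, norm_mul] at e2
    have e3 : |s.im| * ‖mellin f s‖ ≤ ‖s‖ * ‖mellin f s‖ := by
      gcongr
      exact Complex.abs_im_le_norm s
    have e4 : (1 + |s.im|) ^ k * (|s.im| * ‖mellin f s‖) ≤ C₂ :=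
      (mul_le_mul_of_nonneg_left e3 (by positivity)).trans e2
    calc (1 + |s.im|) ^ (k + 1) * ‖mellin f s‖
        = (1 + |s.im|) ^ k * ‖mellin f s‖ + (1 + |s.im|) ^ k * (|s.im| * ‖mellin f s‖) := by ring
      _ ≤ _ := add_le_add e1 e4

lemma IsTestOn.isBigO_top {a b : ℝ} {f : ℝ → ℂ} (hf : IsTestOn a b f) (r : ℝ) :
    f =O[atTop] (· ^ (-r)) := by
  refine (Asymptotics.isBigO_zero (E' := ℂ) (fun x : ℝ => x ^ (-r)) atTop).congr' ?_ EventuallyEq.rfl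
  filter_upwards [eventually_ge_atTop b] with u hu
  exact (hf.eq_zero fun h => absurd h.2 (not_lt.2 hu)).symm

lemma IsTestOn.isBigO_zero {a b : ℝ} {f : ℝ → ℂ} (hf : IsTestOn a b f) (r : ℝ) :
    f =O[𝓝[>] 0] (· ^ (-r)) := by
  refine (Asymptotics.isBigO_zero (E' := ℂ) (fun x : ℝ => x ^ (-r)) _).congr' ?_ EventuallyEq.rfl
  filter_upwards [eventually_nhdsWithin_of_eventually_nhds (eventually_le_nhds hf.pos)] with u hu
  exact (hf.eq_zero fun h => absurd h.1 (not_lt.2 hu)).symm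

lemma IsTestOn.hasDerivAt_mellin {a b : ℝ} {f : ℝ → ℂ} (hf : IsTestOn a b f) (s : ℂ) :
    MellinConvergent (fun u : ℝ => Real.log u • f u) s ∧
      HasDerivAt (mellin f) (mellin (fun u : ℝ => Real.log u • f u) s) s :=
  mellin_hasDerivAt_of_isBigO_rpow (hf.contDiff.continuous.locallyIntegrable.locallyIntegrableOn _)
    (hf.isBigO_top (s.re + 1)) (lt_add_one _) (hf.isBigO_zero (s.re - 1)) (sub_one_lt _)

lemma IsTestOn.mellinConvergent {a b : ℝ} {f : ℝ → ℂ} (hf : IsTestOn a b f) (s : ℂ) :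
    MellinConvergent f s :=
  mellinConvergent_of_isBigO_rpow (hf.contDiff.continuous.locallyIntegrable.locallyIntegrableOn _)
    (hf.isBigO_top (s.re + 1)) (lt_add_one _) (hf.isBigO_zero (s.re - 1)) (sub_one_lt _)

lemma IsTestOn.differentiable_mellin {a b : ℝ} {f : ℝ → ℂ} (hf : IsTestOn a b f) :
    Differentiable ℂ (mellin f) := fun s => (hf.hasDerivAt_mellin s).2.differentiableAt

/-! ### Integrals over vertical lines -/

/-- Quadratic decay implies absolute convergence along a vertical line. -/
lemma lineIntegrable_of_norm_le {c C : ℝ} {F : ℂ → ℂ}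
    (hF : Continuous fun t : ℝ => F (c + t * Complex.I))
    (hC : ∀ t : ℝ, ‖F (c + t * Complex.I)‖ * (1 + |t|) ^ 2 ≤ C) : LineIntegrable c F := by
  refine (integrable_inv_one_add_sq.const_mul C).mono' hF.aestronglyMeasurable
    (Eventually.of_forall fun t => ?_)
  have h1 : 0 < 1 + t ^ 2 := by positivity
  rw [← div_eq_mul_inv, le_div_iff₀ h1]
  refine le_trans ?_ (hC t)
  gcongr
  nlinarith [sq_abs t, abs_nonneg t]

lemma re_add_mul_I (c t : ℝ) : ((c : ℂ) + t * Complex.I).re = c := by simp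

lemma im_add_mul_I (c t : ℝ) : ((c : ℂ) + t * Complex.I).im = t := by simp

/-- Cauchy's theorem: the line of integration may be moved inside a strip of holomorphy in which
the integrand decays quadratically. -/
lemma lineIntegral_eq_of_le {a b C : ℝ} {F : ℂ → ℂ} (hab : a ≤ b)
    (hd : ∀ s : ℂ, a ≤ s.re → s.re ≤ b → DifferentiableAt ℂ F s)
    (hC : ∀ s : ℂ, a ≤ s.re → s.re ≤ b → ‖F s‖ * (1 + |s.im|) ^ 2 ≤ C) :
    lineIntegral a F = lineIntegral b F := by
  have hint : ∀ c : ℝ, a ≤ c → c ≤ b → LineIntegrable c F := by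
    intro c hac hcb
    refine lineIntegrable_of_norm_le (C := C) (continuous_iff_continuousAt.2 fun t => ?_)
      fun t => ?_
    · refine ContinuousAt.comp (f := fun t : ℝ => (c : ℂ) + t * Complex.I)
        (hd _ (by simpa using hac) (by simpa using hcb)).continuousAt ?_
      fun_prop
    · have := hC (c + t * Complex.I) (by simpa using hac) (by simpa using hcb)
      rwa [im_add_mul_I] at this
  have hrect : ∀ T : ℝ,
      (∫ x : ℝ in a..b, F (x + (-T : ℝ) * Complex.I)) - (∫ x : ℝ in a..b, F (x + T * Complex.I)) +
      Complex.I • (∫ y : ℝ in (-T)..T, F (b + y * Complex.I)) -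
      Complex.I • (∫ y : ℝ in (-T)..T, F (a + y * Complex.I)) = 0 := by
    intro T
    have := Complex.integral_boundary_rect_eq_zero_of_differentiableOn F
      (a + (-T : ℝ) * Complex.I) (b + T * Complex.I) (fun s hs => ?_)
    · simpa only [re_add_mul_I, im_add_mul_I] using this
    · rw [Complex.mem_reProdIm, re_add_mul_I, re_add_mul_I, uIcc_of_le hab] at hs
      exact (hd s hs.1.1 hs.1.2).differentiableWithinAt
  have hhor : ∀ ε : ℝ, |ε| = 1 → Tendsto (fun T : ℝ => ∫ x : ℝ in a..b,
      F (x + (ε * T : ℝ) * Complex.I)) atTop (𝓝 0) := by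
    intro ε hε
    have hz : Tendsto (fun T : ℝ => C * (T ^ 2)⁻¹ * |b - a|) atTop (𝓝 0) := by
      have := ((tendsto_inv_atTop_zero.comp (tendsto_pow_atTop (α := ℝ) two_ne_zero)).const_mul
        C).mul_const |b - a|
      simpa using this
    refine squeeze_zero_norm' ?_ hz
    filter_upwards [eventually_gt_atTop 0] with T hT
    refine intervalIntegral.norm_integral_le_of_norm_le_const fun x hx => ?_
    rw [uIoc_of_le hab] at hx
    have h1 := hC (x + (ε * T : ℝ) * Complex.I) (by rw [re_add_mul_I]; exact hx.1.le)
      (by rw [re_add_mul_I]; exact hx.2)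
    rw [im_add_mul_I, abs_mul, hε, one_mul, abs_of_pos hT] at h1
    rw [← div_eq_mul_inv, le_div_iff₀ (by positivity)]
    refine le_trans ?_ h1
    gcongr
    linarith
  have hver : ∀ c : ℝ, a ≤ c → c ≤ b → Tendsto (fun T : ℝ => Complex.I •
      ∫ y : ℝ in (-T)..T, F (c + y * Complex.I)) atTop
      (𝓝 (Complex.I • ∫ y : ℝ, F (c + y * Complex.I))) := fun c hac hcb =>
    (intervalIntegral_tendsto_integral (hint c hac hcb) tendsto_neg_atTop_atBot
      tendsto_id).const_smul _
  have hlim := (((hhor (-1) (by simp)).sub (hhor 1 (by simp))).add (hver b hab le_rfl)).sub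
    (hver a le_rfl hab)
  simp only [neg_mul, one_mul] at hlim
  simp_rw [hrect] at hlim
  have h2 := tendsto_nhds_unique tendsto_const_nhds hlim
  rw [sub_self, zero_add, eq_comm, sub_eq_zero, smul_eq_mul, smul_eq_mul] at h2
  rw [lineIntegral, lineIntegral, integral_mul_const, integral_mul_const]
  linear_combination (-(1 / (2 * Real.pi * Complex.I))) * h2

/-! ### The integrands of the Weil terms -/

/-- The integrand of the Weil term decays quadratically on vertical strips to the right of `0`. -/
lemma exists_weilIntegrand_bound (v : Place) (g : 𝓓(halfLine, ℂ)) {A : ℝ} (hA : 0 < A) (B : ℝ) :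
    ∃ C : ℝ, ∀ s : ℂ, A ≤ s.re → s.re ≤ B → ‖weilIntegrand v g s‖ * (1 + |s.im|) ^ 2 ≤ C := by
  obtain ⟨a, b, hg⟩ := exists_isTestOn g
  obtain ⟨C, hC0, hC⟩ := exists_norm_logDeriv_eulerFactor_le v hA B
  obtain ⟨C₁, h₁0, h₁⟩ := hg.exists_pow_mul_norm_mellin_le A B 3
  obtain ⟨C₂, h₂0, h₂⟩ := hg.exists_pow_mul_norm_mellin_le (1 - B) (1 - A) 3
  refine ⟨C * (C₁ + C₂), fun s hs hs' => ?_⟩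
  have e1 := h₁ s hs hs'
  have e2 := h₂ (1 - s) (by simp; linarith) (by simp; linarith)
  rw [show (1 - s).im = -s.im by simp, abs_neg] at e2
  rw [weilIntegrand, norm_mul, norm_neg]
  calc ‖logDeriv (eulerFactor v) s‖ * ‖mellin g s + mellin g (1 - s)‖ * (1 + |s.im|) ^ 2
      ≤ (C * (1 + |s.im|)) * (‖mellin g s‖ + ‖mellin g (1 - s)‖) * (1 + |s.im|) ^ 2 := by
        gcongr
        · exact hC s hs hs'
        · exact norm_add_le _ _
    _ = C * ((1 + |s.im|) ^ 3 * ‖mellin g s‖ + (1 + |s.im|) ^ 3 * ‖mellin g (1 - s)‖) := by ring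
    _ ≤ _ := by gcongr

lemma differentiableAt_weilIntegrand (v : Place) (g : 𝓓(halfLine, ℂ)) {s : ℂ} (hs : 0 < s.re) :
    DifferentiableAt ℂ (weilIntegrand v g) s := by
  obtain ⟨a, b, hg⟩ := exists_isTestOn g
  have hd := hg.differentiable_mellin
  exact (differentiableAt_logDeriv_eulerFactor v hs).neg.mul
    ((hd s).add ((hd (1 - s)).comp s (differentiableAt_id.const_sub 1)))

lemma lineIntegrable_weilIntegrand (v : Place) (g : 𝓓(halfLine, ℂ)) {c : ℝ} (hc : 0 < c) :
    LineIntegrable c (weilIntegrand v g) := by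
  obtain ⟨C, hC⟩ := exists_weilIntegrand_bound v g hc c
  refine lineIntegrable_of_norm_le (C := C) (continuous_iff_continuousAt.2 fun t => ?_) fun t => ?_
  · refine ContinuousAt.comp (f := fun t : ℝ => (c : ℂ) + t * Complex.I)
      (differentiableAt_weilIntegrand v g (by simpa using hc)).continuousAt ?_
    fun_prop
  · have := hC (c + t * Complex.I) (by simp) (by simp)
    rwa [im_add_mul_I] at this

/-- The Weil term does not depend on the line of integration. -/
lemma weilTerm_eq (v : Place) (g : 𝓓(halfLine, ℂ)) {c c' : ℝ} (hc : 0 < c) (hc' : 0 < c') :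
    weilTerm v c g = weilTerm v c' g := by
  wlog h : c ≤ c' generalizing c c'
  · exact (this hc' hc (le_of_not_ge h)).symm
  obtain ⟨C, hC⟩ := exists_weilIntegrand_bound v g hc c'
  exact lineIntegral_eq_of_le h
    (fun s hs _ => differentiableAt_weilIntegrand v g (hc.trans_le hs)) hC

lemma lineIntegrable_weilIntegrandAt (v : Place) (g : 𝓓(halfLine, ℂ)) {c : ℝ} (hc0 : 0 < c)
    (hc1 : c < 1) {y : Completion v} (hy : y ≠ 0) : LineIntegrable c (weilIntegrandAt v g y) := by
  obtain ⟨a, b, hg⟩ := exists_isTestOn g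
  obtain ⟨C, hC0, hC⟩ := exists_norm_logDeriv_eulerFactor_le v hc0 c
  obtain ⟨C', hC'0, hC'⟩ := exists_norm_logDeriv_eulerFactor_le v (sub_pos.2 hc1) (1 - c)
  obtain ⟨C₁, h₁0, h₁⟩ := hg.exists_pow_mul_norm_mellin_le c c 3
  have hy' : (‖y‖ : ℂ) ≠ 0 := by simpa using hy
  refine lineIntegrable_of_norm_le (C := (C + C') * C₁ * ‖y‖ ^ (-c))
    (continuous_iff_continuousAt.2 fun t => ?_) fun t => ?_
  · refine ContinuousAt.comp (f := fun t : ℝ => (c : ℂ) + t * Complex.I) (g := weilIntegrandAt v g y)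
      (DifferentiableAt.continuousAt (𝕜 := ℂ) ?_) (by fun_prop)
    set s : ℂ := c + t * Complex.I with hs
    have hs0 : 0 < s.re := by rw [hs, re_add_mul_I]; exact hc0
    have hs1 : s.re < 1 := by rw [hs, re_add_mul_I]; exact hc1
    have hU : {z : ℂ | 0 < z.re ∧ z.re < 1} ∈ 𝓝 s :=
      ((isOpen_lt continuous_const Complex.continuous_re).inter
        (isOpen_lt Complex.continuous_re continuous_const)).mem_nhds ⟨hs0, hs1⟩
    have h2 : DifferentiableAt ℂ (fun z => logDeriv (eulerFactor v) z +
        logDeriv (eulerFactor v) (1 - z)) s :=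
      (differentiableAt_logDeriv_eulerFactor v hs0).add
        ((differentiableAt_logDeriv_eulerFactor v (s := 1 - s) (by simpa using hs1)).comp s
          (differentiableAt_id.const_sub 1))
    have h3 : DifferentiableAt ℂ (logDeriv (tateGamma v)) s := by
      refine h2.congr_of_eventuallyEq ?_
      filter_upwards [hU] with z hz
      exact logDeriv_tateGamma v hz.1 hz.2
    exact (h3.neg.mul (hg.differentiable_mellin s)).mul
      (differentiableAt_id.neg.const_cpow (Or.inl hy'))
  · set s : ℂ := c + t * Complex.I with hs
    have hre : s.re = c := re_add_mul_I c t
    have him : s.im = t := im_add_mul_I c t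
    have e1 := h₁ s hre.ge hre.le
    have e2 := hC s hre.ge hre.le
    have e3 := hC' (1 - s) (by simp [hre]) (by simp [hre])
    rw [show (1 - s).im = -t by simp [him], abs_neg] at e3
    rw [him] at e1 e2
    have e4 : ‖logDeriv (tateGamma v) s‖ ≤ (C + C') * (1 + |t|) := by
      rw [logDeriv_tateGamma v (by rwa [hre]) (by rwa [hre]), add_mul]
      exact (norm_add_le _ _).trans (add_le_add e2 e3)
    rw [weilIntegrandAt, norm_mul, norm_mul, norm_neg, norm_norm_cpow hy, Complex.neg_re, hre]
    calc ‖logDeriv (tateGamma v) s‖ * ‖mellin g s‖ * ‖y‖ ^ (-c) * (1 + |t|) ^ 2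
        ≤ ((C + C') * (1 + |t|)) * ‖mellin g s‖ * ‖y‖ ^ (-c) * (1 + |t|) ^ 2 := by gcongr
      _ = (C + C') * ((1 + |t|) ^ 3 * ‖mellin g s‖) * ‖y‖ ^ (-c) := by ring
      _ ≤ _ := by gcongr

/-- On the line `Re s = 1 / 2`, the symmetry `s ↦ 1 - s` turns the two Mellin transforms into the
two factors of the gamma function. -/
lemma weilTerm_half_eq (v : Place) (g : 𝓓(halfLine, ℂ)) :
    weilTerm v (1 / 2) g = weilTermAt v (1 / 2) g 1 := by
  obtain ⟨a, b, hg⟩ := exists_isTestOn g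
  set ℓ := logDeriv (eulerFactor v) with hℓ
  set z : ℝ → ℂ := fun t => ((1 / 2 : ℝ) : ℂ) + t * Complex.I with hz
  have hre : ∀ t, (z t).re = 1 / 2 := fun t => re_add_mul_I _ t
  have him : ∀ t, (z t).im = t := fun t => im_add_mul_I _ t
  have hz1 : ∀ t, 1 - z t = z (-t) := by
    intro t
    simp only [hz]
    push_cast
    ring
  obtain ⟨C, hC0, hC⟩ := exists_norm_logDeriv_eulerFactor_le v (A := 1 / 2) (by norm_num) (1 / 2)
  obtain ⟨C₁, h₁0, h₁⟩ := hg.exists_pow_mul_norm_mellin_le (1 / 2) (1 / 2) 3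
  have hcz : Continuous z := by simp only [hz]; fun_prop
  have hcℓ : Continuous fun t => ℓ (z t) := continuous_iff_continuousAt.2 fun t =>
    ContinuousAt.comp (f := z) (differentiableAt_logDeriv_eulerFactor v
      (by rw [hre]; norm_num)).continuousAt hcz.continuousAt
  have hcg : Continuous fun t => mellin g (z t) := hg.differentiable_mellin.continuous.comp hcz
  have hint : ∀ ε : ℝ, |ε| = 1 → Integrable fun t : ℝ => ℓ (z t) * mellin g (z (ε * t)) := by
    intro ε hε
    refine (integrable_inv_one_add_sq.const_mul (C * C₁)).mono' (Continuous.aestronglyMeasurable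
      (hcℓ.mul (hcg.comp (continuous_const.mul continuous_id)))) (Eventually.of_forall fun t => ?_)
    have e1 := hC (z t) (hre t).ge (hre t).le
    have e2 := h₁ (z (ε * t)) (hre _).ge (hre _).le
    rw [him, abs_mul, hε, one_mul] at e2
    rw [him] at e1
    rw [← div_eq_mul_inv, le_div_iff₀ (by positivity), norm_mul]
    calc ‖ℓ (z t)‖ * ‖mellin g (z (ε * t))‖ * (1 + t ^ 2)
        ≤ (C * (1 + |t|)) * ‖mellin g (z (ε * t))‖ * (1 + |t|) ^ 2 := by
          gcongr
          nlinarith [sq_abs t, abs_nonneg t]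
      _ = C * ((1 + |t|) ^ 3 * ‖mellin g (z (ε * t))‖) := by ring
      _ ≤ _ := by gcongr
  have hi1 : Integrable fun t : ℝ => ℓ (z t) * mellin g (z t) := by simpa using hint 1 (by simp)
  have hi2 : Integrable fun t : ℝ => ℓ (z t) * mellin g (z (-t)) := by
    simpa using hint (-1) (by simp)
  have hi3 : Integrable fun t : ℝ => ℓ (z (-t)) * mellin g (z t) := by
    simpa using hi2.comp_neg
  have hA : ∫ t, weilIntegrand v g (z t) =
      -((∫ t, ℓ (z t) * mellin g (z t)) + ∫ t, ℓ (z t) * mellin g (z (-t))) := by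
    rw [← integral_add hi1 hi2, ← integral_neg]
    congr 1 with t
    rw [weilIntegrand, hz1]
    ring
  have hB : ∫ t, weilIntegrandAt v g 1 (z t) =
      -((∫ t, ℓ (z t) * mellin g (z t)) + ∫ t, ℓ (z (-t)) * mellin g (z t)) := by
    rw [← integral_add hi1 hi3, ← integral_neg]
    congr 1 with t
    rw [weilIntegrandAt, logDeriv_tateGamma v (by rw [hre]; norm_num) (by rw [hre]; norm_num), hz1,
      norm_one, Complex.ofReal_one, Complex.one_cpow]
    ring
  have hC' : ∫ t, ℓ (z (-t)) * mellin g (z t) = ∫ t, ℓ (z t) * mellin g (z (-t)) := by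
    rw [← integral_neg_eq_self]
    simp
  rw [weilTerm, weilTermAt, lineIntegral, lineIntegral, integral_mul_const, integral_mul_const]
  change _ * ((∫ t, weilIntegrand v g (z t)) * _) = _ * ((∫ t, weilIntegrandAt v g 1 (z t)) * _)
  rw [hA, hB, hC']

/-! ### The Fourier transform of `-log |x|` away from the origin -/

/-- The Fourier transform of a radial function is radial. -/
lemma localFourier_eq_of_norm_eq {f : Completion v → ℂ} (hf : ∀ x y, ‖x‖ = ‖y‖ → f x = f y)
    {x y : Completion v} (h : ‖x‖ = ‖y‖) : localFourier v f x = localFourier v f y := by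
  rcases eq_or_ne y 0 with rfl | hy
  · rw [norm_zero, norm_eq_zero] at h
    rw [h]
  have hx : x ≠ 0 := by rwa [← norm_pos_iff, h, norm_pos_iff]
  have hn : ‖y / x‖ = 1 := by rw [norm_div, h, div_self (norm_ne_zero_iff.2 hy)]
  have h1 := localFourier_comp_mul_left (div_ne_zero hy hx) f y
  rw [hn, inv_one, Complex.ofReal_one, one_mul, inv_div, div_mul_cancel₀ _ hy] at h1
  rw [← h1]
  congr 1 with z
  exact hf _ _ (by rw [norm_mul, hn, one_mul])

/-- The transform exchanges translations and modulations. -/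
lemma localFourier_reflectAt (φ : SchwartzBruhat v) (y t : Completion v) :
    localFourier v (reflectAt φ y) t = (basicChar v (-(y * t)) : ℂ) * localFourier v φ (-t) := by
  rw [localFourier_apply, localFourier_apply, ← integral_const_mul,
    ← integral_sub_left_eq_self _ _ y]
  congr 1 with x
  rw [reflectAt_apply, sub_sub_cancel, ← mul_assoc, ← Circle.coe_mul, ← AddChar.map_add_eq_mul]
  congr 3
  ring_nf

/-- The convolution of the Fourier transform of `-log |x|` with a radial test function `φ` is the
Fourier transform of the function `-log |x| φ̂ (x)`. -/
lemma IsFourierOfNegLog.addConv_eq {G : LocalDistribution v} (hG : IsFourierOfNegLog v G)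
    {φ : SchwartzBruhat v} (hφ : ∀ x y, ‖x‖ = ‖y‖ → φ x = φ y) (y : Completion v) :
    addConv G φ y = localFourier v (fun t => localFourier v φ t * -(Real.log ‖t‖ : ℂ)) y := by
  rw [addConv, hG.eq_integral, localFourier_apply]
  congr 1 with t
  rw [localFourier_reflectAt, localFourier_eq_of_norm_eq hφ (norm_neg t), mul_comm t y]
  ring

/-- The zeta integral of a test function vanishing near the origin converges for every `s`. -/
lemma SchwartzBruhat.integrable_mul_norm_cpow_of_eq_zero (φ : SchwartzBruhat v) {r : ℝ}
    (hr : 0 < r) (hφ : ∀ x, ‖x‖ < r → φ x = 0) (s : ℂ) :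
    Integrable (fun x => φ x * (‖x‖ : ℂ) ^ (s - 1)) (haar v) := by
  have h := (φ.rapidDecay.integrable_mul (temperateWeight_norm_cpow (v := v)
    (s := ((|s.re| + 1 : ℝ) : ℂ)) (by rw [Complex.ofReal_re]; positivity))).norm.const_mul
    (r ^ (s.re - (|s.re| + 1)))
  refine h.mono' (φ.rapidDecay.1.aestronglyMeasurable.mul
    (measurable_norm_cpow _).aestronglyMeasurable) ?_
  filter_upwards [ae_ne_zero] with x hx
  have hx' := norm_pos_iff.2 hx
  rcases lt_or_ge ‖x‖ r with h1 | h1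
  · rw [hφ x h1, zero_mul, norm_zero]
    positivity
  · rw [norm_mul, norm_mul, norm_norm_cpow hx, norm_norm_cpow hx, Complex.sub_re, Complex.sub_re,
      Complex.ofReal_re, Complex.one_re, mul_left_comm]
    gcongr
    rw [show s.re - 1 = (s.re - (|s.re| + 1)) + (|s.re| + 1 - 1) by ring, Real.rpow_add hx']
    gcongr ?_ * _
    exact Real.rpow_le_rpow_of_nonpos hr h1 (by linarith [le_abs_self s.re])

/-- Away from the origin, the Fourier transform of `-log |x|` is a multiple of `1 / |x|`: at `s = 0`
the factor `1 / Γ_ν (s)` vanishes while the zeta integral stays holomorphic. -/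
lemma IsFourierOfNegLog.mul_invEuler_one {G : LocalDistribution v} (hG : IsFourierOfNegLog v G)
    (φ : SchwartzBruhat v) {r : ℝ} (hr : 0 < r) (hφ : ∀ x, ‖x‖ < r → φ x = 0) :
    G φ * invEuler v 1 = deriv (invEuler v) 0 * zetaIntegral φ 0 := by
  have hM := differentiable_invEuler v
  have hM1 : Differentiable ℂ fun z => invEuler v (1 - z) :=
    hM.comp (differentiable_id.const_sub 1)
  have hZ : Differentiable ℂ (zetaIntegral φ) := fun s =>
    (hasDerivAt_zetaIntegral (sub_one_lt s.re) (lt_add_one s.re) φ.rapidDecay.1.aestronglyMeasurable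
      fun σ _ _ => φ.integrable_mul_norm_cpow_of_eq_zero hr hφ σ).differentiableAt
  have hMZ : Differentiable ℂ fun z => invEuler v z * zetaIntegral φ z := hM.mul hZ
  have hH := hG.hasDerivAt φ
  have h0 := hH.mul (hM1 0).hasDerivAt
  have h1 := (hM 0).hasDerivAt.mul (hZ 0).hasDerivAt
  have heq : (fun z => zetaIntegral (localFourier v φ) (1 - z) * invEuler v (1 - z)) =ᶠ[𝓝 0]
      fun z => invEuler v z * zetaIntegral φ z := by
    refine (h0.continuousAt.eventuallyEq_nhds_iff_eventuallyEq_nhdsNE h1.continuousAt).1 ?_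
    refine eventually_eq_of_eq_on_strip
      (fun s hs => ((analyticAt_riesz φ hs).mul (hM1.analyticAt s)).meromorphicAt)
      (fun s _ => (hMZ.analyticAt s).meromorphicAt) (fun s hs0 hs1 => ?_) (by simp)
    rw [mul_comm (invEuler v s), zetaIntegral_mul_invEuler hs0 hs1 φ.rapidDecay.integrable
      (φ.rapidDecay.integrable_mul (temperateWeight_norm_cpow hs0))
      (φ.rapidDecay_localFourier.integrable_mul (temperateWeight_norm_cpow (by simpa using hs1)))]
    exact mul_comm _ _
  have h2 := heq.self_of_nhds
  have h3 := (h0.congr_of_eventuallyEq heq.symm).unique h1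
  simp only [sub_zero, invEuler_zero, zero_mul, mul_eq_zero] at h2 h3
  have h4 := h2.resolve_right (invEuler_ne_zero v (by simp))
  rw [h4, zero_mul, add_zero, add_zero] at h3
  exact h3

lemma liftTo_eq_of_norm_eq (v : Place) (g : 𝓓(halfLine, ℂ)) {x y : Completion v} (h : ‖x‖ = ‖y‖) :
    liftTo v g x = liftTo v g y := by
  rw [liftTo_apply, liftTo_apply, h]

/-- The convolution `G_ν * φ` with a radial test function is radial. -/
lemma IsFourierOfNegLog.addConv_eq_of_norm_eq {G : LocalDistribution v}
    (hG : IsFourierOfNegLog v G) {φ : SchwartzBruhat v} (hφ : ∀ x y, ‖x‖ = ‖y‖ → φ x = φ y)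
    {x y : Completion v} (h : ‖x‖ = ‖y‖) : addConv G φ x = addConv G φ y := by
  rw [hG.addConv_eq hφ, hG.addConv_eq hφ]
  refine localFourier_eq_of_norm_eq (fun x y hxy => ?_) h
  rw [localFourier_eq_of_norm_eq hφ hxy, hxy]

lemma IsFourierOfNegLog.continuous_addConv {G : LocalDistribution v}
    (hG : IsFourierOfNegLog v G) {φ : SchwartzBruhat v} (hφ : ∀ x y, ‖x‖ = ‖y‖ → φ x = φ y) :
    Continuous (addConv G φ) := by
  rw [funext (hG.addConv_eq hφ)]
  exact continuous_localFourier (φ.rapidDecay_localFourier.integrable_mul temperateWeight_log)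

/-- The convolution `G_ν * g_ν` decays like `1 / |y|`. -/
lemma IsFourierOfNegLog.exists_norm_addConv_le {G : LocalDistribution v}
    (hG : IsFourierOfNegLog v G) (g : 𝓓(halfLine, ℂ)) :
    ∃ C : ℝ, ∀ y, (1 + ‖y‖) * ‖addConv G (liftTo v g) y‖ ≤ C := by
  obtain ⟨a, b, hg⟩ := exists_isTestOn g
  have hb : 0 < b := hg.pos.trans hg.lt
  have hcont := hG.continuous_addConv fun x y => liftTo_eq_of_norm_eq v g (x := x) (y := y)
  obtain ⟨C₁, hC₁⟩ := (isCompact_closedBall (0 : Completion v) (2 * b)).exists_bound_of_continuousOn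
    (f := fun y => ((1 + ‖y‖ : ℝ) : ℂ) * addConv G (liftTo v g) y) (by fun_prop)
  set κ := ‖deriv (invEuler v) 0‖ / ‖invEuler v 1‖ with hκ
  set I := ∫ x, ‖liftTo v g x‖ ∂haar v with hI
  have hI0 : 0 ≤ I := by positivity
  refine ⟨max C₁ ((2 + b⁻¹) * (κ * I)), fun y => ?_⟩
  rcases le_or_gt ‖y‖ (2 * b) with hy | hy
  · refine le_max_of_le_left ?_
    have := hC₁ y (by simpa using hy)
    rwa [norm_mul, Complex.norm_real, Real.norm_of_nonneg (by positivity)] at this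
  refine le_max_of_le_right ?_
  have hy0 : 0 < ‖y‖ := by linarith
  have hM : invEuler v 1 ≠ 0 := invEuler_ne_zero v (by simp)
  have hvan : ∀ x, ‖x‖ < ‖y‖ / 2 → reflectAt (liftTo v g) y x = 0 := by
    intro x hx
    rw [reflectAt_apply, liftTo_apply]
    refine hg.eq_zero fun h => ?_
    have := norm_sub_norm_le y x
    linarith [h.2]
  have h1 := hG.mul_invEuler_one _ (half_pos hy0) hvan
  have h2 : ‖zetaIntegral (reflectAt (liftTo v g) y) 0‖ ≤ 2 / ‖y‖ * I := by
    rw [hI, ← integral_sub_left_eq_self _ _ y, ← integral_const_mul]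
    refine norm_integral_le_of_norm_le ?_ ?_
    · have := (reflectAt (liftTo v g) y).rapidDecay.integrable.norm.const_mul (2 / ‖y‖)
      simpa only [reflectAt_apply] using this
    · filter_upwards [ae_ne_zero] with x hx
      rcases lt_or_ge ‖x‖ (‖y‖ / 2) with h | h
      · rw [hvan x h, zero_mul, norm_zero]
        positivity
      · rw [norm_mul, reflectAt_apply, norm_norm_cpow hx, mul_comm]
        gcongr
        rw [zero_sub, Complex.neg_re, Complex.one_re, Real.rpow_neg_one, ← inv_div]
        gcongr
  have h3 : ‖addConv G (liftTo v g) y‖ ≤ κ * (2 / ‖y‖ * I) := by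
    rw [hκ, div_mul_eq_mul_div, le_div_iff₀ (norm_pos_iff.2 hM), addConv, ← norm_mul, h1, norm_mul]
    gcongr
  calc (1 + ‖y‖) * ‖addConv G (liftTo v g) y‖ ≤ (1 + ‖y‖) * (κ * (2 / ‖y‖ * I)) := by gcongr
    _ = (2 + 2 / ‖y‖) * (κ * I) := by
      field_simp
      ring
    _ ≤ (2 + b⁻¹) * (κ * I) := by
      gcongr
      rw [div_le_iff₀ hy0, ← div_eq_inv_mul, le_div_iff₀ hb]
      exact hy.le

lemma IsFourierOfNegLog.integrable_addConv {G : LocalDistribution v}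
    (hG : IsFourierOfNegLog v G) (g : 𝓓(halfLine, ℂ)) {s : ℂ} (hs0 : 0 < s.re) (hs1 : s.re < 1) :
    Integrable (fun y => addConv G (liftTo v g) y * (‖y‖ : ℂ) ^ (s - 1)) (haar v) := by
  obtain ⟨C, hC⟩ := hG.exists_norm_addConv_le g
  have h := integrable_inv_pow_mul_norm_cpow (v := v) hs0 (N := 1) (by simpa using hs1)
  refine (h.norm.const_mul C).mono' (Continuous.aestronglyMeasurable ?_ |>.mul
    (measurable_norm_cpow _).aestronglyMeasurable) (Eventually.of_forall fun y => ?_)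
  · exact hG.continuous_addConv fun x y => liftTo_eq_of_norm_eq v g (x := x) (y := y)
  · exact RapidDecay.norm_mul_le (w := fun x => (‖x‖ : ℂ) ^ (s - 1)) (N := 1) (fun x => by simpa using hC x) y

lemma differentiableAt_tateGamma (v : Place) {s : ℂ} (hs0 : 0 < s.re) :
    DifferentiableAt ℂ (tateGamma v) s := by
  have h : tateGamma v = fun z => invEuler v (1 - z) / invEuler v z := funext (tateGamma_eq_div v)
  rw [h]
  exact (((differentiable_invEuler v).comp (differentiable_id.const_sub 1)) s).div
    (differentiable_invEuler v s) (invEuler_ne_zero v hs0)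

/-- The zeta integral of `G_ν * φ - log |x| φ`. Differentiating `Z (φ, s) = Γ_ν (s) R_s (φ)` in `s`
produces the zeta integral of `log |x| φ` on the left, and on the right the term `Γ_ν (s) R_s' (φ)`,
which is the zeta integral of `G_ν * φ` by the functional equation of `-log |x| φ̂`. -/
theorem IsFourierOfNegLog.zetaIntegral_addConv {G : LocalDistribution v}
    (hG : IsFourierOfNegLog v G) (g : 𝓓(halfLine, ℂ)) {s : ℂ} (hs0 : 0 < s.re) (hs1 : s.re < 1) :
    Integrable (fun x => (-(Real.log ‖x‖ : ℂ) * liftTo v g x + addConv G (liftTo v g) x) *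
      (‖x‖ : ℂ) ^ (s - 1)) (haar v) ∧
    zetaIntegral (fun x => -(Real.log ‖x‖ : ℂ) * liftTo v g x + addConv G (liftTo v g) x) s =
      -logDeriv (tateGamma v) s * zetaIntegral (liftTo v g) s := by
  set φ := liftTo v g with hφ
  set A := addConv G φ with hA
  set B : Completion v → ℂ := fun t => localFourier v φ t * -(Real.log ‖t‖ : ℂ) with hB
  have hAB : A = localFourier v B :=
    funext (hG.addConv_eq fun x y => liftTo_eq_of_norm_eq v g (x := x) (y := y))
  have hs1' : 0 < (1 - s).re := by simpa using hs1
  have hAi := hG.integrable_addConv g hs0 hs1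
  have hφi : Integrable (fun x => φ x * (-(Real.log ‖x‖ : ℂ) * (‖x‖ : ℂ) ^ (s - 1))) (haar v) :=
    φ.rapidDecay.integrable_mul (temperateWeight_log_mul_norm_cpow hs0)
  have hBi : Integrable (fun x => B x * (‖x‖ : ℂ) ^ (1 - s - 1)) (haar v) := by
    simp only [hB, mul_assoc]
    exact φ.rapidDecay_localFourier.integrable_mul (temperateWeight_log_mul_norm_cpow hs1')
  -- the functional equation for `B`
  have h1 := zetaIntegral_mul_invEuler hs1' (by simpa using hs0)
    (φ.rapidDecay_localFourier.integrable_mul temperateWeight_log) hBi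
    (by simpa only [sub_sub_cancel, ← hB, ← hAB] using hAi)
  rw [sub_sub_cancel, ← hB, ← hAB] at h1
  -- the derivative of the functional equation for `φ`
  have h2 := φ.rapidDecay.hasDerivAt_zetaIntegral hs0
  have h3 := (differentiableAt_tateGamma v hs0).hasDerivAt.mul (hasDerivAt_riesz φ hs1)
  have heq : zetaIntegral φ =ᶠ[𝓝 s]
      fun z => tateGamma v z * zetaIntegral (localFourier v φ) (1 - z) := by
    filter_upwards [((isOpen_lt continuous_const Complex.continuous_re).inter
      (isOpen_lt Complex.continuous_re continuous_const)).mem_nhds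
      (show s ∈ {z : ℂ | 0 < z.re} ∩ {z : ℂ | z.re < 1} from ⟨hs0, hs1⟩)] with z hz
    exact zetaIntegral_schwartzBruhat φ hz.1 hz.2
  have h4 := h2.unique (h3.congr_of_eventuallyEq heq)
  have h5 : ∫ x, localFourier v φ x * (-(Real.log ‖x‖ : ℂ) * (‖x‖ : ℂ) ^ (-s)) ∂haar v =
      zetaIntegral B (1 - s) := by
    rw [zetaIntegral]
    congr 1 with x
    rw [hB, show 1 - s - 1 = -s by ring]
    ring
  have h6 : ∫ x, φ x * (-(Real.log ‖x‖ : ℂ) * (‖x‖ : ℂ) ^ (s - 1)) ∂haar v =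
      -∫ x, φ x * ((Real.log ‖x‖ : ℂ) * (‖x‖ : ℂ) ^ (s - 1)) ∂haar v := by
    rw [← integral_neg]
    congr 1 with x
    ring
  have h7 : tateGamma v s ≠ 0 := by
    rw [tateGamma_eq_div]
    exact div_ne_zero (invEuler_ne_zero v hs1') (invEuler_ne_zero v hs0)
  have e : ∀ x : Completion v, (-(Real.log ‖x‖ : ℂ) * φ x + A x) * (‖x‖ : ℂ) ^ (s - 1) =
      φ x * (-(Real.log ‖x‖ : ℂ) * (‖x‖ : ℂ) ^ (s - 1)) + A x * (‖x‖ : ℂ) ^ (s - 1) := fun x => by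
    ring
  refine ⟨(hφi.add hAi).congr (Eventually.of_forall fun x => (e x).symm), ?_⟩
  have h8 : tateGamma v s * zetaIntegral B (1 - s) = zetaIntegral A s := by
    rw [tateGamma_eq_div, div_mul_eq_mul_div, mul_comm (invEuler v (1 - s)), h1,
      mul_div_cancel_left₀ _ (invEuler_ne_zero v hs0)]
  have h9 : zetaIntegral (fun x => -(Real.log ‖x‖ : ℂ) * φ x + A x) s =
      (∫ x, φ x * (-(Real.log ‖x‖ : ℂ) * (‖x‖ : ℂ) ^ (s - 1)) ∂haar v) + zetaIntegral A s := by
    rw [zetaIntegral, zetaIntegral, ← integral_add hφi hAi]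
    exact congrArg _ (funext e)
  rw [h9, h6, h4, h5, h8, heq.self_of_nhds, logDeriv_apply]
  field_simp
  ring

/-! ### The real place -/

/-- At the real place the zeta integral of an even function is twice its Mellin transform. -/
lemma zetaIntegral_real {f : Completion .real → ℂ} (hf : ∀ x y, ‖x‖ = ‖y‖ → f x = f y) {s : ℂ}
    (hi : Integrable (fun x => f x * (‖x‖ : ℂ) ^ (s - 1)) (haar .real)) :
    MellinConvergent (fun u : ℝ => f u) s ∧
      zetaIntegral f s = 2 * mellin (fun u : ℝ => f u) s := by
  let F : ℝ → ℂ := fun u => f u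
  have h1 : ∀ u ∈ Ioi (0 : ℝ), F u * ((|u| : ℝ) : ℂ) ^ (s - 1) = (u : ℂ) ^ (s - 1) • F u := fun u hu => by
    rw [abs_of_pos (mem_Ioi.1 hu), mul_comm, smul_eq_mul]
  have hi' : Integrable (fun u : ℝ => F u * ((|u| : ℝ) : ℂ) ^ (s - 1)) := hi
  have hm : MellinConvergent F s := by
    refine IntegrableOn.congr_fun hi'.integrableOn (fun u hu => ?_) measurableSet_Ioi
    exact h1 u hu
  refine ⟨hm, ?_⟩
  have h2 := integral_comp_abs_complex (fun u : ℝ => (u : ℂ) ^ (s - 1) • F u) hm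
  change _ = 2 * ∫ u in Ioi (0 : ℝ), (u : ℂ) ^ (s - 1) • F u
  rw [← h2]
  change ∫ u : ℝ, F u * ((|u| : ℝ) : ℂ) ^ (s - 1) = _
  congr 1 with u
  have h3 : F |u| = F u := hf _ _ (abs_abs u)
  rw [h3, mul_comm, smul_eq_mul]

/-- Mellin inversion on the half-line, applied to `G_ν * g_ν - log |x| g_ν`. -/
theorem weilTermAt_real {G : LocalDistribution .real} (hG : IsFourierOfNegLog .real G)
    (g : 𝓓(halfLine, ℂ)) {c : ℝ} (hc0 : 0 < c) (hc1 : c < 1) {y : Completion .real} (hy : y ≠ 0) :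
    weilTermAt .real c g y =
      -(Real.log ‖y‖ : ℂ) * liftTo .real g y + addConv G (liftTo .real g) y := by
  set φ := liftTo .real g with hφ
  have hφr : ∀ x y, ‖x‖ = ‖y‖ → φ x = φ y := fun x y => liftTo_eq_of_norm_eq .real g
  set f : Completion .real → ℂ := fun x => -(Real.log ‖x‖ : ℂ) * φ x + addConv G φ x with hf
  have hfr : ∀ x y, ‖x‖ = ‖y‖ → f x = f y := fun x y h => by
    simp only [hf]
    rw [h, hφr x y h, hG.addConv_eq_of_norm_eq hφr h]
  have hmel : ∀ s : ℂ, 0 < s.re → s.re < 1 → MellinConvergent (fun u : ℝ => f u) s ∧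
      mellin (fun u : ℝ => f u) s = -logDeriv (tateGamma .real) s * mellin g s := by
    intro s hs0 hs1
    obtain ⟨h1, h2⟩ := hG.zetaIntegral_addConv g hs0 hs1
    obtain ⟨h3, h4⟩ := zetaIntegral_real hfr h1
    obtain ⟨-, h5⟩ := zetaIntegral_real hφr
      (φ.rapidDecay.integrable_mul (temperateWeight_norm_cpow hs0))
    have h6 : mellin (fun u : ℝ => φ u) s = mellin g s :=
      setIntegral_congr_fun measurableSet_Ioi fun u hu => by
        change _ • g |u| = _
        rw [abs_of_pos (mem_Ioi.1 hu)]
    refine ⟨h3, ?_⟩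
    have h7 : (2 : ℂ) * mellin (fun u : ℝ => f u) s =
        -logDeriv (tateGamma .real) s * (2 * mellin g s) := by
      rw [← h4, ← h6, ← h5]
      exact h2
    linear_combination h7 / 2
  have hz0 : ∀ t : ℝ, 0 < ((c : ℂ) + t * Complex.I).re := fun t => by rwa [re_add_mul_I]
  have hz1 : ∀ t : ℝ, ((c : ℂ) + t * Complex.I).re < 1 := fun t => by rwa [re_add_mul_I]
  have hv : Complex.VerticalIntegrable (mellin (fun u : ℝ => f u)) c := by
    refine (lineIntegrable_weilIntegrandAt .real g hc0 hc1 (y := 1) one_ne_zero).congr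
      (Eventually.of_forall fun t => ?_)
    simp only [weilIntegrandAt, norm_one, Complex.ofReal_one, Complex.one_cpow, mul_one]
    exact ((hmel _ (hz0 t) (hz1 t)).2).symm
  have hy' : 0 < ‖y‖ := norm_pos_iff.2 hy
  have hcont : ContinuousAt (fun u : ℝ => f u) ‖y‖ := by
    have h1 : Continuous (fun u : ℝ => addConv G φ u) := hG.continuous_addConv hφr
    have h2 : ContinuousAt (fun u : ℝ => -(Real.log |u| : ℂ) * φ u + addConv G φ u) ‖y‖ := by
      have h3 : Continuous fun u : ℝ => φ u := φ.rapidDecay.1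
      have h4 : ContinuousAt (fun u : ℝ => Real.log |u|) ‖y‖ := by
        simp only [Real.log_abs]
        exact Real.continuousAt_log hy'.ne'
      fun_prop
    exact h2
  have hinv := mellinInv_mellin_eq c (fun u : ℝ => f u) hy'
    (hmel c (by simpa using hc0) (by simpa using hc1)).1 hv hcont
  have h8 : f (show ℝ from ‖y‖) = f y := hfr _ _ (norm_norm y)
  refine Eq.trans ?_ (hinv.trans h8)
  rw [weilTermAt, lineIntegral, mellinInv, integral_mul_const, Complex.real_smul]
  have h9 : ∀ t : ℝ, (‖y‖ : ℂ) ^ (-(c + t * Complex.I)) • mellin (fun u : ℝ => f u) (c + t * Complex.I) =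
      weilIntegrandAt .real g y (c + t * Complex.I) := fun t => by
    rw [(hmel _ (hz0 t) (hz1 t)).2, weilIntegrandAt, smul_eq_mul]
    ring
  simp_rw [h9]
  have hI := Complex.I_ne_zero
  have hpi : (Real.pi : ℂ) ≠ 0 := by exact_mod_cast Real.pi_ne_zero
  push_cast
  field_simp

/-! ### Mellin inversion for periodic factors -/

lemma ofReal_zpow_cpow {q : ℝ} (hq : 0 < q) (n : ℤ) (s : ℂ) :
    ((q ^ n : ℝ) : ℂ) ^ s = ((q : ℂ) ^ s) ^ n := by
  have h0 : (q : ℂ) ≠ 0 := by exact_mod_cast hq.ne'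
  have h1 : ((q ^ n : ℝ) : ℂ) ≠ 0 := by exact_mod_cast (zpow_pos hq n).ne'
  rw [Complex.cpow_def_of_ne_zero h0, Complex.cpow_def_of_ne_zero h1,
    ← Complex.ofReal_log hq.le, ← Complex.ofReal_log (zpow_pos hq n).le, Real.log_zpow,
    ← Complex.exp_int_mul]
  push_cast
  ring_nf

lemma IsTestOn.lineIntegrable_mellin {a b : ℝ} {f : ℝ → ℂ} (hf : IsTestOn a b f) (c : ℝ) :
    LineIntegrable c (mellin f) := by
  obtain ⟨C, -, hC⟩ := hf.exists_pow_mul_norm_mellin_le c c 2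
  refine lineIntegrable_of_norm_le (C := C) ?_ fun t => ?_
  · exact hf.differentiable_mellin.continuous.comp (by fun_prop)
  · have := hC (c + t * Complex.I) (re_add_mul_I c t).ge (re_add_mul_I c t).le
    rwa [im_add_mul_I, mul_comm] at this

/-- Mellin inversion for test functions. -/
lemma IsTestOn.lineIntegral_mellin {a b : ℝ} {f : ℝ → ℂ} (hf : IsTestOn a b f) (c : ℝ) {u : ℝ}
    (hu : 0 < u) : ∫ t : ℝ, mellin f (c + t * Complex.I) * (u : ℂ) ^ (-(c + t * Complex.I)) =
      2 * Real.pi * f u := by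
  have h := mellinInv_mellin_eq c f hu (hf.mellinConvergent c) (hf.lineIntegrable_mellin c)
    hf.contDiff.continuous.continuousAt
  have hpi : (Real.pi : ℂ) ≠ 0 := by exact_mod_cast Real.pi_ne_zero
  rw [← h, mellinInv, Complex.real_smul]
  have e : ∀ t : ℝ, mellin f (c + t * Complex.I) * (u : ℂ) ^ (-(c + t * Complex.I)) =
      (u : ℂ) ^ (-(c + t * Complex.I)) • mellin f (c + t * Complex.I) := fun t => mul_comm _ _
  simp_rw [e]
  rw [← mul_assoc]
  push_cast
  rw [mul_one_div_cancel (by simp), one_mul]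

/-- Mellin inversion with a factor that is a Laurent series in `q ^ (-s)`: the series acts on the
function by translations by the powers of `q`. -/
lemma IsTestOn.hasSum_lineIntegral {a b : ℝ} {f : ℝ → ℂ} (hf : IsTestOn a b f) {q c u : ℝ}
    (hq : 0 < q) (hu : 0 < u) {α : ℤ → ℂ} {F : ℂ → ℂ}
    (hF : ∀ s : ℂ, s.re = c → HasSum (fun n => α n * ((q : ℂ) ^ (-s)) ^ n) (F s)) :
    HasSum (fun n => α n * f (q ^ n * u))
      (lineIntegral c fun s => F s * mellin f s * (u : ℂ) ^ (-s)) := by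
  let z : ℝ → ℂ := fun t => c + t * Complex.I
  have hre : ∀ t, (z t).re = c := fun t => re_add_mul_I c t
  set H : ℤ → ℝ → ℂ := fun n t =>
    α n * (mellin f (z t) * ((q ^ n * u : ℝ) : ℂ) ^ (-z t)) with hH
  have hcpow : ∀ (n : ℤ) (t : ℝ), ((q ^ n * u : ℝ) : ℂ) ^ (-z t) =
      ((q : ℂ) ^ (-z t)) ^ n * (u : ℂ) ^ (-z t) := fun n t => by
    rw [Complex.ofReal_mul, Complex.mul_cpow_ofReal_nonneg (zpow_pos hq n).le hu.le,
      ofReal_zpow_cpow hq]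
  have hmul : ∀ (n : ℤ) (t : ℝ), H n t =
      (α n * ((q : ℂ) ^ (-z t)) ^ n) * (mellin f (z t) * (u : ℂ) ^ (-z t)) := fun n t => by
    simp only [hH]
    rw [hcpow]
    ring
  have hnorm : ∀ (n : ℤ) (t : ℝ), ‖H n t‖ =
      ‖α n * ((q : ℂ) ^ (-(c : ℂ))) ^ n‖ * (‖mellin f (z t)‖ * u ^ (-c)) := by
    intro n t
    rw [hmul, norm_mul, norm_mul, norm_mul, norm_mul, norm_zpow, norm_zpow,
      Complex.norm_cpow_eq_rpow_re_of_pos hq, Complex.norm_cpow_eq_rpow_re_of_pos hq,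
      Complex.norm_cpow_eq_rpow_re_of_pos hu, Complex.neg_re, hre, Complex.neg_re,
      Complex.ofReal_re]
  have hcont : Continuous z := by fun_prop
  have hmeas : ∀ n, AEStronglyMeasurable (H n) := fun n => by
    refine Continuous.aestronglyMeasurable (continuous_const.mul
      ((hf.differentiable_mellin.continuous.comp hcont).mul ?_))
    exact hcont.neg.const_cpow
      (Or.inl (by exact_mod_cast (mul_pos (zpow_pos hq n) hu).ne'))
  have hi : Integrable fun t => ‖mellin f (z t)‖ * u ^ (-c) :=
    (hf.lineIntegrable_mellin c).norm.mul_const _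
  have hint : ∀ n, Integrable (H n) := fun n =>
    (hi.const_mul _).mono' (hmeas n) (Eventually.of_forall fun t => (hnorm n t).le)
  have hs : Summable fun n => ∫ t, ‖H n t‖ := by
    simp_rw [hnorm, integral_const_mul]
    exact (hF c (Complex.ofReal_re c)).summable.norm.mul_right _
  have key := hasSum_integral_of_summable_integral_norm hint hs
  have h1 : ∀ n, ∫ t, H n t = 2 * Real.pi * (α n * f (q ^ n * u)) := fun n => by
    simp only [hH]
    rw [integral_const_mul, hf.lineIntegral_mellin c (mul_pos (zpow_pos hq n) hu)]
    ring
  have h2 : ∀ t, ∑' n, H n t = F (z t) * mellin f (z t) * (u : ℂ) ^ (-z t) := fun t => by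
    simp_rw [hmul]
    rw [tsum_mul_right, (hF _ (hre t)).tsum_eq, mul_assoc]
  simp_rw [h1, h2] at key
  have hpi : (Real.pi : ℂ) ≠ 0 := by exact_mod_cast Real.pi_ne_zero
  have hI := Complex.I_ne_zero
  have h3 : lineIntegral c (fun s => F s * mellin f s * (u : ℂ) ^ (-s)) =
      (2 * Real.pi : ℂ)⁻¹ * ∫ t, F (z t) * mellin f (z t) * (u : ℂ) ^ (-z t) := by
    rw [lineIntegral, integral_mul_const]
    change 1 / (2 * (Real.pi : ℂ) * Complex.I) *
      ((∫ t, F (z t) * mellin f (z t) * (u : ℂ) ^ (-z t)) * Complex.I) = _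
    field_simp
  rw [h3]
  exact (key.mul_left (2 * Real.pi : ℂ)⁻¹).congr_fun fun n => by field_simp

/-- The coefficients of a Laurent series in `q ^ (-s)` are determined by its values on a vertical
line, as pairing with the Mellin transforms of bump functions shows. -/
lemma eq_zero_of_hasSum_zero {q c : ℝ} (hq : 1 < q) {α : ℤ → ℂ}
    (hα : ∀ s : ℂ, s.re = c → HasSum (fun n => α n * ((q : ℂ) ^ (-s)) ^ n) 0) (n : ℤ) :
    α n = 0 := by
  have hq0 : 0 < q := one_pos.trans hq
  have hlt : ∀ k : ℤ, q ^ k < q ^ (k + 1) := fun k => zpow_lt_zpow_right₀ hq (lt_add_one k)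
  have hlt' : q ^ (n - 1) < q ^ n := by simpa using hlt (n - 1)
  obtain ⟨f, hfs, -, hfd, -, hf1⟩ := exists_contDiff_tsupport_subset (n := ⊤)
    (Ioo_mem_nhds hlt' (hlt n))
  have hf : IsTestOn (q ^ (n - 1)) (q ^ (n + 1)) fun u => (f u : ℂ) :=
    { pos := zpow_pos hq0 _
      lt := hlt'.trans (hlt n)
      contDiff := Complex.ofRealCLM.contDiff.comp hfd
      tsupport_subset :=
        (tsupport_comp_subset (g := fun x : ℝ => (x : ℂ)) Complex.ofReal_zero f).trans hfs }
  have h := hf.hasSum_lineIntegral hq0 one_pos (F := fun _ => 0) hα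
  have h0 : lineIntegral c (fun s => 0 * mellin (fun u => (f u : ℂ)) s * ((1 : ℝ) : ℂ) ^ (-s)) = 0 := by
    simp [lineIntegral]
  rw [h0] at h
  have h1 : ∀ m, m ≠ n → α m * (f (q ^ m * 1) : ℂ) = 0 := by
    intro m hm
    rw [mul_one, hf.eq_zero, mul_zero]
    rintro ⟨h2, h3⟩
    rw [zpow_lt_zpow_iff_right₀ hq] at h2 h3
    omega
  have h2 := (hasSum_single n h1).unique h
  rw [mul_one, hf1, Complex.ofReal_one, mul_one] at h2
  exact h2

/-! ### The finite places -/

/-- At a finite place the zeta integral of a radial function is a Laurent series. -/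
lemma hasSum_zetaIntegral_finite (p : Nat.Primes) {f : Completion (.finite p) → ℂ}
    (hf : ∀ x y, ‖x‖ = ‖y‖ → f x = f y) {s : ℂ}
    (hi : Integrable (fun x => f x * (‖x‖ : ℂ) ^ (s - 1)) (haar (.finite p))) :
    HasSum (fun n : ℤ => standardConst (.finite p) * f (uniformizer p ^ n) *
      ((((p : ℕ) : ℝ) : ℂ) ^ (-s)) ^ n) (zetaIntegral f s) := by
  have hp := one_lt_prime p
  have hp0 := prime_pos p
  have hpc : (((p : ℕ) : ℝ) : ℂ) ≠ 0 := by exact_mod_cast hp0.ne'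
  set S : ℤ → Set (Completion (.finite p)) := fun n => {x | ‖x‖ = ((p : ℕ) : ℝ) ^ (-n)} with hS
  have hm : ∀ n, MeasurableSet (S n) := fun n => measurableSet_eq_fun measurable_norm measurable_const
  have hd : Pairwise (Function.onFun Disjoint S) := by
    intro m n hmn
    refine Set.disjoint_left.2 fun x hx hx' => hmn ?_
    have h : ((p : ℕ) : ℝ) ^ (-m) = ((p : ℕ) : ℝ) ^ (-n) := hx.symm.trans hx'
    have := zpow_right_injective₀ hp0 hp.ne' h
    omega
  have hU : (⋃ n, S n) = {0}ᶜ := by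
    ext x
    simp only [hS, mem_iUnion, mem_ofPred_eq, mem_compl_iff, mem_singleton_iff]
    constructor
    · rintro ⟨n, hn⟩ rfl
      rw [norm_zero] at hn
      exact (zpow_pos hp0 (-n)).ne hn
    · intro hx
      exact ⟨_, Padic.norm_eq_zpow_neg_valuation (p := p) hx⟩
  have hvol : ∀ n, (haar (.finite p)).real (S n) = ((p : ℕ) : ℝ) ^ (-n) * (1 - ((p : ℕ) : ℝ)⁻¹) := by
    intro n
    have h1 : S n = Metric.closedBall 0 (((p : ℕ) : ℝ) ^ (-n)) \
        Metric.closedBall 0 (((p : ℕ) : ℝ) ^ (-n - 1)) := by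
      ext x
      simp only [hS, mem_ofPred_eq, Set.mem_sdiff, mem_closedBall_zero_iff]
      constructor
      · intro hx
        rw [hx]
        exact ⟨le_rfl, not_le.2 (zpow_lt_zpow_right₀ hp (sub_one_lt _))⟩
      · rintro ⟨h1, h2⟩
        refine le_antisymm h1 (not_lt.1 fun h3 => h2 (norm_le_zpow_of_lt p ?_))
        rwa [sub_add_cancel]
    have h2 : ∀ m : ℤ, (haar (.finite p)).real (Metric.closedBall 0 (((p : ℕ) : ℝ) ^ m)) =
        ((p : ℕ) : ℝ) ^ m := fun m => by
      rw [measureReal_def]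
      exact (congrArg _ (padic_haar_closedBall p m)).trans
        (ENNReal.toReal_ofReal (zpow_pos hp0 m).le)
    rw [h1, measureReal_sdiff (Metric.closedBall_subset_closedBall
      (zpow_le_zpow_right₀ hp.le (by omega))) measurableSet_closedBall
      measure_closedBall_lt_top.ne, h2, h2,
      zpow_sub_one₀ hp0.ne']
    ring
  have hne : ∀ n : ℤ, ‖uniformizer p ^ n‖ = ((p : ℕ) : ℝ) ^ (-n) := fun n => by
    rw [norm_zpow, norm_uniformizer, inv_zpow, zpow_neg]
  have key := hasSum_integral_iUnion hm hd (hi.integrableOn)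
  have h0 : ∫ x in ⋃ n, S n, f x * (‖x‖ : ℂ) ^ (s - 1) ∂haar (.finite p) = zetaIntegral f s := by
    rw [hU, zetaIntegral]
    exact setIntegral_eq_integral_of_ae_compl_eq_zero
      (by filter_upwards [ae_ne_zero] with x hx h using absurd hx (by simpa using h))
  rw [h0] at key
  refine key.congr_fun fun n => ?_
  have h1 : ∀ x ∈ S n, f x * (‖x‖ : ℂ) ^ (s - 1) =
      f (uniformizer p ^ n) * ((((p : ℕ) : ℝ) ^ (-n) : ℝ) : ℂ) ^ (s - 1) := fun x hx => by
    rw [hf x (uniformizer p ^ n) (by rw [hne]; exact hx), show ‖x‖ = _ from hx]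
  rw [setIntegral_congr_fun (hm n) h1, setIntegral_const, hvol, Complex.real_smul,
    ofReal_zpow_cpow hp0, Complex.cpow_sub _ _ hpc, Complex.cpow_one, Complex.cpow_neg, inv_zpow', div_zpow]
  have h2 := zpow_ne_zero (-n) hpc
  push_cast at h2 ⊢
  rw [standardConst]
  field_simp

/-- The logarithmic derivative of the gamma factor at `p`, as a Laurent series in `p ^ (-s)`. -/
lemma exists_hasSum_logDeriv_tateGamma (p : Nat.Primes) : ∃ α : ℤ → ℂ, ∀ s : ℂ, 0 < s.re →
    s.re < 1 → HasSum (fun n => α n * ((((p : ℕ) : ℝ) : ℂ) ^ (-s)) ^ n)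
      (-logDeriv (tateGamma (.finite p)) s) := by
  have hpc : ((p : ℕ) : ℂ) ≠ 0 := by exact_mod_cast p.2.ne_zero
  set ℓ := Complex.log (p : ℕ) with hℓ
  refine ⟨fun n => if 0 < n then ℓ else if n = 0 then 0 else ℓ * ((p : ℕ) : ℂ) ^ n,
    fun s hs0 hs1 => ?_⟩
  have hs1' : 0 < (1 - s).re := by simpa using hs1
  have hz1 := norm_prime_cpow_neg_lt_one p hs0
  have hw1 := norm_prime_cpow_neg_lt_one p hs1'
  rw [logDeriv_tateGamma _ hs0 hs1, logDeriv_eulerFactor_finite p hs0,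
    logDeriv_eulerFactor_finite p hs1', Complex.ofReal_natCast]
  set z := ((p : ℕ) : ℂ) ^ (-s) with hz
  set w := ((p : ℕ) : ℂ) ^ (-(1 - s)) with hw
  have hz0 : z ≠ 0 := by rw [hz, Ne, Complex.cpow_eq_zero_iff]; exact fun h => hpc h.1
  have hzw : w = ((p : ℕ) : ℂ)⁻¹ * z⁻¹ := by
    rw [hw, hz, ← Complex.cpow_neg_one, ← Complex.cpow_neg, ← Complex.cpow_add _ _ hpc]
    ring_nf
  have h1 := ((hasSum_geometric_of_norm_lt_one hz1).mul_left (ℓ * z))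
  have h2 := ((hasSum_geometric_of_norm_lt_one hw1).mul_left (ℓ * w))
  have h3 : -(-(z * ℓ / (1 - z)) + -(w * ℓ / (1 - w))) =
      ℓ * z * (1 - z)⁻¹ + 0 * z ^ (0 : ℤ) + ℓ * w * (1 - w)⁻¹ := by
    ring
  rw [h3]
  refine HasSum.of_add_one_of_neg_add_one (h1.congr_fun fun n => ?_) (h2.congr_fun fun n => ?_)
  · beta_reduce
    rw [if_pos (by omega), zpow_add_one₀ hz0, zpow_natCast]
    ring
  · beta_reduce
    rw [if_neg (by omega), if_neg (by omega), mul_assoc, ← mul_zpow, hzw, ← mul_inv, zpow_neg,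
      ← inv_zpow, zpow_add_one₀ (by simp [hpc, hz0]), zpow_natCast]
    ring

/-- Both sides, at `|y| = p ^ (-k)`, are the convolution at `k` of the values of `g` at the powers
of `p` with the coefficients of `-Γ_p' / Γ_p`. -/
theorem weilTermAt_finite {p : Nat.Primes} {G : LocalDistribution (.finite p)}
    (hG : IsFourierOfNegLog (.finite p) G) (g : 𝓓(halfLine, ℂ)) {c : ℝ} (hc0 : 0 < c) (hc1 : c < 1)
    {y : Completion (.finite p)} (hy : y ≠ 0) :
    weilTermAt (.finite p) c g y =
      -(Real.log ‖y‖ : ℂ) * liftTo (.finite p) g y + addConv G (liftTo (.finite p) g) y := by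
  obtain ⟨a, b, hg⟩ := exists_isTestOn g
  obtain ⟨α, hα⟩ := exists_hasSum_logDeriv_tateGamma p
  have hp := one_lt_prime p
  have hp0 := prime_pos p
  set q : ℝ := ((p : ℕ) : ℝ) with hq
  set φ := liftTo (.finite p) g with hφ
  have hφr : ∀ x y, ‖x‖ = ‖y‖ → φ x = φ y := fun x y => liftTo_eq_of_norm_eq (.finite p) g
  set f : Completion (.finite p) → ℂ :=
    fun x => -(Real.log ‖x‖ : ℂ) * φ x + addConv G φ x with hf
  have hfr : ∀ x y, ‖x‖ = ‖y‖ → f x = f y := fun x y h => by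
    simp only [hf]
    rw [h, hφr x y h, hG.addConv_eq_of_norm_eq hφr h]
  have hne : ∀ n : ℤ, ‖uniformizer p ^ n‖ = q ^ (-n) := fun n => by
    rw [norm_zpow, norm_uniformizer, inv_zpow, zpow_neg]
  have hφn : ∀ n : ℤ, φ (uniformizer p ^ n) = g (q ^ (-n)) := fun n => by
    rw [hφ, liftTo_apply, hne]
  -- `g` vanishes at all but finitely many powers of `p`
  obtain ⟨F, hF⟩ : ∃ F : Finset ℤ, ∀ n ∉ F, g (q ^ (-n)) = 0 := by
    obtain ⟨M, hM⟩ := pow_unbounded_of_one_lt b hp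
    obtain ⟨N, hN⟩ := pow_unbounded_of_one_lt a⁻¹ hp
    refine ⟨Finset.Icc (-(M : ℤ)) N, fun n hn => hg.eq_zero fun h => hn ?_⟩
    have h1 : q ^ (-n) < q ^ (M : ℤ) := by
      rw [zpow_natCast]
      exact h.2.trans hM
    have h2 : q ^ n < q ^ (N : ℤ) := by
      rw [zpow_natCast, ← inv_inv (q ^ n), ← zpow_neg]
      exact (inv_strictAnti₀ hg.pos h.1).trans hN
    rw [zpow_lt_zpow_iff_right₀ hp] at h1 h2
    rw [Finset.mem_Icc]
    omega
  -- compare the coefficients of the two Laurent series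
  have hcoef : ∀ n : ℤ, f (uniformizer p ^ n) = ∑ m ∈ F, g (q ^ (-m)) * α (n - m) := by
    intro n
    have h := eq_zero_of_hasSum_zero (c := c) hp (α := fun n => standardConst (.finite p) *
      (f (uniformizer p ^ n) - ∑ m ∈ F, g (q ^ (-m)) * α (n - m))) (fun s hs => ?_) n
    · exact sub_eq_zero.1 ((mul_eq_zero.1 h).resolve_left (standardConst_ne_zero _))
    have hs0 : 0 < s.re := hs ▸ hc0
    have hs1 : s.re < 1 := hs ▸ hc1
    obtain ⟨h1, h2⟩ := hG.zetaIntegral_addConv g hs0 hs1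
    have h3 := hasSum_zetaIntegral_finite p hfr h1
    have h4 := hasSum_zetaIntegral_finite p hφr
      (φ.rapidDecay.integrable_mul (temperateWeight_norm_cpow hs0))
    set z := (q : ℂ) ^ (-s) with hz
    have hz0 : z ≠ 0 := by
      rw [hz, Ne, Complex.cpow_eq_zero_iff]
      exact fun h => hp0.ne' (by exact_mod_cast h.1)
    have h5 : zetaIntegral φ s = ∑ m ∈ F, standardConst (.finite p) * g (q ^ (-m)) * z ^ m := by
      have := hasSum_sum_of_ne_finset_zero (L := SummationFilter.unconditional ℤ) (s := F)
        (f := fun m : ℤ => standardConst (.finite p) * g (q ^ (-m)) * z ^ m)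
        (fun m hm => by rw [hF m hm, mul_zero, zero_mul])
      simp_rw [← hφn] at this
      rw [h4.unique this]
      simp_rw [hφn]
    have h6 : HasSum (fun n => ∑ m ∈ F,
        standardConst (.finite p) * g (q ^ (-m)) * z ^ m * (α (n - m) * z ^ (n - m)))
        (∑ m ∈ F, standardConst (.finite p) * g (q ^ (-m)) * z ^ m *
          -logDeriv (tateGamma (.finite p)) s) :=
      hasSum_sum fun m _ => (((Equiv.subRight m).hasSum_iff).2 (hα s hs0 hs1)).mul_left _
    have h7 : zetaIntegral f s = ∑ m ∈ F, standardConst (.finite p) * g (q ^ (-m)) * z ^ m *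
          -logDeriv (tateGamma (.finite p)) s := by
      rw [← Finset.sum_mul, ← h5, mul_comm]
      exact h2
    rw [← h7] at h6
    rw [← sub_self (zetaIntegral f s)]
    refine (h3.sub h6).congr_fun fun k => ?_
    rw [mul_sub, sub_mul, Finset.mul_sum, Finset.sum_mul]
    congr 1
    refine Finset.sum_congr rfl fun m _ => ?_
    rw [zpow_sub₀ hz0]
    field_simp
  -- Mellin inversion of the Laurent series of the gamma factor
  obtain ⟨k, hk⟩ : ∃ k : ℤ, ‖y‖ = q ^ (-k) := ⟨_, Padic.norm_eq_zpow_neg_valuation (p := p) hy⟩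
  have h1 := hg.hasSum_lineIntegral hp0 (norm_pos_iff.2 hy) (c := c)
    (fun s hs => hα s (hs ▸ hc0) (hs ▸ hc1))
  have h2 : HasSum (fun m => g (q ^ (-m)) * α (k - m)) (weilTermAt (.finite p) c g y) := by
    refine (((Equiv.subLeft k).hasSum_iff).2 h1).congr_fun fun m => ?_
    rw [Function.comp_apply, Equiv.subLeft_apply, hk, ← zpow_add₀ hp0.ne', mul_comm]
    congr 3
    ring
  have h3 := hasSum_sum_of_ne_finset_zero (L := SummationFilter.unconditional ℤ) (s := F)
    (f := fun m => g (q ^ (-m)) * α (k - m)) (fun m hm => by rw [hF m hm, zero_mul])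
  rw [h2.unique h3, ← hcoef k]
  exact hfr _ _ (by rw [hne, hk])

/-! ### The Weil terms at an arbitrary place -/

theorem weilTermAt_eq {v : Place} {G : LocalDistribution v} (hG : IsFourierOfNegLog v G)
    (g : 𝓓(halfLine, ℂ)) {c : ℝ} (hc0 : 0 < c) (hc1 : c < 1) {y : Completion v} (hy : y ≠ 0) :
    weilTermAt v c g y = -(Real.log ‖y‖ : ℂ) * liftTo v g y + addConv G (liftTo v g) y := by
  cases v with
  | real => exact weilTermAt_real hG g hc0 hc1 hy
  | finite p => exact weilTermAt_finite hG g hc0 hc1 hy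

theorem weilTerm_eq_addConv {v : Place} {G : LocalDistribution v} (hG : IsFourierOfNegLog v G)
    (g : 𝓓(halfLine, ℂ)) {c : ℝ} (hc : 0 < c) : weilTerm v c g = addConv G (liftTo v g) 1 := by
  rw [weilTerm_eq v g hc (c' := 1 / 2) (by norm_num), weilTerm_half_eq,
    weilTermAt_eq hG g (by norm_num) (by norm_num) one_ne_zero, norm_one, Real.log_one,
    Complex.ofReal_zero, neg_zero, zero_mul, zero_add]

end WeilLocal

open WeilLocal in
theorem mainTheorem9 (v : Place) :
    (∃ Δ : ℂ → LocalDistribution v, IsHomogeneousFamily v Δ) ∧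
    (∀ Δ : ℂ → LocalDistribution v, IsHomogeneousFamily v Δ → ∃ R : ℂ → LocalDistribution v, IsRieszKernel v Δ R) ∧
    (∃ G : LocalDistribution v, IsFourierOfNegLog v G) ∧
    ∀ (Δ R : ℂ → LocalDistribution v) (G : LocalDistribution v),
      IsHomogeneousFamily v Δ → IsRieszKernel v Δ R → IsFourierOfNegLog v G →
        (∀ φ : SchwartzBruhat v, HasDerivAt (fun s : ℂ => R s φ) (G φ) 0) ∧
        ∀ g : 𝓓(halfLine, ℂ),
          (∀ c : ℝ, 0 < c →
            LineIntegrable c (weilIntegrand v g) ∧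
            HasDerivAt (fun s : ℂ => addConv (R s) (liftTo v g) 1) (weilTerm v c g) 0 ∧
            weilTerm v c g = addConv G (liftTo v g) 1) ∧
          (∀ c : ℝ, 0 < c → c < 1 → ∀ y : Completion v, y ≠ 0 →
            LineIntegrable c (weilIntegrandAt v g y) ∧
            weilTermAt v c g y = -(Real.log ‖y‖ : ℂ) * liftTo v g y + addConv G (liftTo v g) y) := by
  refine ⟨exists_isHomogeneousFamily v, fun Δ hΔ => hΔ.exists_isRieszKernel,
    exists_isFourierOfNegLog v, fun Δ R G hΔ hR hG => ⟨hR.hasDerivAt hΔ hG, fun g => ⟨?_, ?_⟩⟩⟩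
  · intro c hc
    refine ⟨lineIntegrable_weilIntegrand v g hc, ?_, weilTerm_eq_addConv hG g hc⟩
    rw [weilTerm_eq_addConv hG g hc]
    exact hR.hasDerivAt hΔ hG (reflectAt (liftTo v g) 1)
  · exact fun c hc0 hc1 y hy =>
      ⟨lineIntegrable_weilIntegrandAt v g hc0 hc1 hy, weilTermAt_eq hG g hc0 hc1 hy⟩
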